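/- Let $f,g:[0,1)\to\mathbb R$ be continuous, $\sigma_0,\sigma_1>0$, and let $q,p$ be two probability distributions on $\mathbb R^D$. Let $\mathbf z_0\sim q$ and let $(\mathbf z_t)$ denote the solution on $[0,1)$ of the It\^o SDE $d\mathbf z=f(t)\,\mathbf z\,dt+g(t)\,d\mathbf w$ whose value at time $t=0$ is $\mathbf z_0$ plus independent normal noise of variance $\sigma_0^2$ per component, the initial data being independent of the Wiener process $\mathbf w$. Write $q_t$ for the law of this solution at time $t\in[0,1)$ (so $q_0=q*\mathcal N(\mathbf 0,\sigma_0^2\mathbf I)$), and let $p_t$ be the law obtained in the same way from $p$; choose the density of $p_t$ so that it is positive and $\log p_t$ is smooth. Put $$\boldsymbol\mu_t(\mathbf z_0)=e^{\int_0^t f(s)\,ds}\,\mathbf z_0,\qquad \sigma_t^2=\frac1{\tilde F(t)}\Big(\int_0^t\tilde F(s)g(s)^2\,ds+\sigma_0^2\Big),\qquad \tilde F(t)=e^{-2\int_0^t f(s)\,ds}.$$ Assume that $q$ and $p$ are diffused to the same normal distribution at $t=1$: as $t\uparrow1$ one has $\sigma_t^2\to\sigma_1^2$, and both $q_t$ and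 $p_t$ converge weakly to $\mathcal N(\mathbf 0,\sigma_1^2\mathbf I)$. Then for every $t\in[0,1)$ the solution started from $q$ has the normal transition kernel $q(\mathbf z_t|\mathbf z_0)=\mathcal N(\mathbf z_t;\boldsymbol\mu_t(\mathbf z_0),\sigma_t^2\mathbf I)$, i.e. the joint law of the sample $\mathbf z_0\sim q$ and the solution at time $t$ is $q(\mathbf z_t,\mathbf z_0)=q(\mathbf z_t|\mathbf z_0)\,q(\mathbf z_0)$, and $$\mathrm{CE}(q_0\,\|\,p_0)=\mathbb E_{t\sim\mathcal U[0,1]}\Big[\frac{g(t)^2}{2}\,\mathbb E_{q(\mathbf z_t,\mathbf z_0)}\big\|\nabla_{\mathbf z_t}\log q(\mathbf z_t|\mathbf z_0)-\nabla_{\mathbf z_t}\log p_t(\mathbf z_t)\big\|_2^2\Big]+\frac D2\log(2\pi e\sigma_0^2),$$ where $\mathrm{CE}(q_0\|p_0)=-\int\log p_0\,dq_0$. The identity holds in $(-\infty,+\infty]$: if one side is finite, so is the other, and they agree. -/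

import Mathlib

open MeasureTheory ProbabilityTheory Filter Set Topology
open scoped NNReal ENNReal

noncomputable section

/-- The density at `x` of the normal distribution `N(m, v I)` on `ℝ^D`. -/
def normalDensity {D : ℕ} (m : EuclideanSpace ℝ (Fin D)) (v : ℝ)
    (x : EuclideanSpace ℝ (Fin D)) : ℝ :=
  (2 * Real.pi * v) ^ (-(D : ℝ) / 2) * Real.exp (-‖x - m‖ ^ 2 / (2 * v))

/-- The factor `exp (∫₀ᵗ f)`, so that the kernel mean is `μ_t(z) = meanCoeff f t • z`. -/
def meanCoeff (f : ℝ → ℝ) (t : ℝ) : ℝ :=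
  Real.exp (∫ s in (0 : ℝ)..t, f s)

/-- The function `F t = exp (-2 ∫₀ᵗ f)`. -/
def dampingFactor (f : ℝ → ℝ) (t : ℝ) : ℝ :=
  Real.exp (-2 * ∫ s in (0 : ℝ)..t, f s)

/-- The kernel variance `σ_t² = (1 / F t) (∫₀ᵗ F s g(s)² ds + v₀)` with initial value `v₀`. -/
def noiseVar (f g : ℝ → ℝ) (v₀ t : ℝ) : ℝ :=
  1 / dampingFactor f t * ((∫ s in (0 : ℝ)..t, dampingFactor f s * g s ^ 2) + v₀)

/-- The joint law of `(z, x)` when `z` has law `ν` and, given `z`, `x` is `N(a z, v I)`. -/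
def jointLaw {D : ℕ} (ν : Measure (EuclideanSpace ℝ (Fin D))) (a v : ℝ) :
    Measure (EuclideanSpace ℝ (Fin D) × EuclideanSpace ℝ (Fin D)) :=
  (ν.prod volume).withDensity fun x => ENNReal.ofReal (normalDensity (a • x.1) v x.2)

/-- Standard `D`-dimensional Brownian motion: independent standard real Brownian coordinates. -/
structure IsBrownianMotion {D : ℕ} {Ω : Type*} [MeasurableSpace Ω]
    (w : ℝ≥0 → Ω → EuclideanSpace ℝ (Fin D)) (P : Measure Ω) : Prop where
  coord : ∀ i, IsBrownianReal (fun t ω => w t ω i) P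
  indep : iIndepFun (fun (i : Fin D) (ω : Ω) (t : ℝ≥0) => w t ω i) P

/-- `I` is the Itô integral `∫₀ᵗ g dw` of a deterministic integrand `g` that is continuous on
`[0, t]`: the limit in probability of the left-endpoint Riemann sums. -/
def IsItoIntegral {D : ℕ} {Ω : Type*} [MeasurableSpace Ω] (g : ℝ → ℝ)
    (w : ℝ≥0 → Ω → EuclideanSpace ℝ (Fin D)) (P : Measure Ω) (t : ℝ)
    (I : Ω → EuclideanSpace ℝ (Fin D)) : Prop :=
  TendstoInMeasure P
    (fun (n : ℕ) (ω : Ω) => ∑ k ∈ Finset.range n,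
      g (k * t / n) • (w (Real.toNNReal ((k + 1) * t / n)) ω - w (Real.toNNReal (k * t / n)) ω))
    atTop I

/-- `Z` solves `dz = f(t) z dt + g(t) dw` on `[0, 1)`, driven by the Brownian motion `w`, where
`Z 0` is obtained from the sample `U` of `ν` by adding normal noise of variance `v₀`, and the
initial data `(U, Z 0)` are independent of `w`. -/
structure IsLinearDiffusion {D : ℕ} {Ω : Type*} [MeasurableSpace Ω] (f g : ℝ → ℝ)
    (ν : Measure (EuclideanSpace ℝ (Fin D))) (v₀ : ℝ) (P : Measure Ω)
    (w : ℝ≥0 → Ω → EuclideanSpace ℝ (Fin D)) (U : Ω → EuclideanSpace ℝ (Fin D))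
    (Z : ℝ → Ω → EuclideanSpace ℝ (Fin D)) : Prop where
  brownian : IsBrownianMotion w P
  measurable_sample : Measurable U
  measurable : ∀ t ∈ Ico (0 : ℝ) 1, Measurable (Z t)
  initial_law : P.map (fun ω => (U ω, Z 0 ω)) = jointLaw ν 1 v₀
  indep : IndepFun (fun ω => (U ω, Z 0 ω)) (fun ω t => w t ω) P
  continuous_paths : ∀ᵐ ω ∂P, ContinuousOn (fun t => Z t ω) (Ico (0 : ℝ) 1)
  sde : ∀ t ∈ Ico (0 : ℝ) 1,
    IsItoIntegral g w P t (fun ω => Z t ω - Z 0 ω - ∫ s in (0 : ℝ)..t, f s • Z s ω)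

/-- The cross entropy `-∫ log p dq` of a measure `q` relative to a density `p`, as the difference
of the integrals of the positive and the negative part of `-log p`. -/
def crossEntropy {D : ℕ} (q : Measure (EuclideanSpace ℝ (Fin D)))
    (p : EuclideanSpace ℝ (Fin D) → ℝ) : EReal :=
  ((∫⁻ z, ENNReal.ofReal (-Real.log (p z)) ∂q : ℝ≥0∞) : EReal) -
    ((∫⁻ z, ENNReal.ofReal (Real.log (p z)) ∂q : ℝ≥0∞) : EReal)

/-- The expected squared distance, for `(z, x)` distributed as `jointLaw ν a v`, between the
kernel score `∇_x log N(x; a z, v I)` and the score `∇ log p (x)` of the density `p`. -/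
def denoisingError {D : ℕ} (ν : Measure (EuclideanSpace ℝ (Fin D))) (a v : ℝ)
    (p : EuclideanSpace ℝ (Fin D) → ℝ) : ℝ≥0∞ :=
  ∫⁻ x, ENNReal.ofReal (‖gradient (fun y => Real.log (normalDensity (a • x.1) v y)) x.2 -
    gradient (fun y => Real.log (p y)) x.2‖ ^ 2) ∂(jointLaw ν a v)

end

/-! ### Standard Gaussian measure: densities, Stein's identity, exponential moments. -/

section Gaussian

variable {D : ℕ}

local notation "𝔼" => EuclideanSpace ℝ (Fin D)
local notation "γ" => stdGaussian (EuclideanSpace ℝ (Fin D))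
local notation "⟪" x ", " y "⟫" => inner ℝ x y

/-! Condition on the sample `z` and write the noised point as `a z + √v ξ` with `ξ` standard normal.
Completing the square, the density `p_t` there is the density of the noise times `tiltMass
(recentered p z) r ξ`, the likelihood ratio of a Gaussian channel of amplitude `r = a / √v`
(`mixtureDensity_eq`). By Tweedie's formula the kernel score minus the score of `p_t` is `-(a / v)`
times the posterior mean `m` of that channel.

The core is `hasDerivAt_freeEnergy`, an identity of I-MMSE type: the Gaussian average of `log
tiltMass` has `r`-derivative `-r E‖m‖²`. Indeed the pointwise derivative is `⟪m, ξ⟫ - r M₂`, where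
`M₂` is the posterior second moment, and Stein's identity turns `E⟪m, ξ⟫` into `r E(M₂ - ‖m‖²)`. No
moment of `p` is required, since the Gaussian weight controls `‖b‖²` once `r > 0`.

Along the noise schedule `r = signalRatio` equals `(scaledVar + σ₀²)^(-1/2)`, and `-r r'` is exactly
the weight `g² / 2 · a² / v²`. So for each `z` the time integral of the error is the free energy at
the limiting ratio minus the free energy at `1 / σ₀`. The limit exists by monotonicity, and
comparing characteristic functions at time `1` shows that it is `0` or that `q` and `p` are both the
point mass at `0`; either way the terminal free energy vanishes. The initial free energy is what
separates the cross entropy from the entropy of the noise. All integrands averaged over `q` and `t`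
are nonnegative, so Tonelli applies and infinite values need no separate argument.

For the transition kernel, multiply by the integrating factor `exp (-∫ f)`. Pathwise summation by
parts exhibits `exp (-∫ f) Z_t - Z_0` as a limit of weighted increments of the Itô integrals in the
equation. Those are Wiener integrals, hence centered normal and independent of the initial data, and
both properties survive limits in probability. -/

lemma normalDensity_nonneg (m : 𝔼) {v : ℝ} (hv : 0 < v) (x : 𝔼) : 0 ≤ normalDensity m v x := by
  unfold normalDensity; positivity

lemma continuous_normalDensity (m : 𝔼) (v : ℝ) : Continuous (normalDensity m v) := by
  unfold normalDensity; fun_prop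

lemma integrable_normalDensity (m : 𝔼) {v : ℝ} (hv : 0 < v) :
    Integrable (normalDensity m v) := by
  have h := GaussianFourier.integrable_cexp_neg_mul_sq_norm_add (V := 𝔼) (b := ((1 / (2 * v) : ℝ) : ℂ))
    (by rw [Complex.ofReal_re]; positivity) 0 0
  have h2 : Integrable (fun x : 𝔼 => Real.exp (-‖x‖ ^ 2 / (2 * v))) := by
    convert h.re using 2 with x
    have : (-((1 / (2 * v) : ℝ) : ℂ) * (‖x‖ : ℂ) ^ 2 + 0 * ((inner ℝ (0 : 𝔼) x : ℝ) : ℂ)) =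
        ((-‖x‖ ^ 2 / (2 * v) : ℝ) : ℂ) := by
      push_cast; ring
    rw [this, ← Complex.ofReal_exp]
    rfl
  exact (h2.comp_sub_right m).const_mul _

lemma integral_cexp_inner_mul_normalDensity (m : 𝔼) {v : ℝ} (hv : 0 < v) (t : 𝔼) :
    ∫ x, (normalDensity m v x : ℂ) * Complex.exp (⟪x, t⟫ * Complex.I) =
      Complex.exp (⟪m, t⟫ * Complex.I - v * ‖t‖ ^ 2 / 2) := by
  rw [← integral_add_right_eq_self _ m]
  have hb : (0 : ℝ) < ((1 / (2 * v) : ℝ) : ℂ).re := by rw [Complex.ofReal_re]; positivity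
  have h := GaussianFourier.integral_cexp_neg_mul_sq_norm_add (V := 𝔼) hb Complex.I t
  have h2 : ∀ x : 𝔼, (normalDensity m v (x + m) : ℂ) * Complex.exp (⟪x + m, t⟫ * Complex.I) =
      (((2 * Real.pi * v) ^ (-(D : ℝ) / 2) : ℝ) : ℂ) * Complex.exp (⟪m, t⟫ * Complex.I) *
        Complex.exp (-((1 / (2 * v) : ℝ) : ℂ) * (‖x‖ : ℂ) ^ 2 + Complex.I * (⟪t, x⟫ : ℝ)) := by
    intro x
    unfold normalDensity
    have he : Complex.exp ((-‖x‖ ^ 2 / (2 * v) : ℝ) : ℂ) * Complex.exp (⟪x + m, t⟫ * Complex.I) =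
        Complex.exp (⟪m, t⟫ * Complex.I) *
          Complex.exp (-((1 / (2 * v) : ℝ) : ℂ) * (‖x‖ : ℂ) ^ 2 + Complex.I * (⟪t, x⟫ : ℝ)) := by
      rw [← Complex.exp_add, ← Complex.exp_add, inner_add_left, real_inner_comm x t]
      push_cast
      congr 1
      ring
    rw [add_sub_cancel_right, Complex.ofReal_mul, Complex.ofReal_exp]
    linear_combination (((2 * Real.pi * v) ^ (-(D : ℝ) / 2) : ℝ) : ℂ) * he
  simp_rw [h2]
  rw [integral_const_mul, h]
  have hpi : ((Real.pi : ℂ) / ((1 / (2 * v) : ℝ) : ℂ)) ^ ((Module.finrank ℝ 𝔼 : ℂ) / 2) =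
      (((2 * Real.pi * v) ^ ((D : ℝ) / 2) : ℝ) : ℂ) := by
    rw [finrank_euclideanSpace_fin, Complex.ofReal_cpow (by positivity)]
    push_cast
    congr 1
    have : (v : ℂ) ≠ 0 := by exact_mod_cast hv.ne'
    field_simp
  rw [hpi]
  have hc : (((2 * Real.pi * v) ^ (-(D : ℝ) / 2) : ℝ) : ℂ) * (((2 * Real.pi * v) ^ ((D : ℝ) / 2) : ℝ) : ℂ) = 1 := by
    rw [← Complex.ofReal_mul, ← Real.rpow_add (by positivity)]
    norm_num [neg_div]
  rw [sub_eq_add_neg, Complex.exp_add]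
  have he : Complex.I ^ 2 * (‖t‖ : ℂ) ^ 2 / (4 * ((1 / (2 * v) : ℝ) : ℂ)) = -(v * ‖t‖ ^ 2 / 2) := by
    have : (v : ℂ) ≠ 0 := by exact_mod_cast hv.ne'
    rw [Complex.I_sq]
    push_cast
    field_simp
    ring
  rw [he]
  linear_combination (Complex.exp (⟪m, t⟫ * Complex.I) * Complex.exp (-(v * ‖t‖ ^ 2 / 2))) * hc

lemma charFun_map_affine_stdGaussian (m : 𝔼) {v : ℝ} (hv : 0 ≤ v) (t : 𝔼) :
    charFun ((γ).map fun ξ => m + √v • ξ) t =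
      Complex.exp (⟪m, t⟫ * Complex.I - v * ‖t‖ ^ 2 / 2) := by
  have : (γ).map (fun ξ => m + √v • ξ) = ((γ).map fun ξ => √v • ξ).map fun x => m + x := by
    rw [Measure.map_map (by fun_prop) (by fun_prop)]; rfl
  rw [this, charFun_map_const_add, charFun_map_smul, charFun_stdGaussian, norm_smul,
    Real.norm_of_nonneg (Real.sqrt_nonneg v), ← Complex.exp_add]
  congr 1
  have : ((√v : ℝ) : ℂ) ^ 2 = v := by rw [← Complex.ofReal_pow, Real.sq_sqrt hv]
  push_cast
  linear_combination (-(‖t‖ : ℂ) ^ 2 / 2) * this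

/-- Both sides have the same characteristic function. This moves every normal average to the fixed
measure `γ`, so that parameters sit in the integrand and can be differentiated. -/
theorem map_affine_stdGaussian (m : 𝔼) {v : ℝ} (hv : 0 < v) :
    (γ).map (fun ξ => m + √v • ξ) =
      volume.withDensity fun x => ENNReal.ofReal (normalDensity m v x) := by
  have hfin : IsFiniteMeasure (volume.withDensity fun x => ENNReal.ofReal (normalDensity m v x)) :=
    isFiniteMeasure_withDensity_ofReal (integrable_normalDensity m hv).hasFiniteIntegral
  have : IsProbabilityMeasure ((γ).map (fun ξ => m + √v • ξ)) :=
    Measure.isProbabilityMeasure_map (by fun_prop)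
  apply Measure.ext_of_charFun
  ext t
  rw [charFun_map_affine_stdGaussian m hv.le, charFun_apply,
    integral_withDensity_eq_integral_toReal_smul
      (continuous_normalDensity m v).measurable.ennreal_ofReal (by simp),
    ← integral_cexp_inner_mul_normalDensity m hv]
  congr with x
  rw [ENNReal.toReal_ofReal (normalDensity_nonneg m hv x)]
  simp

lemma stdGaussian_eq_withDensity :
    γ = volume.withDensity fun x => ENNReal.ofReal (normalDensity 0 1 x) := by
  rw [← map_affine_stdGaussian 0 one_pos]
  simp

lemma integrable_stdGaussian_iff {F : Type*} [NormedAddCommGroup F] [NormedSpace ℝ F] {h : 𝔼 → F} :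
    Integrable h γ ↔ Integrable fun x => normalDensity 0 1 x • h x := by
  rw [stdGaussian_eq_withDensity, integrable_withDensity_iff_integrable_smul₀'
    (continuous_normalDensity 0 1).measurable.ennreal_ofReal.aemeasurable (by simp)]
  simp_rw [ENNReal.toReal_ofReal (normalDensity_nonneg (0 : 𝔼) one_pos _)]

lemma integral_stdGaussian_eq {F : Type*} [NormedAddCommGroup F] [NormedSpace ℝ F] (h : 𝔼 → F) :
    ∫ x, h x ∂γ = ∫ x, normalDensity 0 1 x • h x := by
  rw [stdGaussian_eq_withDensity, integral_withDensity_eq_integral_toReal_smul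
    (continuous_normalDensity 0 1).measurable.ennreal_ofReal (by simp)]
  simp_rw [ENNReal.toReal_ofReal (normalDensity_nonneg (0 : 𝔼) one_pos _)]

/-- The derivative of `x ↦ ‖x‖ ^ 2` along a line. -/
lemma hasDerivAt_norm_sq_add_smul (x y : 𝔼) (t : ℝ) :
    HasDerivAt (fun t : ℝ => ‖x + t • y‖ ^ 2) (2 * ⟪x + t • y, y⟫) t := by
  have h : HasDerivAt (fun t : ℝ => x + t • y) y t := by
    simpa using ((hasDerivAt_id t).smul_const y).const_add x
  exact h.norm_sq

/-- Stein's identity for the standard Gaussian measure, in a fixed direction. -/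
theorem integral_inner_mul_stdGaussian {h h' : 𝔼 → ℝ} {u : 𝔼}
    (hd : ∀ x, HasLineDerivAt ℝ h (h' x) x u) (hi : Integrable h γ) (hi' : Integrable h' γ)
    (hiu : Integrable (fun x => ⟪x, u⟫ * h x) γ) :
    ∫ x, ⟪x, u⟫ * h x ∂γ = ∫ x, h' x ∂γ := by
  have hN : ∀ x : 𝔼, HasLineDerivAt ℝ (normalDensity 0 1) (-(normalDensity 0 1 x * ⟪x, u⟫)) x u := by
    intro x
    unfold HasLineDerivAt normalDensity
    have h1 := (((hasDerivAt_norm_sq_add_smul x u 0).neg.div_const (2 * 1)).exp).const_mul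
      ((2 * Real.pi * 1) ^ (-(D : ℝ) / 2))
    simp only [sub_zero]
    refine h1.congr_deriv ?_
    simp only [Pi.neg_apply, zero_smul, add_zero]
    ring
  rw [integrable_stdGaussian_iff] at hi hi' hiu
  have key := integral_bilinear_hasLineDerivAt_right_eq_neg_left_of_integrable (μ := volume)
    (B := ContinuousLinearMap.mul ℝ ℝ) (f := normalDensity (0 : 𝔼) 1)
    (f' := fun x => -(normalDensity 0 1 x * ⟪x, u⟫)) (g := h) (g' := h') (v := u)
    (by
      refine hiu.neg.congr (ae_of_all _ fun x => ?_)
      simp only [Pi.neg_apply, smul_eq_mul, ContinuousLinearMap.mul_apply']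
      ring) hi' hi (fun x _ => hN x) (fun x _ => hd x)
  rw [integral_stdGaussian_eq, integral_stdGaussian_eq]
  simp only [ContinuousLinearMap.mul_apply', smul_eq_mul] at key ⊢
  rw [key, ← integral_neg]
  congr with x
  ring

/-- Fernique's theorem gives a square-exponential moment, and `A‖x‖ ≤ C‖x‖² + A² / (4C)`. Functions
of this form serve as dominating functions for all Gaussian averages below. -/
lemma integrable_exp_mul_norm_stdGaussian (A : ℝ) : Integrable (fun x => Real.exp (A * ‖x‖)) γ := by
  obtain ⟨C, hC, hint⟩ := IsGaussian.exists_integrable_exp_sq γ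
  refine (hint.const_mul (Real.exp (A ^ 2 / (4 * C)))).mono' (by fun_prop) (ae_of_all _ fun x => ?_)
  rw [Real.norm_of_nonneg (Real.exp_pos _).le, ← Real.exp_add]
  apply Real.exp_le_exp.2
  have : A ^ 2 / (4 * C) + C * ‖x‖ ^ 2 - A * ‖x‖ = (A - 2 * C * ‖x‖) ^ 2 / (4 * C) := by
    field_simp; ring
  have h2 : 0 ≤ (A - 2 * C * ‖x‖) ^ 2 / (4 * C) := by positivity
  linarith

lemma integrable_norm_sq_stdGaussian : Integrable (fun x => ‖x‖ ^ 2) γ := by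
  simpa using (IsGaussian.memLp_two_id (μ := γ)).integrable_norm_pow (by norm_num)

lemma integral_norm_sq_stdGaussian : ∫ x, ‖x‖ ^ 2 ∂γ = D := by
  have hc : ∀ i : Fin D, Integrable (fun x : 𝔼 => x i ^ 2) γ := fun i =>
    integrable_norm_sq_stdGaussian.mono' (by fun_prop) (ae_of_all _ fun x => by
      rw [Real.norm_of_nonneg (sq_nonneg _), EuclideanSpace.real_norm_sq_eq]
      exact Finset.single_le_sum (f := fun i => x i ^ 2) (fun _ _ => sq_nonneg _) (Finset.mem_univ i))
  have hl : ∀ i : Fin D, Integrable (fun x : 𝔼 => x i) γ := fun i =>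
    ((integrable_const 1).add (hc i)).mono' (by fun_prop) (ae_of_all _ fun x => by
      simp only [Pi.add_apply]
      rw [Real.norm_eq_abs, abs_le]
      constructor <;> nlinarith [sq_nonneg (x i - 1), sq_nonneg (x i + 1)])
  have h1 : ∀ i : Fin D, ∫ x : 𝔼, x i ^ 2 ∂γ = 1 := by
    intro i
    have hin : ∀ x : 𝔼, ⟪x, EuclideanSpace.single i (1 : ℝ)⟫ = x i := by
      intro x; simp [EuclideanSpace.inner_single_right]
    -- Stein's identity for the coordinate function gives its variance.
    have := integral_inner_mul_stdGaussian (h := fun x : 𝔼 => x i) (h' := fun _ => 1)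
      (u := EuclideanSpace.single i (1 : ℝ)) (fun x => by
        unfold HasLineDerivAt
        simpa using (hasDerivAt_id (0 : ℝ)).const_add (x i)) (hl i) (integrable_const 1)
        (by simpa only [hin, sq] using hc i)
    simp only [hin] at this
    simpa [sq] using this
  simp_rw [EuclideanSpace.real_norm_sq_eq]
  rw [integral_finsetSum _ fun i _ => hc i]
  simp [h1]

end Gaussian

/-! ### Gaussian channel: likelihood ratio, posterior moments and their bounds. -/

section Tilt

variable {D : ℕ}

local notation "𝔼" => EuclideanSpace ℝ (Fin D)
local notation "γ" => stdGaussian (EuclideanSpace ℝ (Fin D))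
local notation "⟪" x ", " y "⟫" => inner ℝ x y

/-- The likelihood ratio of `N(r b, I)` with respect to `N(0, I)` at `ξ`. -/
noncomputable def tiltWeight (r : ℝ) (ξ b : EuclideanSpace ℝ (Fin D)) : ℝ :=
  Real.exp (r * inner ℝ b ξ - r ^ 2 * ‖b‖ ^ 2 / 2)

/-- The likelihood ratio of the mixture of the `N(r b, I)`, `b ∼ β`, with respect to `N(0, I)`. -/
noncomputable def tiltMass (β : Measure (EuclideanSpace ℝ (Fin D))) (r : ℝ)
    (ξ : EuclideanSpace ℝ (Fin D)) : ℝ :=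
  ∫ b, tiltWeight r ξ b ∂β

/-- The mean of `b` under the posterior given the observation `ξ`. -/
noncomputable def tiltMean (β : Measure (EuclideanSpace ℝ (Fin D))) (r : ℝ)
    (ξ : EuclideanSpace ℝ (Fin D)) : EuclideanSpace ℝ (Fin D) :=
  (tiltMass β r ξ)⁻¹ • ∫ b, tiltWeight r ξ b • b ∂β

/-- The second moment of `b` under the posterior given the observation `ξ`. -/
noncomputable def tiltSecondMoment (β : Measure (EuclideanSpace ℝ (Fin D))) (r : ℝ)
    (ξ : EuclideanSpace ℝ (Fin D)) : ℝ :=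
  (tiltMass β r ξ)⁻¹ * ∫ b, ‖b‖ ^ 2 * tiltWeight r ξ b ∂β

/-- The Gaussian average of the logarithmic likelihood ratio. -/
noncomputable def freeEnergy (β : Measure (EuclideanSpace ℝ (Fin D))) (r : ℝ) : ℝ :=
  ∫ ξ, Real.log (tiltMass β r ξ) ∂(stdGaussian (EuclideanSpace ℝ (Fin D)))

lemma tiltWeight_pos (r : ℝ) (ξ b : 𝔼) : 0 < tiltWeight r ξ b := Real.exp_pos _

lemma continuous_tiltWeight :
    Continuous fun x : ℝ × 𝔼 × 𝔼 => tiltWeight x.1 x.2.1 x.2.2 := by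
  unfold tiltWeight; fun_prop

lemma measurable_tiltWeight (r : ℝ) (ξ : 𝔼) : Measurable (tiltWeight r ξ) := by
  unfold tiltWeight; fun_prop

/-- The exponent is `‖ξ‖² / 2 - ‖r b - ξ‖² / 2`. The bound is uniform in `b`, so the weight is
integrable against any probability measure. -/
lemma tiltWeight_le (r : ℝ) (ξ b : 𝔼) : tiltWeight r ξ b ≤ Real.exp (‖ξ‖ ^ 2 / 2) := by
  apply Real.exp_le_exp.2
  have h := norm_sub_sq_real (r • b) ξ
  rw [norm_smul, Real.norm_eq_abs, mul_pow, sq_abs, real_inner_smul_left] at h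
  nlinarith [sq_nonneg ‖r • b - ξ‖]

lemma tiltWeight_ge {r : ℝ} (hr : 0 ≤ r) (ξ : 𝔼) {R : ℝ} {b : 𝔼} (hb : ‖b‖ ≤ R) :
    Real.exp (-(r * R * ‖ξ‖) - r ^ 2 * R ^ 2 / 2) ≤ tiltWeight r ξ b := by
  apply Real.exp_le_exp.2
  have h1 : -(‖b‖ * ‖ξ‖) ≤ ⟪b, ξ⟫ := neg_le_of_abs_le (abs_real_inner_le_norm b ξ)
  have h2 : ‖b‖ * ‖ξ‖ ≤ R * ‖ξ‖ := by gcongr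
  have h3 : ‖b‖ ^ 2 ≤ R ^ 2 := by gcongr
  have h4 : r * (-(R * ‖ξ‖)) ≤ r * ⟪b, ξ⟫ := by gcongr; linarith
  have h5 : r ^ 2 * ‖b‖ ^ 2 ≤ r ^ 2 * R ^ 2 := by gcongr
  linarith

/-- This replaces moment assumptions on `β`. If `r‖b‖ ≤ 4‖ξ‖`, then `‖b‖²` is bounded directly;
otherwise the quadratic term wins, the exponent is at most `-r²‖b‖² / 4`, and `x e⁻ˣ ≤ 1` applies.
-/
lemma norm_sq_mul_tiltWeight_le {r : ℝ} (hr : 0 < r) (ξ b : 𝔼) :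
    ‖b‖ ^ 2 * tiltWeight r ξ b ≤ 16 * ‖ξ‖ ^ 2 / r ^ 2 * tiltWeight r ξ b + 4 / r ^ 2 := by
  have hw := tiltWeight_pos r ξ b
  rcases le_total (r * ‖b‖) (4 * ‖ξ‖) with h | h
  · have h1 : ‖b‖ ^ 2 ≤ 16 * ‖ξ‖ ^ 2 / r ^ 2 := by
      rw [le_div_iff₀ (by positivity)]
      nlinarith [norm_nonneg b, norm_nonneg ξ, mul_nonneg hr.le (norm_nonneg b)]
    have h2 : 0 ≤ 4 / r ^ 2 := by positivity
    nlinarith [mul_le_mul_of_nonneg_right h1 hw.le]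
  · have h1 : tiltWeight r ξ b ≤ Real.exp (-(r ^ 2 * ‖b‖ ^ 2 / 4)) := by
      apply Real.exp_le_exp.2
      have h2 : ⟪b, ξ⟫ ≤ ‖b‖ * ‖ξ‖ := real_inner_le_norm b ξ
      have h3 : r * ⟪b, ξ⟫ ≤ r * (‖b‖ * ‖ξ‖) := by gcongr
      nlinarith [mul_le_mul_of_nonneg_left h (mul_nonneg hr.le (norm_nonneg b))]
    have h2 : r ^ 2 * ‖b‖ ^ 2 / 4 * Real.exp (-(r ^ 2 * ‖b‖ ^ 2 / 4)) ≤ 1 := by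
      rw [Real.exp_neg, ← div_eq_mul_inv, div_le_one (Real.exp_pos _)]
      linarith [Real.add_one_le_exp (r ^ 2 * ‖b‖ ^ 2 / 4)]
    have h3 : ‖b‖ ^ 2 * Real.exp (-(r ^ 2 * ‖b‖ ^ 2 / 4)) ≤ 4 / r ^ 2 := by
      rw [le_div_iff₀ (by positivity)]; linarith
    have h4 : 0 ≤ 16 * ‖ξ‖ ^ 2 / r ^ 2 * tiltWeight r ξ b := by positivity
    nlinarith [mul_le_mul_of_nonneg_left h1 (sq_nonneg ‖b‖)]

lemma one_add_norm_sq_mul_tiltWeight_le {r r₀ B : ℝ} (hr₀ : 0 < r₀) (hr : r₀ ≤ r) {ξ : 𝔼}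
    (hξ : ‖ξ‖ ≤ B) (b : 𝔼) :
    (1 + ‖b‖ ^ 2) * tiltWeight r ξ b ≤
      (1 + 16 * B ^ 2 / r₀ ^ 2) * Real.exp (B ^ 2 / 2) + 4 / r₀ ^ 2 := by
  have h1 := norm_sq_mul_tiltWeight_le (hr₀.trans_le hr) ξ b
  have h2 : tiltWeight r ξ b ≤ Real.exp (B ^ 2 / 2) :=
    (tiltWeight_le r ξ b).trans (by gcongr)
  have h3 : (1 + 16 * ‖ξ‖ ^ 2 / r ^ 2) * tiltWeight r ξ b ≤
      (1 + 16 * B ^ 2 / r₀ ^ 2) * Real.exp (B ^ 2 / 2) :=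
    mul_le_mul (by gcongr) h2 (tiltWeight_pos r ξ b).le (by positivity)
  have h4 : 4 / r ^ 2 ≤ 4 / r₀ ^ 2 := by gcongr
  linarith

variable (β : Measure (EuclideanSpace ℝ (Fin D))) [IsProbabilityMeasure β]

lemma integrable_tiltWeight (r : ℝ) (ξ : 𝔼) : Integrable (tiltWeight r ξ) β :=
  (integrable_const (Real.exp (‖ξ‖ ^ 2 / 2))).mono' (measurable_tiltWeight r ξ).aestronglyMeasurable
    (ae_of_all _ fun b => by
      rw [Real.norm_of_nonneg (tiltWeight_pos r ξ b).le]; exact tiltWeight_le r ξ b)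

lemma integrable_mul_tiltWeight {r : ℝ} (hr : 0 < r) (ξ : 𝔼) {c : 𝔼 → ℝ} (hc : Measurable c)
    {K : ℝ} (hK : ∀ b, |c b| ≤ K * (1 + ‖b‖ ^ 2)) :
    Integrable (fun b => c b * tiltWeight r ξ b) β := by
  refine (integrable_const (K * ((1 + 16 * ‖ξ‖ ^ 2 / r ^ 2) * Real.exp (‖ξ‖ ^ 2 / 2) + 4 / r ^ 2))).mono'
    (hc.mul (measurable_tiltWeight r ξ)).aestronglyMeasurable (ae_of_all _ fun b => ?_)
  have hK0 : 0 ≤ K := by simpa using (abs_nonneg _).trans (hK 0)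
  rw [norm_mul, Real.norm_eq_abs, Real.norm_of_nonneg (tiltWeight_pos r ξ b).le]
  calc _ ≤ K * (1 + ‖b‖ ^ 2) * tiltWeight r ξ b := by
        gcongr
        · exact (tiltWeight_pos r ξ b).le
        · exact hK b
    _ ≤ _ := by
      rw [mul_assoc]
      gcongr
      exact one_add_norm_sq_mul_tiltWeight_le hr le_rfl le_rfl b

lemma integrable_norm_sq_mul_tiltWeight {r : ℝ} (hr : 0 < r) (ξ : 𝔼) :
    Integrable (fun b => ‖b‖ ^ 2 * tiltWeight r ξ b) β :=
  integrable_mul_tiltWeight β hr ξ (by fun_prop) (K := 1) fun b => by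
    rw [abs_of_nonneg (by positivity)]; linarith

lemma integrable_tiltWeight_smul {r : ℝ} (hr : 0 < r) (ξ : 𝔼) :
    Integrable (fun b => tiltWeight r ξ b • b) β := by
  refine (integrable_mul_tiltWeight β hr ξ (c := fun b => 1 + ‖b‖ ^ 2) (by fun_prop) (K := 1)
    fun b => by rw [abs_of_nonneg (by positivity)]; linarith).mono'
    ((measurable_tiltWeight r ξ).smul measurable_id).aestronglyMeasurable (ae_of_all _ fun b => ?_)
  rw [norm_smul, Real.norm_of_nonneg (tiltWeight_pos r ξ b).le, mul_comm]
  gcongr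
  · exact (tiltWeight_pos r ξ b).le
  · nlinarith [sq_nonneg (‖b‖ - 1), norm_nonneg b]

/-- Some centered ball of radius `R` has positive `β`-mass `c`, and on it the weight is bounded
below. Thus the reciprocal mass grows at most exponentially in `‖ξ‖`. -/
lemma exists_tiltMass_ge : ∃ R c : ℝ, 0 ≤ R ∧ 0 < c ∧ ∀ r : ℝ, 0 ≤ r → ∀ ξ : 𝔼,
    c * Real.exp (-(r * R * ‖ξ‖) - r ^ 2 * R ^ 2 / 2) ≤ tiltMass β r ξ := by
  obtain ⟨n, hn⟩ : ∃ n : ℕ, β (Metric.closedBall 0 n) ≠ 0 := by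
    by_contra! h
    have := measure_iUnion_null h
    rw [Metric.iUnion_closedBall_nat] at this
    simp at this
  have hpos : 0 < β.real (Metric.closedBall 0 n) := ENNReal.toReal_pos hn (measure_ne_top _ _)
  refine ⟨n, β.real (Metric.closedBall 0 n), n.cast_nonneg, hpos, fun r hr ξ => ?_⟩
  calc _ = ∫ b in Metric.closedBall (0 : 𝔼) n,
        Real.exp (-(r * n * ‖ξ‖) - r ^ 2 * n ^ 2 / 2) ∂β := by simp
    _ ≤ ∫ b in Metric.closedBall (0 : 𝔼) n, tiltWeight r ξ b ∂β :=
        setIntegral_mono_on (integrable_const _).integrableOn (integrable_tiltWeight β r ξ).integrableOn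
          measurableSet_closedBall fun b hb => tiltWeight_ge hr ξ (by simpa using hb)
    _ ≤ tiltMass β r ξ :=
        setIntegral_le_integral (integrable_tiltWeight β r ξ)
          (ae_of_all _ fun b => (tiltWeight_pos r ξ b).le)

lemma tiltMass_pos (r : ℝ) (ξ : 𝔼) : 0 < tiltMass β r ξ :=
  integral_exp_pos (integrable_tiltWeight β r ξ)

lemma tiltMass_le (r : ℝ) (ξ : 𝔼) : tiltMass β r ξ ≤ Real.exp (‖ξ‖ ^ 2 / 2) := by
  calc _ ≤ ∫ b, Real.exp (‖ξ‖ ^ 2 / 2) ∂β :=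
        integral_mono (integrable_tiltWeight β r ξ) (integrable_const _) (tiltWeight_le r ξ)
    _ = _ := by simp

lemma log_tiltMass_le (r : ℝ) (ξ : 𝔼) : Real.log (tiltMass β r ξ) ≤ ‖ξ‖ ^ 2 / 2 :=
  (Real.log_le_iff_le_exp (tiltMass_pos β r ξ)).2 (tiltMass_le β r ξ)

lemma tiltSecondMoment_nonneg (r : ℝ) (ξ : 𝔼) : 0 ≤ tiltSecondMoment β r ξ :=
  mul_nonneg (inv_nonneg.2 (tiltMass_pos β r ξ).le)
    (integral_nonneg fun b => mul_nonneg (sq_nonneg _) (tiltWeight_pos r ξ b).le)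

lemma norm_tiltMean_le {r : ℝ} (hr : 0 < r) (ξ : 𝔼) :
    ‖tiltMean β r ξ‖ ≤ 1 + tiltSecondMoment β r ξ := by
  have hM := tiltMass_pos β r ξ
  have h1 : ‖∫ b, tiltWeight r ξ b • b ∂β‖ ≤
      tiltMass β r ξ + ∫ b, ‖b‖ ^ 2 * tiltWeight r ξ b ∂β := by
    unfold tiltMass
    rw [← integral_add (integrable_tiltWeight β r ξ) (integrable_norm_sq_mul_tiltWeight β hr ξ)]
    refine norm_integral_le_of_norm_le ((integrable_tiltWeight β r ξ).add
      (integrable_norm_sq_mul_tiltWeight β hr ξ)) (ae_of_all _ fun b => ?_)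
    rw [norm_smul, Real.norm_of_nonneg (tiltWeight_pos r ξ b).le]
    nlinarith [mul_nonneg (tiltWeight_pos r ξ b).le (sq_nonneg (‖b‖ - 1)),
      mul_nonneg (tiltWeight_pos r ξ b).le (norm_nonneg b),
      mul_nonneg (tiltWeight_pos r ξ b).le (sq_nonneg (‖b‖))]
  rw [tiltMean, norm_smul, Real.norm_of_nonneg (inv_nonneg.2 hM.le), tiltSecondMoment]
  calc _ ≤ (tiltMass β r ξ)⁻¹ * (tiltMass β r ξ + ∫ b, ‖b‖ ^ 2 * tiltWeight r ξ b ∂β) := by gcongr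
    _ = _ := by rw [mul_add, inv_mul_cancel₀ hM.ne']

lemma tiltSecondMoment_le {r : ℝ} (hr : 0 < r) (ξ : 𝔼) :
    tiltSecondMoment β r ξ ≤ 16 * ‖ξ‖ ^ 2 / r ^ 2 + 4 / r ^ 2 * (tiltMass β r ξ)⁻¹ := by
  have hM := tiltMass_pos β r ξ
  have h1 : ∫ b, ‖b‖ ^ 2 * tiltWeight r ξ b ∂β ≤ 16 * ‖ξ‖ ^ 2 / r ^ 2 * tiltMass β r ξ + 4 / r ^ 2 := by
    calc _ ≤ ∫ b, (16 * ‖ξ‖ ^ 2 / r ^ 2 * tiltWeight r ξ b + 4 / r ^ 2) ∂β :=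
          integral_mono (integrable_norm_sq_mul_tiltWeight β hr ξ)
            (((integrable_tiltWeight β r ξ).const_mul _).add (integrable_const _))
            (norm_sq_mul_tiltWeight_le hr ξ)
      _ = _ := by
        rw [integral_add ((integrable_tiltWeight β r ξ).const_mul _) (integrable_const _),
          integral_const_mul]
        simp [tiltMass]
  calc _ ≤ (tiltMass β r ξ)⁻¹ * (16 * ‖ξ‖ ^ 2 / r ^ 2 * tiltMass β r ξ + 4 / r ^ 2) := by
        unfold tiltSecondMoment; gcongr
    _ = _ := by field_simp

/-- Exponential growth in `‖ξ‖`, locally uniform in `r > 0`, is what permits differentiation under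
the Gaussian integral. -/
lemma exists_tiltSecondMoment_le {r₁ r₂ : ℝ} (hr₁ : 0 < r₁) (hr₂ : 0 ≤ r₂) :
    ∃ K A : ℝ, 0 ≤ K ∧ 0 ≤ A ∧ ∀ r ∈ Icc r₁ r₂, ∀ ξ : 𝔼,
      tiltSecondMoment β r ξ ≤ K * Real.exp (A * ‖ξ‖) := by
  obtain ⟨R, c, hR, hc, h⟩ := exists_tiltMass_ge β
  -- In the rate, `r₂ * R` comes from the reciprocal mass and the extra `1` absorbs `‖ξ‖² ≤ 2 exp
  -- ‖ξ‖`.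
  refine ⟨32 / r₁ ^ 2 + 4 / r₁ ^ 2 * (c⁻¹ * Real.exp (r₂ ^ 2 * R ^ 2 / 2)), 1 + r₂ * R,
    by positivity, by positivity, fun r hr ξ => ?_⟩
  have hr0 : 0 < r := hr₁.trans_le hr.1
  have h1 : (tiltMass β r ξ)⁻¹ ≤ c⁻¹ * Real.exp (r₂ ^ 2 * R ^ 2 / 2) * Real.exp ((1 + r₂ * R) * ‖ξ‖) := by
    calc _ ≤ (c * Real.exp (-(r * R * ‖ξ‖) - r ^ 2 * R ^ 2 / 2))⁻¹ :=
          inv_anti₀ (by positivity) (h r hr0.le ξ)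
      _ = c⁻¹ * Real.exp (r ^ 2 * R ^ 2 / 2 + r * R * ‖ξ‖) := by
          rw [mul_inv, ← Real.exp_neg]; congr 2; ring
      _ ≤ c⁻¹ * Real.exp (r₂ ^ 2 * R ^ 2 / 2 + (1 + r₂ * R) * ‖ξ‖) := by
          have := hr.2
          gcongr
          have : r * R ≤ r₂ * R := by gcongr
          linarith
      _ = _ := by rw [Real.exp_add]; ring
  have h2 : ‖ξ‖ ^ 2 ≤ 2 * Real.exp ((1 + r₂ * R) * ‖ξ‖) := by
    have h3 := Real.quadratic_le_exp_of_nonneg (norm_nonneg ξ)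
    have h4 : Real.exp ‖ξ‖ ≤ Real.exp ((1 + r₂ * R) * ‖ξ‖) := by
      apply Real.exp_le_exp.2
      nlinarith [mul_nonneg (mul_nonneg hr₂ hR) (norm_nonneg ξ)]
    nlinarith [norm_nonneg ξ]
  calc _ ≤ 16 * ‖ξ‖ ^ 2 / r ^ 2 + 4 / r ^ 2 * (tiltMass β r ξ)⁻¹ := tiltSecondMoment_le β hr0 ξ
    _ ≤ 16 * ‖ξ‖ ^ 2 / r₁ ^ 2 + 4 / r₁ ^ 2 * (tiltMass β r ξ)⁻¹ := by
        have := hr.1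
        have hM := (tiltMass_pos β r ξ).le
        gcongr
    _ ≤ 16 * (2 * Real.exp ((1 + r₂ * R) * ‖ξ‖)) / r₁ ^ 2 + 4 / r₁ ^ 2 *
        (c⁻¹ * Real.exp (r₂ ^ 2 * R ^ 2 / 2) * Real.exp ((1 + r₂ * R) * ‖ξ‖)) := by gcongr
    _ = _ := by ring

/-- Unlike the bound on the second moment, this one is uniform down to `r = 0`, where continuity of
the free energy is needed. -/
lemma exists_abs_log_tiltMass_le {r₂ : ℝ} (hr₂ : 0 ≤ r₂) :
    ∃ K : ℝ, ∀ r ∈ Icc 0 r₂, ∀ ξ : 𝔼, |Real.log (tiltMass β r ξ)| ≤ K * Real.exp (1 * ‖ξ‖) := by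
  obtain ⟨R, c, hR, hc, h⟩ := exists_tiltMass_ge β
  refine ⟨|Real.log c| + r₂ * R + r₂ ^ 2 * R ^ 2 / 2 + 1, fun r hr ξ => ?_⟩
  have h1 := log_tiltMass_le β r ξ
  have h2 : Real.log c + (-(r * R * ‖ξ‖) - r ^ 2 * R ^ 2 / 2) ≤ Real.log (tiltMass β r ξ) := by
    rw [← Real.log_exp (-(r * R * ‖ξ‖) - r ^ 2 * R ^ 2 / 2), ← Real.log_mul hc.ne' (Real.exp_pos _).ne']
    exact Real.log_le_log (by positivity) (h r hr.1 ξ)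
  have h3 := Real.quadratic_le_exp_of_nonneg (norm_nonneg ξ)
  have h4 : r * R * ‖ξ‖ ≤ r₂ * R * ‖ξ‖ := by have := hr.2; gcongr
  have h5 : r ^ 2 * R ^ 2 ≤ r₂ ^ 2 * R ^ 2 := by have := hr.1; have := hr.2; gcongr
  have h6 := norm_nonneg ξ
  have h7 := neg_abs_le (Real.log c)
  have h8 := abs_nonneg (Real.log c)
  have h9 : 0 ≤ r₂ * R := by positivity
  have h10 : 0 ≤ r₂ ^ 2 * R ^ 2 / 2 := by positivity
  have e1 : 1 ≤ Real.exp ‖ξ‖ := by nlinarith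
  have e2 : ‖ξ‖ ≤ Real.exp ‖ξ‖ := by nlinarith
  have e3 : ‖ξ‖ ^ 2 / 2 ≤ Real.exp ‖ξ‖ := by nlinarith
  have f1 := mul_le_mul_of_nonneg_left e1 h8
  have f2 := mul_le_mul_of_nonneg_left e2 h9
  have f3 := mul_le_mul_of_nonneg_left e1 h10
  have f4 := mul_nonneg h9 h6
  rw [one_mul, abs_le]
  constructor <;> nlinarith

/-- A single differentiation under the integral along the line `(r + t ρ, ξ + t v)`: `ρ = 0` gives
derivatives in `ξ`, while `ρ = 1`, `v = 0` gives the derivative in `r`. Quadratic growth in `b` is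
exactly what the weight can absorb. -/
lemma hasDerivAt_integral_mul_tiltWeight {c : 𝔼 → ℝ} (hc : Measurable c) {K δ r : ℝ} (hδ : 0 < δ)
    (hr : 0 < r) {ρ : ℝ} (hrδ : ∀ t ∈ Ioo (-δ) δ, r / 2 ≤ r + t * ρ) {ξ v : 𝔼}
    (hcK : ∀ b, |c b| ≤ K * (1 + ‖b‖ ^ 2))
    (hK : ∀ t ∈ Ioo (-δ) δ, ∀ b, |c b * (ρ * ⟪b, ξ + t • v⟫ + (r + t * ρ) * ⟪b, v⟫ -
      (r + t * ρ) * ρ * ‖b‖ ^ 2)| ≤ K * (1 + ‖b‖ ^ 2)) :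
    HasDerivAt (fun t => ∫ b, c b * tiltWeight (r + t * ρ) (ξ + t • v) b ∂β)
      (∫ b, c b * (ρ * ⟪b, ξ⟫ + r * ⟪b, v⟫ - r * ρ * ‖b‖ ^ 2) * tiltWeight r ξ b ∂β) 0 := by
  have hK0 : 0 ≤ K := by simpa using (abs_nonneg _).trans (hcK 0)
  set B := ‖ξ‖ + δ * ‖v‖
  have hr2 : 0 < r / 2 := by positivity
  have hmem : (0 : ℝ) ∈ Ioo (-δ) δ := ⟨by linarith, hδ⟩
  have := (hasDerivAt_integral_of_dominated_loc_of_deriv_le (μ := β) (𝕜 := ℝ)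
    (F := fun t b => c b * tiltWeight (r + t * ρ) (ξ + t • v) b)
    (F' := fun t b => c b * (ρ * ⟪b, ξ + t • v⟫ + (r + t * ρ) * ⟪b, v⟫ -
      (r + t * ρ) * ρ * ‖b‖ ^ 2) * tiltWeight (r + t * ρ) (ξ + t • v) b)
    (bound := fun _ => K * ((1 + 16 * B ^ 2 / (r / 2) ^ 2) * Real.exp (B ^ 2 / 2) + 4 / (r / 2) ^ 2))
    (x₀ := 0) (s := Ioo (-δ) δ) (Ioo_mem_nhds hmem.1 hmem.2)
    (Eventually.of_forall fun t =>
      (hc.mul (measurable_tiltWeight _ _)).aestronglyMeasurable)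
    (by simpa using integrable_mul_tiltWeight β hr ξ hc hcK)
    (((hc.mul (by fun_prop)).mul (measurable_tiltWeight _ _)).aestronglyMeasurable)
    (ae_of_all _ fun b t ht => ?_) (integrable_const _) (ae_of_all _ fun b t ht => ?_)).2
  · simpa using this
  · have hξ : ‖ξ + t • v‖ ≤ B := by
      refine (norm_add_le _ _).trans ?_
      rw [norm_smul, Real.norm_eq_abs]
      have : |t| ≤ δ := (abs_lt.2 ht).le
      simp only [B]
      gcongr
    rw [norm_mul, Real.norm_eq_abs, Real.norm_of_nonneg (tiltWeight_pos _ _ b).le]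
    calc _ ≤ K * (1 + ‖b‖ ^ 2) * tiltWeight (r + t * ρ) (ξ + t • v) b :=
          mul_le_mul_of_nonneg_right (hK t ht b) (tiltWeight_pos _ _ b).le
      _ ≤ _ := by
        rw [mul_assoc]
        exact mul_le_mul_of_nonneg_left (one_add_norm_sq_mul_tiltWeight_le hr2 (hrδ t ht) hξ b) hK0
  · have h1 : HasDerivAt (fun t : ℝ => r + t * ρ) ρ t := by
      simpa using ((hasDerivAt_id t).mul_const ρ).const_add r
    have h2 : HasDerivAt (fun t : ℝ => ⟪b, ξ + t • v⟫) ⟪b, v⟫ t := by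
      simp_rw [inner_add_right, real_inner_smul_right]
      simpa using ((hasDerivAt_id t).mul_const ⟪b, v⟫).const_add ⟪b, ξ⟫
    have h3 := ((((h1.mul h2).sub (((h1.pow 2).mul_const (‖b‖ ^ 2)).div_const 2)).exp).const_mul (c b))
    refine h3.congr_deriv ?_
    simp only [Pi.mul_apply, Pi.sub_apply, Pi.pow_apply, tiltWeight]
    ring

end Tilt

/-! ### Derivatives of the channel and the free energy identity. -/

section FreeEnergy

variable {D : ℕ}

local notation "𝔼" => EuclideanSpace ℝ (Fin D)
local notation "γ" => stdGaussian (EuclideanSpace ℝ (Fin D))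
local notation "⟪" x ", " y "⟫" => inner ℝ x y

lemma sum_inner_sq_basisFun (b : 𝔼) :
    ∑ i, ⟪b, EuclideanSpace.basisFun (Fin D) ℝ i⟫ ^ 2 = ‖b‖ ^ 2 :=
  (EuclideanSpace.basisFun (Fin D) ℝ).sum_sq_inner_left b

variable (β : Measure (EuclideanSpace ℝ (Fin D))) [IsProbabilityMeasure β]

lemma abs_mul_inner_le_mul_one_add_norm_sq (b v : 𝔼) : |⟪b, v⟫| ≤ ‖v‖ * (1 + ‖b‖ ^ 2) := by
  refine (abs_real_inner_le_norm b v).trans ?_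
  rw [mul_comm]
  gcongr
  nlinarith [sq_nonneg (‖b‖ - 1), norm_nonneg b]

lemma hasLineDerivAt_tiltMass {r : ℝ} (hr : 0 < r) (ξ v : 𝔼) :
    HasLineDerivAt ℝ (tiltMass β r) (r * ∫ b, ⟪b, v⟫ * tiltWeight r ξ b ∂β) ξ v := by
  have h := hasDerivAt_integral_mul_tiltWeight β (c := fun _ => 1) (ρ := 0) (ξ := ξ) (v := v)
    (K := 1 + r * ‖v‖) measurable_const one_pos hr (fun t _ => by linarith)
    (fun b => by
      rw [abs_one]
      nlinarith [sq_nonneg ‖b‖, mul_nonneg hr.le (norm_nonneg v),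
        mul_nonneg (mul_nonneg hr.le (norm_nonneg v)) (sq_nonneg ‖b‖)])
    (fun t _ b => by
      simp only [zero_mul, mul_zero, add_zero, one_mul, zero_add, sub_zero]
      rw [abs_mul, abs_of_pos hr]
      have := mul_le_mul_of_nonneg_left (abs_mul_inner_le_mul_one_add_norm_sq b v) hr.le
      nlinarith [sq_nonneg ‖b‖])
  simp only [one_mul, mul_zero, add_zero, zero_mul, zero_add, sub_zero, mul_assoc,
    integral_const_mul] at h
  exact h

lemma hasLineDerivAt_integral_inner_mul_tiltWeight {r : ℝ} (hr : 0 < r) (ξ v : 𝔼) :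
    HasLineDerivAt ℝ (fun ξ => ∫ b, ⟪b, v⟫ * tiltWeight r ξ b ∂β)
      (r * ∫ b, ⟪b, v⟫ ^ 2 * tiltWeight r ξ b ∂β) ξ v := by
  have h := hasDerivAt_integral_mul_tiltWeight β (c := fun b => ⟪b, v⟫) (ρ := 0) (ξ := ξ) (v := v)
    (K := ‖v‖ + r * ‖v‖ ^ 2) (by fun_prop) one_pos hr (fun t _ => by linarith)
    (fun b => by
      have := abs_mul_inner_le_mul_one_add_norm_sq b v
      nlinarith [mul_nonneg (mul_nonneg hr.le (sq_nonneg ‖v‖)) (sq_nonneg ‖b‖),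
        mul_nonneg hr.le (sq_nonneg ‖v‖)])
    (fun t _ b => by
      simp only [zero_mul, mul_zero, add_zero, zero_add, sub_zero]
      rw [abs_mul, abs_mul, abs_of_pos hr]
      have h1 : |⟪b, v⟫| * |⟪b, v⟫| ≤ (‖b‖ * ‖v‖) * (‖b‖ * ‖v‖) :=
        mul_self_le_mul_self (abs_nonneg _) (abs_real_inner_le_norm b v)
      nlinarith [mul_le_mul_of_nonneg_left h1 hr.le, mul_nonneg hr.le (sq_nonneg ‖v‖),
        mul_nonneg (norm_nonneg v) (sq_nonneg ‖b‖), norm_nonneg v])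
  simp only [mul_zero, add_zero, zero_mul, zero_add, sub_zero] at h
  rw [← integral_const_mul]
  refine h.congr_deriv (integral_congr_ae (ae_of_all _ fun b => ?_))
  simp only
  ring

lemma hasDerivAt_tiltMass {r : ℝ} (hr : 0 < r) (ξ : 𝔼) :
    HasDerivAt (fun r => tiltMass β r ξ)
      (∫ b, (⟪b, ξ⟫ - r * ‖b‖ ^ 2) * tiltWeight r ξ b ∂β) r := by
  -- The radius `δ = r / 2` keeps the amplitude between `r / 2` and `2 r`.
  have h := hasDerivAt_integral_mul_tiltWeight β (c := fun _ => 1) (ρ := 1) (ξ := ξ) (v := 0)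
    (δ := r / 2) (K := 1 + ‖ξ‖ + 2 * r) measurable_const (by positivity) hr
    (fun t ht => by linarith [ht.1])
    (fun b => by
      rw [abs_one]
      nlinarith [sq_nonneg ‖b‖, norm_nonneg ξ,
        mul_nonneg (norm_nonneg ξ) (sq_nonneg ‖b‖), mul_nonneg hr.le (sq_nonneg ‖b‖)])
    (fun t ht b => by
      simp only [smul_zero, add_zero, one_mul, inner_zero_right, mul_zero, mul_one]
      have h1 := abs_mul_inner_le_mul_one_add_norm_sq b ξ
      have h2 : |(r + t) * ‖b‖ ^ 2| ≤ 2 * r * ‖b‖ ^ 2 := by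
        rw [abs_mul, abs_of_nonneg (sq_nonneg ‖b‖)]
        gcongr
        rw [abs_le]
        constructor <;> linarith [ht.1, ht.2]
      have h3 := abs_sub (⟪b, ξ⟫) ((r + t) * ‖b‖ ^ 2)
      nlinarith [sq_nonneg ‖b‖])
  simp only [one_mul, mul_zero, add_zero, mul_one, smul_zero, inner_zero_right] at h
  have h4 : HasDerivAt (fun s : ℝ => s - r) 1 r := (hasDerivAt_id r).sub_const r
  have h5 : HasDerivAt (fun t => ∫ b, tiltWeight (r + t) ξ b ∂β)
      (∫ b, (⟪b, ξ⟫ - r * ‖b‖ ^ 2) * tiltWeight r ξ b ∂β) (r - r) := by rw [sub_self]; exact h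
  have := HasDerivAt.comp (h := fun s => s - r) r h5 h4
  simpa [Function.comp_def, tiltMass] using this

lemma inner_tiltMean {r : ℝ} (hr : 0 < r) (ξ v : 𝔼) :
    ⟪tiltMean β r ξ, v⟫ = (tiltMass β r ξ)⁻¹ * ∫ b, ⟪b, v⟫ * tiltWeight r ξ b ∂β := by
  rw [tiltMean, real_inner_smul_left, real_inner_comm, ← integral_inner (integrable_tiltWeight_smul β hr ξ)]
  congr 2 with b
  rw [real_inner_smul_right, real_inner_comm, mul_comm]

lemma integrable_inner_mul_tiltWeight {r : ℝ} (hr : 0 < r) (ξ v : 𝔼) :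
    Integrable (fun b => ⟪b, v⟫ * tiltWeight r ξ b) β :=
  integrable_mul_tiltWeight β hr ξ (by fun_prop) fun b => abs_mul_inner_le_mul_one_add_norm_sq b v

lemma integrable_inner_sq_mul_tiltWeight {r : ℝ} (hr : 0 < r) (ξ v : 𝔼) :
    Integrable (fun b => ⟪b, v⟫ ^ 2 * tiltWeight r ξ b) β :=
  integrable_mul_tiltWeight β hr ξ (by fun_prop) (K := ‖v‖ ^ 2) fun b => by
    rw [abs_pow]
    have h1 : |⟪b, v⟫| ^ 2 ≤ (‖b‖ * ‖v‖) ^ 2 := by gcongr; exact abs_real_inner_le_norm b v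
    nlinarith [sq_nonneg ‖v‖]

lemma hasLineDerivAt_log_tiltMass {r : ℝ} (hr : 0 < r) (ξ v : 𝔼) :
    HasLineDerivAt ℝ (fun ξ => Real.log (tiltMass β r ξ)) (r * ⟪tiltMean β r ξ, v⟫) ξ v := by
  have h : HasDerivAt _ _ _ := hasLineDerivAt_tiltMass β hr ξ v
  refine (h.log (by simpa using (tiltMass_pos β r ξ).ne')).congr_deriv ?_
  rw [inner_tiltMean β hr, zero_smul, add_zero]
  ring

/-- The derivative of a posterior mean in the observation is `r` times the posterior variance in
that direction; this is the right-hand side of Stein's identity below. -/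
lemma hasLineDerivAt_inner_tiltMean {r : ℝ} (hr : 0 < r) (ξ v : 𝔼) :
    HasLineDerivAt ℝ (fun ξ => ⟪tiltMean β r ξ, v⟫)
      (r * ((tiltMass β r ξ)⁻¹ * ∫ b, ⟪b, v⟫ ^ 2 * tiltWeight r ξ b ∂β - ⟪tiltMean β r ξ, v⟫ ^ 2))
      ξ v := by
  simp only [inner_tiltMean β hr]
  have h1 : HasDerivAt _ _ _ := hasLineDerivAt_tiltMass β hr ξ v
  have h2 : HasDerivAt _ _ _ := hasLineDerivAt_integral_inner_mul_tiltWeight β hr ξ v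
  have hM := tiltMass_pos β r ξ
  refine ((h1.inv (by simpa using hM.ne')).mul h2).congr_deriv ?_
  simp only [Pi.inv_apply, zero_smul, add_zero]
  field_simp
  ring

lemma hasDerivAt_log_tiltMass {r : ℝ} (hr : 0 < r) (ξ : 𝔼) :
    HasDerivAt (fun r => Real.log (tiltMass β r ξ))
      (⟪tiltMean β r ξ, ξ⟫ - r * tiltSecondMoment β r ξ) r := by
  refine ((hasDerivAt_tiltMass β hr ξ).log (tiltMass_pos β r ξ).ne').congr_deriv ?_
  rw [inner_tiltMean β hr, tiltSecondMoment]
  simp only [sub_mul, mul_assoc]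
  rw [integral_sub (integrable_inner_mul_tiltWeight β hr ξ ξ)
    ((integrable_norm_sq_mul_tiltWeight β hr ξ).const_mul r), integral_const_mul]
  ring

lemma sum_integral_inner_sq_basisFun {r : ℝ} (hr : 0 < r) (ξ : 𝔼) :
    ∑ i, (tiltMass β r ξ)⁻¹ *
      ∫ b, ⟪b, EuclideanSpace.basisFun (Fin D) ℝ i⟫ ^ 2 * tiltWeight r ξ b ∂β =
      tiltSecondMoment β r ξ := by
  rw [← Finset.mul_sum, ← integral_finsetSum _ fun i _ => integrable_inner_sq_mul_tiltWeight β hr ξ _]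
  simp_rw [← Finset.sum_mul, sum_inner_sq_basisFun]
  rfl

/-! ### Measurability -/

/-- The change of variables trades the measure depending on the center for a fixed `β` with a
shifted integrand, so joint measurability reduces to that of a parametric integral. -/
lemma measurable_tiltMass_map :
    Measurable fun x : ℝ × 𝔼 × 𝔼 => tiltMass (β.map fun b => b - x.2.1) x.1 x.2.2 := by
  have h : ∀ x : ℝ × 𝔼 × 𝔼, tiltMass (β.map fun b => b - x.2.1) x.1 x.2.2 =
      ∫ b, tiltWeight x.1 x.2.2 (b - x.2.1) ∂β := fun x =>
    integral_map (by fun_prop) (measurable_tiltWeight _ _).aestronglyMeasurable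
  simp_rw [h]
  refine (StronglyMeasurable.integral_prod_right' (ν := β)
    (f := fun y : (ℝ × 𝔼 × 𝔼) × 𝔼 => tiltWeight y.1.1 y.1.2.2 (y.2 - y.1.2.1)) ?_).measurable
  exact (continuous_tiltWeight.comp (by fun_prop :
    Continuous fun y : (ℝ × 𝔼 × 𝔼) × 𝔼 => (y.1.1, y.1.2.2, y.2 - y.1.2.1))).stronglyMeasurable

lemma measurable_tiltMean_map :
    Measurable fun x : ℝ × 𝔼 × 𝔼 => tiltMean (β.map fun b => b - x.2.1) x.1 x.2.2 := by
  unfold tiltMean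
  refine (measurable_tiltMass_map β).inv.smul ?_
  have h : ∀ x : ℝ × 𝔼 × 𝔼, ∫ b, tiltWeight x.1 x.2.2 b • b ∂(β.map fun b => b - x.2.1) =
      ∫ b, tiltWeight x.1 x.2.2 (b - x.2.1) • (b - x.2.1) ∂β := fun x =>
    integral_map (by fun_prop) ((measurable_tiltWeight _ _).smul measurable_id).aestronglyMeasurable
  simp_rw [h]
  refine (StronglyMeasurable.integral_prod_right' (ν := β)
    (f := fun y : (ℝ × 𝔼 × 𝔼) × 𝔼 =>
      tiltWeight y.1.1 y.1.2.2 (y.2 - y.1.2.1) • (y.2 - y.1.2.1)) ?_).measurable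
  exact ((continuous_tiltWeight.comp (by fun_prop :
    Continuous fun y : (ℝ × 𝔼 × 𝔼) × 𝔼 => (y.1.1, y.1.2.2, y.2 - y.1.2.1))).smul
      (by fun_prop)).stronglyMeasurable

lemma measurable_tiltMass (r : ℝ) : Measurable (tiltMass β r) := by
  have := (measurable_tiltMass_map β).comp (by fun_prop : Measurable fun ξ : 𝔼 => (r, (0 : 𝔼), ξ))
  simpa [Function.comp_def] using this

lemma measurable_tiltMean (r : ℝ) : Measurable (tiltMean β r) := by
  have := (measurable_tiltMean_map β).comp (by fun_prop : Measurable fun ξ : 𝔼 => (r, (0 : 𝔼), ξ))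
  simpa [Function.comp_def] using this

lemma measurable_integral_mul_tiltWeight (r : ℝ) {c : 𝔼 → ℝ} (hc : Continuous c) :
    Measurable fun ξ => ∫ b, c b * tiltWeight r ξ b ∂β := by
  refine (StronglyMeasurable.integral_prod_right' (ν := β)
    (f := fun y : 𝔼 × 𝔼 => c y.2 * tiltWeight r y.1 y.2) ?_).measurable
  exact ((hc.comp continuous_snd).mul (continuous_tiltWeight.comp (by fun_prop :
    Continuous fun y : 𝔼 × 𝔼 => (r, y.1, y.2)))).stronglyMeasurable

lemma measurable_tiltSecondMoment (r : ℝ) : Measurable (tiltSecondMoment β r) :=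
  (measurable_tiltMass β r).inv.mul (measurable_integral_mul_tiltWeight β r (by fun_prop))

/-! ### Integrability and the derivative of the free energy -/

lemma integrable_log_tiltMass {r : ℝ} (hr : 0 ≤ r) :
    Integrable (fun ξ => Real.log (tiltMass β r ξ)) γ := by
  obtain ⟨K, hK⟩ := exists_abs_log_tiltMass_le β hr
  exact ((integrable_exp_mul_norm_stdGaussian 1).const_mul K).mono'
    (measurable_tiltMass β r).log.aestronglyMeasurable (ae_of_all _ fun ξ => hK r ⟨hr, le_rfl⟩ ξ)

/-- Common integrability criterion: the second moment is at most exponential in `‖ξ‖`, so the stated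
product is too. -/
lemma integrable_of_abs_le_tiltSecondMoment {r : ℝ} (hr : 0 < r) {F : 𝔼 → ℝ} (hF : Measurable F) {C : ℝ}
    (hb : ∀ ξ, |F ξ| ≤ C * (1 + ‖ξ‖) * (1 + tiltSecondMoment β r ξ) ^ 2) : Integrable F γ := by
  obtain ⟨K, A, hK, hA, h⟩ := exists_tiltSecondMoment_le β hr hr.le
  refine ((integrable_exp_mul_norm_stdGaussian (1 + 2 * A)).const_mul (C * (1 + K) ^ 2)).mono'
    hF.aestronglyMeasurable (ae_of_all _ fun ξ => ?_)
  -- The hypothesis at `ξ = 0` already forces the sign of `C`.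
  have hC : 0 ≤ C := by
    have := (abs_nonneg _).trans (hb 0)
    by_contra! hC
    have h2 := tiltSecondMoment_nonneg β r (0 : 𝔼)
    simp only [norm_zero, add_zero, mul_one] at this
    nlinarith [sq_nonneg (1 + tiltSecondMoment β r (0 : 𝔼)),
      mul_pos (neg_pos.2 hC) (by positivity : 0 < (1 + tiltSecondMoment β r (0 : 𝔼)) ^ 2)]
  have h1 : 1 + tiltSecondMoment β r ξ ≤ (1 + K) * Real.exp (A * ‖ξ‖) := by
    have h2 := h r ⟨le_rfl, le_rfl⟩ ξ
    have h3 : 1 ≤ Real.exp (A * ‖ξ‖) := Real.one_le_exp (by positivity)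
    linarith
  have h4 : 1 + ‖ξ‖ ≤ Real.exp ‖ξ‖ := by linarith [Real.add_one_le_exp ‖ξ‖]
  have h5 := tiltSecondMoment_nonneg β r ξ
  calc _ ≤ C * (1 + ‖ξ‖) * (1 + tiltSecondMoment β r ξ) ^ 2 := hb ξ
    _ ≤ C * Real.exp ‖ξ‖ * ((1 + K) * Real.exp (A * ‖ξ‖)) ^ 2 := by gcongr
    _ = _ := by
      rw [mul_pow, ← Real.exp_nat_mul, add_mul, one_mul, Real.exp_add]
      push_cast
      ring_nf

lemma integrable_tiltSecondMoment {r : ℝ} (hr : 0 < r) : Integrable (tiltSecondMoment β r) γ :=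
  integrable_of_abs_le_tiltSecondMoment β hr (measurable_tiltSecondMoment β r) (C := 1) fun ξ => by
    have := tiltSecondMoment_nonneg β r ξ
    rw [abs_of_nonneg this]
    nlinarith [norm_nonneg ξ, mul_nonneg (norm_nonneg ξ) (sq_nonneg (1 + tiltSecondMoment β r ξ))]

lemma integrable_norm_tiltMean_sq {r : ℝ} (hr : 0 < r) : Integrable (fun ξ => ‖tiltMean β r ξ‖ ^ 2) γ :=
  integrable_of_abs_le_tiltSecondMoment β hr ((measurable_tiltMean β r).norm.pow_const 2) (C := 1)
    fun ξ => by
    have h1 := tiltSecondMoment_nonneg β r ξ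
    have h2 : ‖tiltMean β r ξ‖ ^ 2 ≤ (1 + tiltSecondMoment β r ξ) ^ 2 := by
      gcongr; exact norm_tiltMean_le β hr ξ
    rw [abs_of_nonneg (by positivity)]
    nlinarith [norm_nonneg ξ, mul_nonneg (norm_nonneg ξ) (sq_nonneg (1 + tiltSecondMoment β r ξ))]

lemma integrable_inner_tiltMean {r : ℝ} (hr : 0 < r) (v : 𝔼) :
    Integrable (fun ξ => ⟪tiltMean β r ξ, v⟫) γ :=
  integrable_of_abs_le_tiltSecondMoment β hr ((measurable_tiltMean β r).inner_const) (C := ‖v‖)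
    fun ξ => by
    have h1 := tiltSecondMoment_nonneg β r ξ
    have h2 := abs_real_inner_le_norm (tiltMean β r ξ) v
    have h3 : ‖tiltMean β r ξ‖ * ‖v‖ ≤ (1 + tiltSecondMoment β r ξ) * ‖v‖ := by
      gcongr; exact norm_tiltMean_le β hr ξ
    have h4 : (1 + tiltSecondMoment β r ξ) ≤ (1 + ‖ξ‖) * (1 + tiltSecondMoment β r ξ) ^ 2 := by
      nlinarith [norm_nonneg ξ, mul_nonneg (norm_nonneg ξ) (sq_nonneg (1 + tiltSecondMoment β r ξ))]
    nlinarith [mul_le_mul_of_nonneg_left h4 (norm_nonneg v)]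

lemma integrable_inner_mul_inner_tiltMean {r : ℝ} (hr : 0 < r) (v : 𝔼) :
    Integrable (fun ξ => ⟪ξ, v⟫ * ⟪tiltMean β r ξ, v⟫) γ :=
  integrable_of_abs_le_tiltSecondMoment β hr
    ((measurable_id.inner_const).mul ((measurable_tiltMean β r).inner_const)) (C := ‖v‖ ^ 2)
    fun ξ => by
    have h1 := tiltSecondMoment_nonneg β r ξ
    have h3 : ‖tiltMean β r ξ‖ ≤ 1 + tiltSecondMoment β r ξ := norm_tiltMean_le β hr ξ
    have h4 : (1 + tiltSecondMoment β r ξ) ≤ (1 + tiltSecondMoment β r ξ) ^ 2 := by nlinarith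
    rw [abs_mul]
    calc _ ≤ (‖ξ‖ * ‖v‖) * (‖tiltMean β r ξ‖ * ‖v‖) := by
          gcongr <;> exact abs_real_inner_le_norm _ _
      _ ≤ ((1 + ‖ξ‖) * ‖v‖) * ((1 + tiltSecondMoment β r ξ) ^ 2 * ‖v‖) := by
          gcongr
          · linarith
          · exact h3.trans h4
      _ = _ := by ring

/-- The Gaussian average of `⟪m, ξ⟫`, where `m` is the posterior mean given `ξ`. -/
lemma integral_inner_tiltMean_self {r : ℝ} (hr : 0 < r) :
    ∫ ξ, ⟪tiltMean β r ξ, ξ⟫ ∂γ =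
      r * ∫ ξ, tiltSecondMoment β r ξ ∂γ - r * ∫ ξ, ‖tiltMean β r ξ‖ ^ 2 ∂γ := by
  have hd : ∀ i, Integrable (fun ξ : 𝔼 => r * ((tiltMass β r ξ)⁻¹ *
      ∫ b, ⟪b, EuclideanSpace.basisFun (Fin D) ℝ i⟫ ^ 2 * tiltWeight r ξ b ∂β -
        ⟪tiltMean β r ξ, EuclideanSpace.basisFun (Fin D) ℝ i⟫ ^ 2)) γ := by
    intro i
    refine (((integrable_tiltSecondMoment β hr).add (integrable_norm_tiltMean_sq β hr)).mono' ?_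
      (ae_of_all _ fun ξ => ?_)).const_mul r
    · exact (((measurable_tiltMass β r).inv.mul
        (measurable_integral_mul_tiltWeight β r (by fun_prop))).sub
          ((measurable_tiltMean β r).inner_const.pow_const 2)).aestronglyMeasurable
    · have h1 : ∀ b : 𝔼, ⟪b, EuclideanSpace.basisFun (Fin D) ℝ i⟫ ^ 2 ≤ ‖b‖ ^ 2 := fun b => by
        rw [← sum_inner_sq_basisFun b]
        exact Finset.single_le_sum (f := fun i => ⟪b, EuclideanSpace.basisFun (Fin D) ℝ i⟫ ^ 2)
          (fun _ _ => sq_nonneg _) (Finset.mem_univ i)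
      have h2 : (tiltMass β r ξ)⁻¹ *
          ∫ b, ⟪b, EuclideanSpace.basisFun (Fin D) ℝ i⟫ ^ 2 * tiltWeight r ξ b ∂β ≤
          tiltSecondMoment β r ξ := by
        unfold tiltSecondMoment
        refine mul_le_mul_of_nonneg_left ?_ (inv_nonneg.2 (tiltMass_pos β r ξ).le)
        exact integral_mono (integrable_inner_sq_mul_tiltWeight β hr ξ _)
          (integrable_norm_sq_mul_tiltWeight β hr ξ) fun b =>
            mul_le_mul_of_nonneg_right (h1 b) (tiltWeight_pos r ξ b).le
      have h3 : 0 ≤ (tiltMass β r ξ)⁻¹ *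
          ∫ b, ⟪b, EuclideanSpace.basisFun (Fin D) ℝ i⟫ ^ 2 * tiltWeight r ξ b ∂β :=
        mul_nonneg (inv_nonneg.2 (tiltMass_pos β r ξ).le)
          (integral_nonneg fun b => mul_nonneg (sq_nonneg _) (tiltWeight_pos r ξ b).le)
      have h4 := h1 (tiltMean β r ξ)
      have h5 := sq_nonneg ⟪tiltMean β r ξ, EuclideanSpace.basisFun (Fin D) ℝ i⟫
      have h6 := tiltSecondMoment_nonneg β r ξ
      rw [Real.norm_eq_abs, abs_le]
      simp only [Pi.add_apply]
      constructor <;> linarith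
  have hsum : ∀ ξ : 𝔼, ⟪tiltMean β r ξ, ξ⟫ = ∑ i, ⟪ξ, EuclideanSpace.basisFun (Fin D) ℝ i⟫ *
      ⟪tiltMean β r ξ, EuclideanSpace.basisFun (Fin D) ℝ i⟫ := by
    intro ξ
    rw [← (EuclideanSpace.basisFun (Fin D) ℝ).sum_inner_mul_inner (tiltMean β r ξ) ξ]
    refine Finset.sum_congr rfl fun i _ => ?_
    rw [mul_comm, real_inner_comm ξ]
  simp_rw [hsum]
  rw [integral_finsetSum _ fun i _ => integrable_inner_mul_inner_tiltMean β hr _]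
  -- Stein's identity in each basis direction; summing the directional variances gives the trace of
  -- the posterior covariance, `tiltSecondMoment - ‖tiltMean‖²`.
  simp_rw [integral_inner_mul_stdGaussian (fun ξ => hasLineDerivAt_inner_tiltMean β hr ξ _)
    (integrable_inner_tiltMean β hr _) (hd _) (integrable_inner_mul_inner_tiltMean β hr _)]
  rw [← integral_finsetSum _ fun i _ => hd i, ← integral_const_mul, ← integral_const_mul,
    ← integral_sub ((integrable_tiltSecondMoment β hr).const_mul r)
      ((integrable_norm_tiltMean_sq β hr).const_mul r)]
  congr with ξ
  rw [← Finset.mul_sum, Finset.sum_sub_distrib, sum_integral_inner_sq_basisFun β hr,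
    sum_inner_sq_basisFun]
  ring

/-- The derivative of the free energy in the square root of the signal-to-noise ratio. -/
theorem hasDerivAt_freeEnergy {r : ℝ} (hr : 0 < r) :
    HasDerivAt (freeEnergy β) (-(r * ∫ ξ, ‖tiltMean β r ξ‖ ^ 2 ∂γ)) r := by
  obtain ⟨K, A, hK, hA, h⟩ := exists_tiltSecondMoment_le β (r₁ := r / 2) (r₂ := 2 * r)
    (by positivity) (by positivity)
  have hmem : r ∈ Ioo (r / 2) (2 * r) := ⟨by linarith, by linarith⟩
  have hint : Integrable (fun ξ => ⟪tiltMean β r ξ, ξ⟫) γ :=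
    integrable_of_abs_le_tiltSecondMoment β hr ((measurable_tiltMean β r).inner measurable_id)
      (C := 1) fun ξ => by
      have h1 := tiltSecondMoment_nonneg β r ξ
      have h2 := abs_real_inner_le_norm (tiltMean β r ξ) ξ
      have h3 : ‖tiltMean β r ξ‖ * ‖ξ‖ ≤ (1 + tiltSecondMoment β r ξ) * (1 + ‖ξ‖) := by
        gcongr
        · exact norm_tiltMean_le β hr ξ
        · linarith
      nlinarith [mul_nonneg (by positivity : 0 ≤ 1 + ‖ξ‖) (mul_nonneg h1 (by linarith : 0 ≤ 1 + tiltSecondMoment β r ξ))]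
  have key := (hasDerivAt_integral_of_dominated_loc_of_deriv_le (μ := γ) (𝕜 := ℝ)
    (F := fun r ξ => Real.log (tiltMass β r ξ))
    (F' := fun r ξ => ⟪tiltMean β r ξ, ξ⟫ - r * tiltSecondMoment β r ξ)
    (bound := fun ξ => (1 + K + 2 * r * K) * Real.exp ((A + 1) * ‖ξ‖))
    (x₀ := r) (s := Ioo (r / 2) (2 * r)) (Ioo_mem_nhds hmem.1 hmem.2)
    (Eventually.of_forall fun r => (measurable_tiltMass β r).log.aestronglyMeasurable)
    (integrable_log_tiltMass β hr.le)
    (((measurable_tiltMean β r).inner measurable_id).sub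
      ((measurable_tiltSecondMoment β r).const_mul r)).aestronglyMeasurable
    (ae_of_all _ fun ξ s hs => ?_) ((integrable_exp_mul_norm_stdGaussian (A + 1)).const_mul _)
    (ae_of_all _ fun ξ s hs => hasDerivAt_log_tiltMass β (by linarith [hs.1]) ξ)).2
  · refine key.congr_deriv ?_
    -- After Stein's identity the two second-moment terms cancel, leaving only the squared posterior
    -- mean.
    rw [integral_sub hint ((integrable_tiltSecondMoment β hr).const_mul r),
      integral_inner_tiltMean_self β hr, integral_const_mul]
    ring
  · have hs0 : 0 < s := by linarith [hs.1]
    have h1 := h s ⟨hs.1.le, hs.2.le⟩ ξ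
    have h2 := tiltSecondMoment_nonneg β s ξ
    have h3 : 1 ≤ Real.exp (A * ‖ξ‖) := Real.one_le_exp (by positivity)
    have h4 : 1 + ‖ξ‖ ≤ Real.exp ‖ξ‖ := by linarith [Real.add_one_le_exp ‖ξ‖]
    have h5 := norm_nonneg ξ
    have h6 : ‖tiltMean β s ξ‖ ≤ (1 + K) * Real.exp (A * ‖ξ‖) := by
      linarith [norm_tiltMean_le β hs0 ξ]
    calc _ ≤ |⟪tiltMean β s ξ, ξ⟫| + |s * tiltSecondMoment β s ξ| := abs_sub _ _
      _ ≤ ‖tiltMean β s ξ‖ * ‖ξ‖ + s * tiltSecondMoment β s ξ := by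
          rw [abs_of_nonneg (mul_nonneg hs0.le h2)]
          gcongr
          exact abs_real_inner_le_norm _ _
      _ ≤ ((1 + K) * Real.exp (A * ‖ξ‖)) * Real.exp ‖ξ‖ +
          2 * r * (K * Real.exp (A * ‖ξ‖)) * Real.exp ‖ξ‖ := by
          refine add_le_add (mul_le_mul h6 (by linarith) h5 (by positivity)) ?_
          calc s * tiltSecondMoment β s ξ ≤ 2 * r * (K * Real.exp (A * ‖ξ‖)) :=
                mul_le_mul hs.2.le h1 h2 (by positivity)
            _ ≤ _ := le_mul_of_one_le_right (by positivity) (by linarith)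
      _ = _ := by rw [add_mul A, one_mul, Real.exp_add]; ring

lemma continuous_tiltMass_left (ξ : 𝔼) : Continuous fun r => tiltMass β r ξ :=
  continuous_of_dominated (fun r => (measurable_tiltWeight r ξ).aestronglyMeasurable)
    (fun r => ae_of_all _ fun b => by
      rw [Real.norm_of_nonneg (tiltWeight_pos r ξ b).le]; exact tiltWeight_le r ξ b)
    (integrable_const _) (ae_of_all _ fun b => by unfold tiltWeight; fun_prop)

/-- The endpoint `0` is included because the limiting signal ratio may be `0`, where the derivative
formula is unavailable. -/
lemma continuousOn_freeEnergy : ContinuousOn (freeEnergy β) (Ici 0) := by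
  intro r hr
  obtain ⟨K, hK⟩ := exists_abs_log_tiltMass_le β (r₂ := r + 1) (by have : 0 ≤ r := hr; linarith)
  refine continuousWithinAt_of_dominated (bound := fun ξ => K * Real.exp (1 * ‖ξ‖))
    (Eventually.of_forall fun r => (measurable_tiltMass β r).log.aestronglyMeasurable) ?_
    ((integrable_exp_mul_norm_stdGaussian 1).const_mul K) (ae_of_all _ fun ξ => ?_)
  · filter_upwards [self_mem_nhdsWithin, mem_nhdsWithin_of_mem_nhds (Iio_mem_nhds (lt_add_one r))]
      with s hs0 hs1
    exact ae_of_all _ fun ξ => hK s ⟨hs0, le_of_lt hs1⟩ ξ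
  · exact ((continuous_tiltMass_left β ξ).log fun r => (tiltMass_pos β r ξ).ne').continuousWithinAt

lemma freeEnergy_zero : freeEnergy β 0 = 0 := by
  simp [freeEnergy, tiltMass, tiltWeight]

lemma freeEnergy_dirac_zero (r : ℝ) : freeEnergy (Measure.dirac (0 : 𝔼)) r = 0 := by
  simp [freeEnergy, tiltMass, tiltWeight]

/-- The free energy decreases from its value `0` at `r = 0`. Consequently `ENNReal.ofReal
(-freeEnergy _ _)` loses nothing. -/
lemma freeEnergy_nonpos {r : ℝ} (hr : 0 ≤ r) : freeEnergy β r ≤ 0 := by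
  have hanti : AntitoneOn (freeEnergy β) (Ici 0) := by
    refine antitoneOn_of_deriv_nonpos (convex_Ici 0) (continuousOn_freeEnergy β) ?_ ?_
    · intro x hx
      rw [interior_Ici] at hx
      exact (hasDerivAt_freeEnergy β hx).differentiableAt.differentiableWithinAt
    · intro x hx
      rw [interior_Ici] at hx
      rw [(hasDerivAt_freeEnergy β hx).deriv, neg_nonpos]
      exact mul_nonneg (le_of_lt hx) (integral_nonneg fun ξ => sq_nonneg _)
  simpa [freeEnergy_zero] using hanti self_mem_Ici hr hr

end FreeEnergy

/-! ### Uniform partitions: step functions, Riemann sums, integrating factors. -/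

section Partition

lemma mem_Icc_of_mem_cell {t x : ℝ} (ht : 0 ≤ t) {n k : ℕ} (hk : k < n)
    (hx : x ∈ Icc (k * t / n) ((k + 1) * t / n)) : x ∈ Icc 0 t := by
  have hn : (0 : ℝ) < n := by exact_mod_cast (Nat.zero_le k).trans_lt hk
  have hk' : (k : ℝ) + 1 ≤ n := by exact_mod_cast hk
  refine ⟨le_trans (by positivity) hx.1, hx.2.trans ?_⟩
  rw [div_le_iff₀ hn, mul_comm t]
  gcongr

lemma left_mem_cell {t : ℝ} (ht : 0 ≤ t) (n k : ℕ) :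
    (k * t / n : ℝ) ∈ Icc (k * t / n : ℝ) ((k + 1) * t / n) :=
  ⟨le_rfl, by gcongr; linarith⟩

lemma right_mem_cell {t : ℝ} (ht : 0 ≤ t) (n k : ℕ) :
    ((k + 1) * t / n : ℝ) ∈ Icc (k * t / n : ℝ) ((k + 1) * t / n) :=
  ⟨by gcongr; linarith, le_rfl⟩

lemma sum_indicator_Ioc_eq_zero {t x : ℝ} (ht : 0 ≤ t) (hx : x ∉ Ioc 0 t) (n : ℕ) (c : ℕ → ℝ) :
    ∑ k ∈ Finset.range n, (Ioc (k * t / n : ℝ) ((k + 1) * t / n)).indicator (fun _ => c k) x = 0 := by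
  refine Finset.sum_eq_zero fun k hk => indicator_of_notMem (fun h => hx ?_) _
  have h1 := mem_Icc_of_mem_cell ht (Finset.mem_range.1 hk) ⟨h.1.le, h.2⟩
  exact ⟨lt_of_le_of_lt (by positivity) h.1, h1.2⟩

lemma exists_sum_indicator_Ioc_eq {t x : ℝ} (hx : x ∈ Ioc 0 t) {n : ℕ} (hn : 0 < n) :
    ∃ m < n, x ∈ Ioc (m * t / n : ℝ) ((m + 1) * t / n) ∧ ∀ c : ℕ → ℝ,
      ∑ k ∈ Finset.range n, (Ioc (k * t / n : ℝ) ((k + 1) * t / n)).indicator (fun _ => c k) x = c m := by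
  have ht : 0 < t := hx.1.trans_le hx.2
  have hn' : (0 : ℝ) < n := by exact_mod_cast hn
  have hmem : ∀ k : ℕ, x ∈ Ioc (k * t / n : ℝ) ((k + 1) * t / n) ↔
      (k : ℝ) < x * n / t ∧ x * n / t ≤ k + 1 := by
    intro k
    rw [mem_Ioc, div_lt_iff₀ hn', le_div_iff₀ hn', lt_div_iff₀ ht, div_le_iff₀ ht]
  have hpos : 0 < x * n / t := by have := hx.1; positivity
  have hle : x * n / t ≤ n := by
    rw [div_le_iff₀ ht, mul_comm]
    exact mul_le_mul_of_nonneg_left hx.2 hn'.le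
  -- The cells are open on the left, so the index of the cell containing `x` is the ceiling of `x n
  -- / t` minus one.
  have hc : 0 < ⌈x * n / t⌉₊ := Nat.ceil_pos.2 hpos
  obtain ⟨m, hm⟩ : ∃ m, ⌈x * n / t⌉₊ = m + 1 := ⟨_, (Nat.succ_pred_eq_of_pos hc).symm⟩
  have h1 : (m : ℝ) < x * n / t := Nat.lt_ceil.1 (by omega)
  have h2 : x * n / t ≤ m + 1 := by
    have := Nat.le_ceil (x * n / t)
    rw [hm] at this
    exact_mod_cast this
  have hmn : m < n := by exact_mod_cast h1.trans_le hle
  refine ⟨m, hmn, (hmem m).2 ⟨h1, h2⟩, fun c => ?_⟩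
  rw [Finset.sum_eq_single m]
  · exact indicator_of_mem ((hmem m).2 ⟨h1, h2⟩) _
  · intro k _ hk
    refine indicator_of_notMem (fun h => hk ?_) _
    obtain ⟨h3, h4⟩ := (hmem k).1 h
    have h5 : (k : ℝ) < m + 1 := h3.trans_le h2
    have h6 : (m : ℝ) < k + 1 := h1.trans_le h4
    have h5' : k < m + 1 := by exact_mod_cast h5
    have h6' : m < k + 1 := by exact_mod_cast h6
    omega
  · intro h
    exact absurd (Finset.mem_range.2 hmn) h

lemma abs_sum_indicator_Ioc_le {t K : ℝ} (ht : 0 ≤ t) (hK : 0 ≤ K) {n : ℕ} {c : ℕ → ℝ}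
    (hc : ∀ k < n, |c k| ≤ K) (x : ℝ) :
    |∑ k ∈ Finset.range n, (Ioc (k * t / n : ℝ) ((k + 1) * t / n)).indicator (fun _ => c k) x| ≤ K := by
  by_cases hx : x ∈ Ioc 0 t
  · rcases Nat.eq_zero_or_pos n with rfl | hn
    · simpa using hK
    · obtain ⟨m, hm, -, h⟩ := exists_sum_indicator_Ioc_eq hx hn
      rw [h]
      exact hc m hm
  · rw [sum_indicator_Ioc_eq_zero ht hx]
    simpa using hK

/-- The tag of the cell containing `x` lies within `t / n` of `x`. Arbitrary tags are allowed
because Itô sums use left endpoints and the integrating factor uses right ones. -/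
lemma tendsto_sum_indicator_Ioc {t : ℝ} (ht : 0 ≤ t) {φ : ℝ → ℝ} (hφ : ContinuousOn φ (Icc 0 t))
    {p : ℕ → ℕ → ℝ} (hp : ∀ n k : ℕ, p n k ∈ Icc (k * t / n : ℝ) ((k + 1) * t / n)) (x : ℝ) :
    Tendsto (fun n : ℕ => ∑ k ∈ Finset.range n,
      (Ioc (k * t / n : ℝ) ((k + 1) * t / n)).indicator (fun _ => φ (p n k)) x) atTop
      (𝓝 ((Ioc 0 t).indicator φ x)) := by
  by_cases hx : x ∈ Ioc 0 t
  · rw [indicator_of_mem hx]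
    have hφx := hφ x ⟨hx.1.le, hx.2⟩
    have hex : ∀ n : ℕ, ∃ y ∈ Icc 0 t, |y - x| ≤ t / n ∧ (0 < n → ∑ k ∈ Finset.range n,
        (Ioc (k * t / n : ℝ) ((k + 1) * t / n)).indicator (fun _ => φ (p n k)) x = φ y) := by
      intro n
      rcases Nat.eq_zero_or_pos n with rfl | hn
      -- For `n = 0` the bound `t / 0` is `0`, so `y = x` is the consistent choice.
      · exact ⟨x, ⟨hx.1.le, hx.2⟩, by simp, fun h => absurd h (lt_irrefl 0)⟩
      · obtain ⟨m, hm, hxm, h⟩ := exists_sum_indicator_Ioc_eq hx hn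
        refine ⟨p n m, mem_Icc_of_mem_cell ht hm (hp n m), ?_, fun _ => h fun k => φ (p n k)⟩
        have h1 := hp n m
        have h2 : ((m : ℝ) + 1) * t / n = m * t / n + t / n := by ring
        rw [h2] at h1 hxm
        rw [abs_le]
        constructor <;> linarith [h1.1, h1.2, hxm.1, hxm.2]
    choose y hy hyx hys using hex
    have hlim : Tendsto y atTop (𝓝[Icc 0 t] x) := by
      refine tendsto_nhdsWithin_iff.2 ⟨?_, Eventually.of_forall hy⟩
      rw [tendsto_iff_norm_sub_tendsto_zero]
      exact squeeze_zero (fun _ => norm_nonneg _) hyx (tendsto_const_div_atTop_nhds_zero_nat t)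
    refine (hφx.tendsto.comp hlim).congr' ?_
    filter_upwards [eventually_gt_atTop 0] with n hn using (hys n hn).symm
  · rw [indicator_of_notMem hx]
    simp_rw [sum_indicator_Ioc_eq_zero ht hx]
    exact tendsto_const_nhds

/-- On a fine partition all arguments are close to the diagonal, so uniform continuity on the cube
makes the integrand small, and the cells have total length `t`. -/
lemma tendsto_sum_integral_diagonal {F : Type*} [NormedAddCommGroup F] [NormedSpace ℝ F]
    {Ψ : ℝ × ℝ × ℝ → F} (hΨ : Continuous Ψ) (h0 : ∀ s, Ψ (s, s, s) = 0) {t : ℝ} (ht : 0 ≤ t) :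
    Tendsto (fun n : ℕ => ∑ k ∈ Finset.range n,
      ∫ s in (k * t / n : ℝ)..((k + 1) * t / n), Ψ (k * t / n, (k + 1) * t / n, s)) atTop (𝓝 0) := by
  rw [Metric.tendsto_atTop]
  intro ε hε
  have hcomp : IsCompact (Icc (0 : ℝ) t ×ˢ Icc (0 : ℝ) t ×ˢ Icc (0 : ℝ) t) :=
    isCompact_Icc.prod (isCompact_Icc.prod isCompact_Icc)
  have hunif := hcomp.uniformContinuousOn_of_continuous hΨ.continuousOn
  rw [Metric.uniformContinuousOn_iff] at hunif
  -- Dividing by `t + 1` instead of `t` also covers `t = 0` and keeps the final inequality strict.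
  obtain ⟨δ, hδ, hδ'⟩ := hunif (ε / (t + 1)) (by positivity)
  obtain ⟨N, hN⟩ := exists_nat_gt (t / δ)
  refine ⟨N + 1, fun n hn => ?_⟩
  have hn0 : (0 : ℝ) < n := by exact_mod_cast (Nat.succ_pos N).trans_le hn
  have hnδ : t / n < δ := by
    rw [div_lt_iff₀ hn0, mul_comm, ← div_lt_iff₀ hδ]
    refine hN.trans_le ?_
    exact_mod_cast (Nat.le_succ N).trans hn
  rw [dist_zero_right]
  have hcell : ∀ k ∈ Finset.range n, ‖∫ s in (k * t / n : ℝ)..((k + 1) * t / n),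
      Ψ (k * t / n, (k + 1) * t / n, s)‖ ≤ ε / (t + 1) * (t / n) := by
    intro k hk
    have hk := Finset.mem_range.1 hk
    have hlen : ((k : ℝ) + 1) * t / n - k * t / n = t / n := by ring
    have hle : (k * t / n : ℝ) ≤ (k + 1) * t / n := (left_mem_cell ht n k).2
    have := intervalIntegral.norm_integral_le_of_norm_le_const (a := (k * t / n : ℝ))
      (b := (k + 1) * t / n) (f := fun s => Ψ (k * t / n, (k + 1) * t / n, s)) (C := ε / (t + 1))
      (fun s hs => ?_)
    · rwa [hlen, abs_of_nonneg (by positivity)] at this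
    · rw [uIoc_of_le hle] at hs
      have hs' : s ∈ Icc (k * t / n : ℝ) ((k + 1) * t / n) := ⟨hs.1.le, hs.2⟩
      have m1 := mem_Icc_of_mem_cell ht hk hs'
      have m2 := mem_Icc_of_mem_cell ht hk (left_mem_cell ht n k)
      have m3 := mem_Icc_of_mem_cell ht hk (right_mem_cell ht n k)
      have := hδ' (k * t / n, (k + 1) * t / n, s) ⟨m2, m3, m1⟩ (s, s, s) ⟨m1, m1, m1⟩ (by
        rw [Prod.dist_eq, Prod.dist_eq, max_lt_iff, max_lt_iff, Real.dist_eq, Real.dist_eq,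
          Real.dist_eq, sub_self, abs_zero]
        refine ⟨?_, ?_, hδ⟩ <;> rw [abs_lt] <;> constructor <;> linarith [hs'.1, hs'.2])
      rw [h0, dist_zero_right] at this
      exact this.le
  calc _ ≤ ∑ k ∈ Finset.range n, ε / (t + 1) * (t / n) := norm_sum_le_of_le _ hcell
    _ = ε * (t / (t + 1)) := by
        rw [Finset.sum_const, Finset.card_range, nsmul_eq_mul]
        field_simp
    _ < ε * 1 := by
        gcongr
        rw [div_lt_one (by positivity)]
        linarith
    _ = ε := mul_one ε

/-- Variation of constants: for a continuous path `z`, the Riemann–Stieltjes sums of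
`exp (-∫ f)` against `z - ∫ f z` converge. -/
lemma tendsto_sum_integratingFactor {F : Type*} [NormedAddCommGroup F] [NormedSpace ℝ F]
    [CompleteSpace F] {f : ℝ → ℝ} (hf : Continuous f) {z : ℝ → F} (hz : Continuous z)
    {t : ℝ} (ht : 0 ≤ t) :
    Tendsto (fun n : ℕ => ∑ k ∈ Finset.range n,
      Real.exp (-∫ s in (0 : ℝ)..((k + 1) * t / n), f s) •
        ((z ((k + 1) * t / n) - z 0 - ∫ s in (0 : ℝ)..((k + 1) * t / n), f s • z s) -
          (z (k * t / n) - z 0 - ∫ s in (0 : ℝ)..(k * t / n), f s • z s))) atTop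
      (𝓝 (Real.exp (-∫ s in (0 : ℝ)..t, f s) • z t - z 0)) := by
  set e : ℝ → ℝ := fun t => Real.exp (-∫ s in (0 : ℝ)..t, f s) with he
  have hde : ∀ s, HasDerivAt e (-(e s * f s)) s := fun s => by
    have := ((hf.integral_hasStrictDerivAt 0 s).hasDerivAt.neg).exp
    refine this.congr_deriv ?_
    simp [he]
  have hec : Continuous e := continuous_iff_continuousAt.2 fun s => (hde s).continuousAt
  have hfz : Continuous fun s => f s • z s := hf.smul hz
  -- Summation by parts on one cell, using `e' = -e f`: a telescoping increment of `e z` plus the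
  -- integral of a function that vanishes when `a = b = s`.
  have hcell : ∀ (a b : ℝ),
      e b • ((z b - z 0 - ∫ s in (0 : ℝ)..b, f s • z s) - (z a - z 0 - ∫ s in (0 : ℝ)..a, f s • z s)) =
      (e b • z b - e a • z a) + ∫ s in a..b, f s • (e s • z a - e b • z s) := by
    intro a b
    have h1 : ∫ s in a..b, -(e s * f s) = e b - e a :=
      intervalIntegral.integral_eq_sub_of_hasDerivAt (fun s _ => hde s)
        ((hec.mul hf).neg.intervalIntegrable a b)
    have h2 : (∫ s in (0 : ℝ)..b, f s • z s) - ∫ s in (0 : ℝ)..a, f s • z s = ∫ s in a..b, f s • z s :=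
      intervalIntegral.integral_interval_sub_left (hfz.intervalIntegrable _ _)
        (hfz.intervalIntegrable _ _)
    have h3 : ∫ s in a..b, f s • (e s • z a - e b • z s) =
        (e a - e b) • z a - e b • ∫ s in a..b, f s • z s := by
      have : ∀ s, f s • (e s • z a - e b • z s) = (e s * f s) • z a - e b • (f s • z s) := fun s => by
        rw [smul_sub, smul_smul, smul_comm, mul_comm]
      simp_rw [this]
      have i1 : Continuous fun s => (e s * f s) • z a := by fun_prop
      have i2 : Continuous fun s => e b • (f s • z s) := by fun_prop
      rw [intervalIntegral.integral_sub (i1.intervalIntegrable a b)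
        (i2.intervalIntegrable a b), intervalIntegral.integral_smul_const,
        intervalIntegral.integral_smul]
      rw [intervalIntegral.integral_neg] at h1
      rw [show ∫ s in a..b, e s * f s = e a - e b by linarith]
    rw [h3, ← h2]
    simp only [smul_sub, sub_smul]
    abel
  have hsum : ∀ n : ℕ, 0 < n → ∑ k ∈ Finset.range n, e ((k + 1) * t / n) •
        ((z ((k + 1) * t / n) - z 0 - ∫ s in (0 : ℝ)..((k + 1) * t / n), f s • z s) -
          (z (k * t / n) - z 0 - ∫ s in (0 : ℝ)..(k * t / n), f s • z s)) =
      (e t • z t - z 0) + ∑ k ∈ Finset.range n, ∫ s in (k * t / n : ℝ)..((k + 1) * t / n),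
        f s • (e s • z (k * t / n) - e ((k + 1) * t / n) • z s) := by
    intro n hn
    have hn' : (n : ℝ) ≠ 0 := by exact_mod_cast hn.ne'
    simp_rw [hcell]
    rw [Finset.sum_add_distrib]
    congr 1
    have := Finset.sum_range_sub (fun k : ℕ => e (k * t / n) • z (k * t / n)) n
    push_cast at this
    rw [this]
    simp [he, hn']
  have hlim := tendsto_sum_integral_diagonal
    (Ψ := fun x : ℝ × ℝ × ℝ => f x.2.2 • (e x.2.2 • z x.1 - e x.2.1 • z x.2.2))
    (by fun_prop) (by intro s; simp) ht
  have := hlim.const_add (e t • z t - z 0)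
  rw [add_zero] at this
  refine this.congr' ?_
  filter_upwards [eventually_gt_atTop 0] with n hn using (hsum n hn).symm

/-- Paths and coefficients are controlled only on `[0, t]`; extending them by their boundary values
changes none of the sums. -/
lemma tendsto_sum_integratingFactor_of_continuousOn {F : Type*} [NormedAddCommGroup F]
    [NormedSpace ℝ F] [CompleteSpace F] {f : ℝ → ℝ} {z : ℝ → F} {t : ℝ} (ht : 0 ≤ t)
    (hf : ContinuousOn f (Icc 0 t)) (hz : ContinuousOn z (Icc 0 t)) :
    Tendsto (fun n : ℕ => ∑ k ∈ Finset.range n,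
      Real.exp (-∫ s in (0 : ℝ)..((k + 1) * t / n), f s) •
        ((z ((k + 1) * t / n) - z 0 - ∫ s in (0 : ℝ)..((k + 1) * t / n), f s • z s) -
          (z (k * t / n) - z 0 - ∫ s in (0 : ℝ)..(k * t / n), f s • z s))) atTop
      (𝓝 (Real.exp (-∫ s in (0 : ℝ)..t, f s) • z t - z 0)) := by
  have hF : ∀ s ∈ Icc 0 t, IccExtend ht ((Icc 0 t).domRestrict f) s = f s := fun s hs => by
    rw [IccExtend_of_mem _ _ hs]; rfl
  have hZ : ∀ s ∈ Icc 0 t, IccExtend ht ((Icc 0 t).domRestrict z) s = z s := fun s hs => by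
    rw [IccExtend_of_mem _ _ hs]; rfl
  have h := tendsto_sum_integratingFactor
    ((continuousOn_iff_continuous_domRestrict.1 hf).Icc_extend' (h := ht))
    ((continuousOn_iff_continuous_domRestrict.1 hz).Icc_extend' (h := ht)) ht
  have hsub : ∀ s ∈ Icc 0 t, uIcc 0 s ⊆ Icc 0 t := fun s hs => by
    rw [uIcc_of_le hs.1]; exact Icc_subset_Icc le_rfl hs.2
  have hI1 : ∀ s ∈ Icc 0 t, ∫ u in (0 : ℝ)..s, IccExtend ht ((Icc 0 t).domRestrict f) u =
      ∫ u in (0 : ℝ)..s, f u := fun s hs =>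
    intervalIntegral.integral_congr fun u hu => hF u (hsub s hs hu)
  have hI2 : ∀ s ∈ Icc 0 t, ∫ u in (0 : ℝ)..s, IccExtend ht ((Icc 0 t).domRestrict f) u •
      IccExtend ht ((Icc 0 t).domRestrict z) u = ∫ u in (0 : ℝ)..s, f u • z u := fun s hs =>
    intervalIntegral.integral_congr fun u hu => by
      simp only [hF u (hsub s hs hu), hZ u (hsub s hs hu)]
  have ht' : t ∈ Icc 0 t := ⟨ht, le_rfl⟩
  rw [hI1 t ht', hZ t ht', hZ 0 ⟨le_rfl, ht⟩] at h
  refine h.congr fun n => Finset.sum_congr rfl fun k hk => ?_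
  have hk := Finset.mem_range.1 hk
  have m2 := mem_Icc_of_mem_cell ht hk (left_mem_cell ht n k)
  have m3 := mem_Icc_of_mem_cell ht hk (right_mem_cell ht n k)
  rw [hI1 _ m3, hI2 _ m3, hI2 _ m2, hZ _ m3, hZ _ m2]

end Partition

/-! ### Wiener integrals: normal law and independence from the initial data. -/

section WienerIntegral

variable {D : ℕ}

local notation "𝔼" => EuclideanSpace ℝ (Fin D)
local notation "γ" => stdGaussian (EuclideanSpace ℝ (Fin D))

variable {Ω S : Type*} [MeasurableSpace Ω] [MeasurableSpace S]

/-- `X` is independent of `ζ`, with law `N(0, v I)`. -/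
structure IsIndepGaussian (P : Measure Ω) (ζ : Ω → S) (X : Ω → EuclideanSpace ℝ (Fin D)) (v : ℝ) :
    Prop where
  aemeasurable : AEMeasurable X P
  map_eq : P.map (fun ω => (ζ ω, X ω)) =
    (P.map ζ).prod ((stdGaussian (EuclideanSpace ℝ (Fin D))).map fun ξ => √v • ξ)

/-- Convergence in probability of `(ζ, X n)` implies convergence of the joint laws. These laws are
explicit and converge also because `√(v n) • ξ` converges pointwise, so uniqueness of weak limits
identifies the joint law of the limit. -/
theorem IsIndepGaussian.of_tendstoInMeasure [PseudoEMetricSpace S] [SecondCountableTopology S]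
    [BorelSpace S] {P : Measure Ω} [IsProbabilityMeasure P] {ζ : Ω → S} (hζ : Measurable ζ)
    {X : ℕ → Ω → 𝔼} {v : ℕ → ℝ} (h : ∀ n, IsIndepGaussian P ζ (X n) (v n)) {X' : Ω → 𝔼} {v' : ℝ}
    (hv : Tendsto v atTop (𝓝 v')) (hX : TendstoInMeasure P X atTop X') :
    IsIndepGaussian P ζ X' v' := by
  have hX' : AEMeasurable X' P := hX.aemeasurable fun n => (h n).aemeasurable
  refine ⟨hX', ?_⟩
  have hpair : TendstoInMeasure P (fun n ω => (ζ ω, X n ω)) atTop fun ω => (ζ ω, X' ω) := by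
    intro ε hε
    refine (hX ε hε).congr fun n => ?_
    simp [Prod.edist_eq]
  have h1 := hpair.tendstoInDistribution fun n => hζ.aemeasurable.prodMk (h n).aemeasurable
  have : IsProbabilityMeasure (P.map ζ) := Measure.isProbabilityMeasure_map hζ.aemeasurable
  have hmeas : ∀ c : ℝ, Measurable fun x : S × 𝔼 => (x.1, √c • x.2) := fun c => by fun_prop
  have h2 := tendstoInDistribution_of_ae_tendsto (μ' := (P.map ζ).prod γ)
    (X := fun n (x : S × 𝔼) => (x.1, √(v n) • x.2)) (Z := fun x => (x.1, √v' • x.2)) (l := atTop)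
    (fun n => (hmeas _).aemeasurable) (hmeas _).aemeasurable
    (ae_of_all _ fun x => tendsto_const_nhds.prodMk_nhds ((hv.sqrt).smul_const x.2))
  have hmap : ∀ c : ℝ, ((P.map ζ).prod γ).map (fun x : S × 𝔼 => (x.1, √c • x.2)) =
      (P.map ζ).prod ((γ).map fun ξ => √c • ξ) := fun c => by
    conv_rhs => rw [← Measure.map_id (μ := P.map ζ)]
    rw [Measure.map_prod_map _ _ measurable_id (by fun_prop)]
    rfl
  have h3 := h1.tendsto
  have h4 := h2.tendsto
  simp only [hmap] at h4
  simp only [(h _).map_eq] at h3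
  have := tendsto_nhds_unique h3 h4
  exact congrArg Subtype.val this

/-- The span of the pairs `(w t, 1_(0,t])`: the elementary Wiener integrals with their
integrands. -/
def elementaryIntegrals (w : ℝ≥0 → Ω → EuclideanSpace ℝ (Fin D)) :
    Submodule ℝ ((Ω → EuclideanSpace ℝ (Fin D)) × (ℝ → ℝ)) :=
  Submodule.span ℝ (Set.range fun t : ℝ≥0 => (w t, (Ioc (0 : ℝ) t).indicator 1))

lemma mem_elementaryIntegrals {Ω : Type*} (w : ℝ≥0 → Ω → 𝔼) (t : ℝ≥0) :
    (w t, (Ioc (0 : ℝ) t).indicator 1) ∈ elementaryIntegrals w :=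
  Submodule.subset_span ⟨t, rfl⟩

/-- The Itô isometry in its simplest form: `min s t` is the Brownian covariance. -/
lemma integral_indicator_Ioc_mul (s t : ℝ≥0) :
    ∫ x, (Ioc (0 : ℝ) s).indicator 1 x * (Ioc (0 : ℝ) t).indicator (1 : ℝ → ℝ) x = min (s : ℝ) t := by
  have : ∀ x, (Ioc (0 : ℝ) s).indicator 1 x * (Ioc (0 : ℝ) t).indicator (1 : ℝ → ℝ) x =
      (Ioc (0 : ℝ) (min (s : ℝ) t)).indicator 1 x := fun x => by
    rw [← inter_indicator_mul, Ioc_inter_Ioc]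
    simp [Pi.one_def]
  simp_rw [this]
  rw [integral_indicator_one measurableSet_Ioc]
  simp

lemma integrable_indicator_Ioc_mul (s t : ℝ≥0) :
    Integrable fun x => (Ioc (0 : ℝ) s).indicator 1 x * (Ioc (0 : ℝ) t).indicator (1 : ℝ → ℝ) x := by
  have : ∀ x, (Ioc (0 : ℝ) s).indicator 1 x * (Ioc (0 : ℝ) t).indicator (1 : ℝ → ℝ) x =
      (Ioc (0 : ℝ) (min (s : ℝ) t)).indicator 1 x := fun x => by
    rw [← inter_indicator_mul, Ioc_inter_Ioc]
    simp [Pi.one_def]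
  simp_rw [this]
  exact (integrable_indicator_iff measurableSet_Ioc).2 (integrableOn_const (by simp))

lemma measurable_snd_of_mem_elementaryIntegrals {Ω : Type*} {w : ℝ≥0 → Ω → 𝔼} {X : Ω → 𝔼} {h : ℝ → ℝ}
    (hX : (X, h) ∈ elementaryIntegrals w) : Measurable h := by
  obtain ⟨c, hc⟩ := Finsupp.mem_span_range_iff_exists_finsupp.1 hX
  have h2 : h = fun x => ∑ t ∈ c.support, c t * (Ioc (0 : ℝ) t).indicator 1 x := by
    have := (congrArg Prod.snd hc).symm
    simp only [Finsupp.sum, Prod.snd_sum, Prod.smul_snd] at this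
    rw [this]
    ext1 x
    simp
  rw [h2]
  exact Finset.measurable_fun_sum _ fun t _ =>
    (measurable_one.indicator measurableSet_Ioc).const_mul (c t)

/-- The law of a linear combination of values of a one-dimensional Brownian motion. -/
lemma map_sum_mul_brownian {P : Measure Ω} [IsProbabilityMeasure P] {B : ℝ≥0 → Ω → ℝ}
    (hB : IsBrownianReal B P) (J : Finset ℝ≥0) (c : ℝ≥0 → ℝ) :
    P.map (fun ω => ∑ t ∈ J, c t * B t ω) =
      gaussianReal 0 (∫ x, (∑ t ∈ J, c t * (Ioc (0 : ℝ) t).indicator 1 x) ^ 2).toNNReal := by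
  have hG : HasGaussianLaw (fun ω => ∑ t ∈ J, c t * B t ω) P :=
    (hB.isGaussianProcess.smul c).hasGaussianLaw_fun_sum
  have hL : ∀ t, MemLp (fun ω => c t * B t ω) 2 P := fun t =>
    (hB.isGaussianProcess.hasGaussianLaw_eval t).memLp_two.const_mul (c t)
  rw [hG.map_eq_gaussianReal]
  congr 2
  · rw [integral_finsetSum _ fun t _ => (hB.integrable_eval t).const_mul (c t)]
    refine Finset.sum_eq_zero fun t _ => ?_
    rw [integral_const_mul, hB.integral_eval, mul_zero]
  · rw [← covariance_self hG.aemeasurable, covariance_fun_sum_fun_sum' (fun t _ => hL t) fun t _ => hL t]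
    simp_rw [sq, Finset.sum_mul_sum]
    have hint : ∀ s t : ℝ≥0, Integrable fun x => c s * (Ioc (0 : ℝ) s).indicator 1 x *
        (c t * (Ioc (0 : ℝ) t).indicator (1 : ℝ → ℝ) x) := fun s t => by
      refine ((integrable_indicator_Ioc_mul s t).const_mul (c s * c t)).congr (ae_of_all _ fun x => ?_)
      simp only
      ring
    rw [integral_finsetSum _ fun s _ => integrable_finsetSum _ fun t _ => hint s t]
    refine Finset.sum_congr rfl fun s _ => ?_
    rw [integral_finsetSum _ fun t _ => hint s t]
    refine Finset.sum_congr rfl fun t _ => ?_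
    rw [covariance_const_mul_left, covariance_const_mul_right, hB.covariance_fun_eval]
    have : ∀ x, c s * (Ioc (0 : ℝ) s).indicator 1 x * (c t * (Ioc (0 : ℝ) t).indicator (1 : ℝ → ℝ) x) =
        c s * c t * ((Ioc (0 : ℝ) s).indicator 1 x * (Ioc (0 : ℝ) t).indicator (1 : ℝ → ℝ) x) :=
      fun x => by ring
    simp_rw [this]
    rw [integral_const_mul, integral_indicator_Ioc_mul]
    push_cast
    ring

/-- Writing `X` as a finite combination of Brownian values makes it a measurable function of the
path, hence independent of `ζ`. Its coordinates are independent normals with the variance read off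
from `h`, and characteristic functions assemble them. -/
theorem isIndepGaussian_of_mem_elementaryIntegrals {P : Measure Ω} [IsProbabilityMeasure P]
    {w : ℝ≥0 → Ω → 𝔼} (hw : IsBrownianMotion w P) {ζ : Ω → S} (hζ : Measurable ζ)
    (hind : IndepFun ζ (fun ω t => w t ω) P) {X : Ω → 𝔼} {h : ℝ → ℝ}
    (hX : (X, h) ∈ elementaryIntegrals w) : IsIndepGaussian P ζ X (∫ x, h x ^ 2) := by
  obtain ⟨c, hc⟩ := Finsupp.mem_span_range_iff_exists_finsupp.1 hX
  have h1 : X = fun ω => ∑ t ∈ c.support, c t • w t ω := by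
    have := (congrArg Prod.fst hc).symm
    simp only [Finsupp.sum, Prod.fst_sum, Prod.smul_fst] at this
    rw [this]
    ext1 ω
    simp
  have h2 : h = fun x => ∑ t ∈ c.support, c t * (Ioc (0 : ℝ) t).indicator 1 x := by
    have := (congrArg Prod.snd hc).symm
    simp only [Finsupp.sum, Prod.snd_sum, Prod.smul_snd] at this
    rw [this]
    ext1 x
    simp
  have hXi : ∀ i, (fun ω => X ω i) = fun ω => ∑ t ∈ c.support, c t * w t ω i := fun i => by
    rw [h1]; ext1 ω; simp
  have hmi : ∀ i, P.map (fun ω => X ω i) = gaussianReal 0 (∫ x, h x ^ 2).toNNReal := fun i => by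
    rw [hXi, h2, map_sum_mul_brownian (hw.coord i)]
  have haei : ∀ i, AEMeasurable (fun ω => X ω i) P := fun i => by
    rw [hXi]
    exact Finset.aemeasurable_fun_sum _ fun t _ => ((hw.coord i).aemeasurable t).const_mul (c t)
  have hae : AEMeasurable X P := by
    have := (WithLp.measurable_toLp 2 (Fin D → ℝ)).comp_aemeasurable (aemeasurable_pi_lambda _ haei)
    exact this
  refine ⟨hae, ?_⟩
  have hindX : IndepFun ζ X P := by
    have := hind.comp (φ := id) (ψ := fun p : ℝ≥0 → 𝔼 => ∑ t ∈ c.support, c t • p t) measurable_id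
      (by fun_prop)
    rw [h1]
    exact this
  rw [(indepFun_iff_map_prod_eq_prod_map_map hζ.aemeasurable hae).1 hindX]
  congr 1
  have hpi : P.map (fun ω i => X ω i) =
      Measure.pi fun _ : Fin D => gaussianReal 0 (∫ x, h x ^ 2).toNNReal := by
    have hi : iIndepFun (fun (i : Fin D) ω => X ω i) P := by
      have := hw.indep.comp (fun _ (p : ℝ≥0 → ℝ) => ∑ t ∈ c.support, c t * p t)
        (fun _ => by fun_prop)
      convert! this using 2 with i
      exact hXi i
    rw [(iIndepFun_iff_map_fun_eq_pi_map haei).1 hi]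
    simp_rw [hmi]
  have hXmap : P.map X = (P.map (fun ω i => X ω i)).map (WithLp.toLp 2) := by
    rw [AEMeasurable.map_map_of_aemeasurable (by fun_prop) (aemeasurable_pi_lambda _ haei)]
    rfl
  rw [hXmap, hpi]
  have hv : 0 ≤ ∫ x, h x ^ 2 := integral_nonneg fun x => sq_nonneg _
  have hγ := charFun_map_affine_stdGaussian (D := D) 0 hv
  simp only [zero_add, inner_zero_left, Complex.ofReal_zero, zero_mul, zero_sub] at hγ
  have : IsProbabilityMeasure ((γ).map fun ξ => √(∫ x, h x ^ 2) • ξ) :=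
    Measure.isProbabilityMeasure_map (by fun_prop)
  have : IsProbabilityMeasure ((Measure.pi fun _ : Fin D =>
      gaussianReal 0 (∫ x, h x ^ 2).toNNReal).map (WithLp.toLp 2)) :=
    Measure.isProbabilityMeasure_map (by fun_prop)
  apply Measure.ext_of_charFun (E := EuclideanSpace ℝ (Fin D))
  ext θ
  rw [hγ, charFun_pi]
  simp_rw [charFun_gaussianReal, ← Complex.exp_sum]
  congr 1
  have hs := EuclideanSpace.real_norm_sq_eq θ
  rw [← Complex.ofReal_pow, hs]
  simp only [Real.coe_toNNReal _ hv]
  push_cast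
  simp [Finset.sum_div, Finset.mul_sum]

lemma MeasureTheory.TendstoInMeasure.const_smul_add {P : Measure Ω} {X Y : ℕ → Ω → 𝔼} {X' Y' : Ω → 𝔼} (c : ℝ)
    (hX : TendstoInMeasure P X atTop X') (hY : TendstoInMeasure P Y atTop Y') :
    TendstoInMeasure P (fun n => c • X n + Y n) atTop (c • X' + Y') := by
  rw [tendstoInMeasure_iff_norm] at hX hY ⊢
  intro ε hε
  have h1 := hX (ε / 2 / (|c| + 1)) (by positivity)
  have h2 := hY (ε / 2) (by positivity)
  have h3 := h1.add h2
  rw [add_zero] at h3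
  refine tendsto_of_tendsto_of_tendsto_of_le_of_le tendsto_const_nhds h3 (fun _ => zero_le) fun n => ?_
  refine (measure_mono fun ω hω => ?_).trans (measure_union_le _ _)
  by_contra hcon
  simp only [mem_union, mem_ofPred_eq, not_or, not_le] at hcon hω
  have h4 : ‖(c • X n + Y n) ω - (c • X' + Y') ω‖ ≤ |c| * ‖X n ω - X' ω‖ + ‖Y n ω - Y' ω‖ := by
    rw [← Real.norm_eq_abs, ← norm_smul]
    refine le_trans (le_of_eq ?_) (norm_add_le _ _)
    congr 1
    simp only [Pi.add_apply, Pi.smul_apply, smul_sub]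
    abel
  have h5 : |c| * ‖X n ω - X' ω‖ ≤ (|c| + 1) * (ε / 2 / (|c| + 1)) := by
    have := hcon.1.le
    have := abs_nonneg c
    gcongr
    linarith
  have h6 : (|c| + 1) * (ε / 2 / (|c| + 1)) = ε / 2 := by
    have := abs_nonneg c
    field_simp
  linarith [hcon.2]

/-- `X` is the Wiener integral of `h`: the limit in probability of elementary integrals whose
integrands converge boundedly to `h`. -/
def IsWienerIntegral (w : ℝ≥0 → Ω → EuclideanSpace ℝ (Fin D)) (P : Measure Ω)
    (X : Ω → EuclideanSpace ℝ (Fin D)) (h : ℝ → ℝ) : Prop :=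
  ∃ (Xn : ℕ → Ω → EuclideanSpace ℝ (Fin D)) (hn : ℕ → ℝ → ℝ) (K T : ℝ),
    (∀ n, (Xn n, hn n) ∈ elementaryIntegrals w) ∧ (∀ n, ∀ x, |hn n x| ≤ K) ∧
    (∀ n, ∀ x ∉ Ioc 0 T, hn n x = 0) ∧ (∀ x, Tendsto (fun n => hn n x) atTop (𝓝 (h x))) ∧
    TendstoInMeasure P Xn atTop X

/-- The uniform bound and common bounded support in `IsWienerIntegral` provide the dominating
function that makes the variances converge. -/
lemma tendsto_integral_sq {hn : ℕ → ℝ → ℝ} {h : ℝ → ℝ} {K T : ℝ} (hmeas : ∀ n, Measurable (hn n))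
    (hK : ∀ n, ∀ x, |hn n x| ≤ K) (hT : ∀ n, ∀ x ∉ Ioc 0 T, hn n x = 0)
    (hlim : ∀ x, Tendsto (fun n => hn n x) atTop (𝓝 (h x))) :
    Tendsto (fun n => ∫ x, hn n x ^ 2) atTop (𝓝 (∫ x, h x ^ 2)) := by
  refine tendsto_integral_of_dominated_convergence ((Ioc 0 T).indicator fun _ => K ^ 2)
    (fun n => ((hmeas n).pow_const 2).aestronglyMeasurable)
    ((integrable_indicator_iff measurableSet_Ioc).2 (integrableOn_const (by simp)))
    (fun n => ae_of_all _ fun x => ?_) (ae_of_all _ fun x => (hlim x).pow 2)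
  by_cases hx : x ∈ Ioc 0 T
  · rw [indicator_of_mem hx, norm_pow, Real.norm_eq_abs]
    gcongr
    exact hK n x
  · rw [indicator_of_notMem hx, hT n x hx]
    simp

namespace IsWienerIntegral

variable {w : ℝ≥0 → Ω → EuclideanSpace ℝ (Fin D)} {P : Measure Ω}
  {X Y : Ω → EuclideanSpace ℝ (Fin D)} {h k : ℝ → ℝ}

theorem isIndepGaussian [PseudoEMetricSpace S] [SecondCountableTopology S] [BorelSpace S]
    [IsProbabilityMeasure P] (hX : IsWienerIntegral w P X h) (hw : IsBrownianMotion w P) {ζ : Ω → S}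
    (hζ : Measurable ζ) (hind : IndepFun ζ (fun ω t => w t ω) P) :
    IsIndepGaussian P ζ X (∫ x, h x ^ 2) := by
  obtain ⟨Xn, hn, K, T, hmem, hK, hT, hlim, hXn⟩ := hX
  exact IsIndepGaussian.of_tendstoInMeasure hζ
    (fun n => isIndepGaussian_of_mem_elementaryIntegrals hw hζ hind (hmem n))
    (tendsto_integral_sq (fun n => measurable_snd_of_mem_elementaryIntegrals (hmem n)) hK hT hlim) hXn

lemma const_smul_add (c : ℝ) (hX : IsWienerIntegral w P X h) (hY : IsWienerIntegral w P Y k) :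
    IsWienerIntegral w P (c • X + Y) (c • h + k) := by
  obtain ⟨Xn, hn, K, T, hmem, hK, hT, hlim, hXn⟩ := hX
  obtain ⟨Yn, kn, K', T', hmem', hK', hT', hlim', hYn⟩ := hY
  refine ⟨fun n => c • Xn n + Yn n, fun n => c • hn n + kn n, |c| * K + K', max T T',
    fun n => ?_, fun n x => ?_, fun n x hx => ?_, fun x => ?_, hXn.const_smul_add c hYn⟩
  · exact Submodule.add_mem _ (Submodule.smul_mem _ c (hmem n)) (hmem' n)
  · simp only [Pi.add_apply, Pi.smul_apply, smul_eq_mul]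
    refine (abs_add_le _ _).trans (add_le_add ?_ (hK' n x))
    rw [abs_mul]
    exact mul_le_mul_of_nonneg_left (hK n x) (abs_nonneg c)
  · simp [hT n x fun h => hx ⟨h.1, h.2.trans (le_max_left _ _)⟩,
      hT' n x fun h => hx ⟨h.1, h.2.trans (le_max_right _ _)⟩]
  · exact ((hlim x).const_smul c).add (hlim' x)

lemma zero : IsWienerIntegral w P 0 0 :=
  ⟨0, 0, 0, 0, fun _ => Submodule.zero_mem _, by simp, by simp, fun _ => tendsto_const_nhds,
    fun ε hε => by simp [hε.not_ge]⟩

lemma sum {Xs : ℕ → Ω → 𝔼} {hs : ℕ → ℝ → ℝ} {N : ℕ} (c : ℕ → ℝ)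
    (hX : ∀ j < N, IsWienerIntegral w P (Xs j) (hs j)) :
    IsWienerIntegral w P (∑ j ∈ Finset.range N, c j • Xs j) (∑ j ∈ Finset.range N, c j • hs j) := by
  induction N with
  | zero => simpa using zero
  | succ N ih =>
    rw [Finset.sum_range_succ_comm, Finset.sum_range_succ_comm]
    exact (hX N N.lt_succ_self).const_smul_add (c N) (ih fun j hj => hX j (hj.trans N.lt_succ_self))

/-- Each left-endpoint sum is already an elementary integral, with the corresponding step function
as integrand. -/
lemma of_isItoIntegral {g : ℝ → ℝ} {t : ℝ} (ht : 0 ≤ t) (hg : ContinuousOn g (Icc 0 t))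
    (hX : IsItoIntegral g w P t X) : IsWienerIntegral w P X ((Ioc 0 t).indicator g) := by
  obtain ⟨K, hK⟩ := isCompact_Icc.exists_bound_of_continuousOn hg
  have hK0 : 0 ≤ K := (norm_nonneg _).trans (hK 0 ⟨le_rfl, ht⟩)
  refine ⟨_, fun n x => ∑ k ∈ Finset.range n,
    (Ioc (k * t / n : ℝ) ((k + 1) * t / n)).indicator (fun _ => g (k * t / n)) x, K, t,
    fun n => ?_, fun n x => ?_, fun n x hx => sum_indicator_Ioc_eq_zero ht hx n _,
    fun x => tendsto_sum_indicator_Ioc ht hg (left_mem_cell ht) x, hX⟩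
  · have hmem : ∀ k : ℕ, g (k * t / n) •
        ((w (Real.toNNReal ((k + 1) * t / n)), (Ioc (0 : ℝ) (Real.toNNReal ((k + 1) * t / n))).indicator 1) -
        (w (Real.toNNReal (k * t / n)), (Ioc (0 : ℝ) (Real.toNNReal (k * t / n))).indicator 1)) ∈
        elementaryIntegrals w := fun k =>
      Submodule.smul_mem _ _ (Submodule.sub_mem _ (mem_elementaryIntegrals w _)
        (mem_elementaryIntegrals w _))
    have := Submodule.sum_mem (t := Finset.range n) _ fun k _ => hmem k
    convert! this using 1
    refine Prod.ext ?_ ?_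
    · ext1 ω
      simp [Prod.fst_sum]
    · ext1 x
      simp only [Prod.snd_sum, Prod.smul_snd, Prod.snd_sub, Finset.sum_apply, Pi.smul_apply,
        Pi.sub_apply, smul_eq_mul]
      refine Finset.sum_congr rfl fun k _ => ?_
      have h0 : (0 : ℝ) ≤ k * t / n := by positivity
      have h1 : (k * t / n : ℝ) ≤ (k + 1) * t / n := (left_mem_cell ht n k).2
      rw [Real.coe_toNNReal _ h0, Real.coe_toNNReal _ (h0.trans h1)]
      -- The difference of two initial intervals is the cell: `x` may lie before it, in it, or
      -- outside both intervals.
      by_cases hx1 : x ∈ Ioc (0 : ℝ) (k * t / n)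
      · rw [indicator_of_mem hx1, indicator_of_mem (show x ∈ Ioc (0 : ℝ) ((k + 1) * t / n) from ⟨hx1.1, hx1.2.trans h1⟩),
          indicator_of_notMem fun h => (h.1.trans_le hx1.2).false]
        simp
      · rw [indicator_of_notMem hx1]
        by_cases hx2 : x ∈ Ioc (k * t / n : ℝ) ((k + 1) * t / n)
        · rw [indicator_of_mem hx2, indicator_of_mem (show x ∈ Ioc (0 : ℝ) ((k + 1) * t / n) from ⟨h0.trans_lt hx2.1, hx2.2⟩)]
          simp
        · rw [indicator_of_notMem hx2, indicator_of_notMem]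
          · simp
          · intro h
            refine hx2 ⟨not_le.1 fun h3 => hx1 ⟨h.1, h3⟩, h.2⟩
  · refine abs_sum_indicator_Ioc_le ht hK0 (fun k hk => ?_) x
    exact hK _ (mem_Icc_of_mem_cell ht hk (left_mem_cell ht n k))

end IsWienerIntegral

end WienerIntegral

/-! ### Transition kernel of the linear diffusion. -/

section LinearDiffusion

variable {D : ℕ}

local notation "𝔼" => EuclideanSpace ℝ (Fin D)
local notation "γ" => stdGaussian (EuclideanSpace ℝ (Fin D))

lemma lintegral_ofReal_normalDensity_mul (m : 𝔼) {v : ℝ} (hv : 0 < v) {h : 𝔼 → ℝ≥0∞} (hh : Measurable h) :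
    ∫⁻ x, ENNReal.ofReal (normalDensity m v x) * h x = ∫⁻ ξ, h (m + √v • ξ) ∂γ := by
  rw [← lintegral_map hh (by fun_prop : Measurable fun ξ : 𝔼 => m + √v • ξ), map_affine_stdGaussian m hv,
    lintegral_withDensity_eq_lintegral_mul _
      (continuous_normalDensity m v).measurable.ennreal_ofReal hh]
  rfl

/-- The reparametrization `x = a z + √v ξ`, through which all averages over the joint law are
computed. -/
lemma lintegral_jointLaw (ν : Measure (EuclideanSpace ℝ (Fin D))) [SFinite ν] (a : ℝ) {v : ℝ}
    (hv : 0 < v) {h : EuclideanSpace ℝ (Fin D) × EuclideanSpace ℝ (Fin D) → ℝ≥0∞} (hh : Measurable h) :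
    ∫⁻ x, h x ∂(jointLaw ν a v) = ∫⁻ z, ∫⁻ ξ, h (z, a • z + √v • ξ) ∂γ ∂ν := by
  have hN : Measurable fun x : 𝔼 × 𝔼 => ENNReal.ofReal (normalDensity (a • x.1) v x.2) := by
    unfold normalDensity; fun_prop
  rw [jointLaw, lintegral_withDensity_eq_lintegral_mul _ hN hh,
    lintegral_prod _ (hN.mul hh).aemeasurable]
  refine lintegral_congr fun z => ?_
  exact lintegral_ofReal_normalDensity_mul (a • z) hv (hh.comp (measurable_const.prodMk measurable_id))

lemma jointLaw_eq_map (ν : Measure (EuclideanSpace ℝ (Fin D))) [SFinite ν] (a : ℝ) {v : ℝ} (hv : 0 < v) :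
    jointLaw ν a v = (ν.prod γ).map fun x => (x.1, a • x.1 + √v • x.2) := by
  refine Measure.ext_of_lintegral _ fun h hh => ?_
  rw [lintegral_jointLaw ν a hv hh, lintegral_map hh (by fun_prop),
    lintegral_prod _ (Measurable.aemeasurable (by fun_prop))]

/-- A sum of independent centered normal vectors is normal. -/
lemma map_add_stdGaussian_prod {u v : ℝ} (hu : 0 ≤ u) (hv : 0 ≤ v) :
    ((γ).prod γ).map (fun x => √u • x.1 + √v • x.2) = (γ).map fun ξ => √(u + v) • ξ := by
  have key : ∀ {c : ℝ}, 0 ≤ c → ∀ t, charFun ((γ).map fun ξ => √c • ξ) t =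
      Complex.exp (-(c * ‖t‖ ^ 2 / 2)) := fun hc t => by
    have := charFun_map_affine_stdGaussian (D := D) 0 hc t
    simpa using this
  have hconv : ((γ).prod γ).map (fun x => √u • x.1 + √v • x.2) =
      ((γ).map fun ξ => √u • ξ) ∗ ((γ).map fun ξ => √v • ξ) := by
    rw [Measure.conv, Measure.map_prod_map _ _ (by fun_prop) (by fun_prop),
      Measure.map_map (by fun_prop) (by fun_prop)]
    rfl
  have hp : ∀ c : ℝ, IsProbabilityMeasure ((γ).map fun ξ => √c • ξ) := fun c =>
    Measure.isProbabilityMeasure_map (by fun_prop)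
  have := hp u
  have := hp v
  have := hp (u + v)
  rw [hconv]
  apply Measure.ext_of_charFun
  ext t
  rw [charFun_conv, key hu, key hv, key (add_nonneg hu hv), ← Complex.exp_add]
  congr 1
  push_cast
  ring

variable {f g : ℝ → ℝ}

lemma Icc_subset_Ico_one {t : ℝ} (ht : t ∈ Ico (0 : ℝ) 1) : Icc 0 t ⊆ Ico (0 : ℝ) 1 :=
  fun _ hs => ⟨hs.1, hs.2.trans_lt ht.2⟩

lemma continuousOn_primitive_Icc {F : Type*} [NormedAddCommGroup F] [NormedSpace ℝ F] {h : ℝ → F} {t : ℝ}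
    (ht : 0 ≤ t) (hh : ContinuousOn h (Icc 0 t)) :
    ContinuousOn (fun s => ∫ u in (0 : ℝ)..s, h u) (Icc 0 t) := by
  have := intervalIntegral.continuousOn_primitive_interval (a := (0 : ℝ)) (b := t) (f := h)
    (μ := volume) (by rw [uIcc_of_le ht]; exact hh.integrableOn_Icc)
  rwa [uIcc_of_le ht] at this

/-- The accumulated noise of the rescaled diffusion `exp (-∫ f) Z`. -/
noncomputable def scaledVar (f g : ℝ → ℝ) (t : ℝ) : ℝ := ∫ s in (0 : ℝ)..t, dampingFactor f s * g s ^ 2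

lemma dampingFactor_eq_sq (f : ℝ → ℝ) (t : ℝ) :
    dampingFactor f t = Real.exp (-∫ s in (0 : ℝ)..t, f s) ^ 2 := by
  rw [dampingFactor, ← Real.exp_nat_mul]
  congr 1
  push_cast
  ring

lemma noiseVar_eq (f g : ℝ → ℝ) (v₀ t : ℝ) :
    noiseVar f g v₀ t = meanCoeff f t ^ 2 * (scaledVar f g t + v₀) := by
  rw [noiseVar, scaledVar, dampingFactor_eq_sq, meanCoeff, Real.exp_neg]
  field_simp

lemma scaledVar_nonneg {t : ℝ} (ht : 0 ≤ t) : 0 ≤ scaledVar f g t :=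
  intervalIntegral.integral_nonneg ht fun _ _ => mul_nonneg (Real.exp_pos _).le (sq_nonneg _)

namespace IsLinearDiffusion

variable {Ω : Type*} [MeasurableSpace Ω] {ν : Measure (EuclideanSpace ℝ (Fin D))} {v₀ : ℝ} {P : Measure Ω}
  {w : ℝ≥0 → Ω → EuclideanSpace ℝ (Fin D)} {U : Ω → EuclideanSpace ℝ (Fin D)}
  {Z : ℝ → Ω → EuclideanSpace ℝ (Fin D)}

/-- The rescaled diffusion has independent centered normal displacements. -/
theorem isIndepGaussian_sub [IsProbabilityMeasure P] (hZ : IsLinearDiffusion f g ν v₀ P w U Z)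
    (hf : ContinuousOn f (Ico 0 1)) (hg : ContinuousOn g (Ico 0 1)) {t : ℝ} (ht : t ∈ Ico (0 : ℝ) 1) :
    IsIndepGaussian P (fun ω => (U ω, Z 0 ω))
      (fun ω => Real.exp (-∫ s in (0 : ℝ)..t, f s) • Z t ω - Z 0 ω) (scaledVar f g t) := by
  have hf' := hf.mono (Icc_subset_Ico_one ht)
  have hg' := hg.mono (Icc_subset_Ico_one ht)
  set e : ℝ → ℝ := fun t => Real.exp (-∫ s in (0 : ℝ)..t, f s) with he
  have hec : ContinuousOn e (Icc 0 t) := (continuousOn_primitive_Icc ht.1 hf').neg.rexp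
  set I : ℝ → Ω → 𝔼 := fun t ω => Z t ω - Z 0 ω - ∫ s in (0 : ℝ)..t, f s • Z s ω with hI
  have hW : ∀ s ∈ Icc 0 t, IsWienerIntegral w P (I s) ((Ioc 0 s).indicator g) := fun s hs =>
    IsWienerIntegral.of_isItoIntegral hs.1 (hg'.mono (Icc_subset_Icc le_rfl hs.2))
      (hZ.sde s (Icc_subset_Ico_one ht hs))
  -- Right endpoints, matching the summation by parts for the integrating factor.
  set p : ℕ → ℕ → ℝ := fun n k => (k + 1) * t / n with hp
  set S : ℕ → ℝ → ℝ := fun n x => ∑ k ∈ Finset.range n,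
    (Ioc (k * t / n : ℝ) ((k + 1) * t / n)).indicator (fun _ => e (p n k)) x with hS
  -- A weighted sum of increments of Itô integrals is the Wiener integral of the step function times
  -- `g`.
  have hsum : ∀ n : ℕ, IsWienerIntegral w P
      (∑ k ∈ Finset.range n, e (p n k) • (I ((k + 1) * t / n) - I (k * t / n)))
      (fun x => S n x * (Ioc 0 t).indicator g x) := by
    intro n
    have h1 := IsWienerIntegral.sum (w := w) (P := P) (N := n)
      (Xs := fun k => I ((k + 1) * t / n) - I (k * t / n))
      (hs := fun k => (-1 : ℝ) • (Ioc 0 (k * t / n : ℝ)).indicator g +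
        (Ioc 0 ((k + 1) * t / n : ℝ)).indicator g) (fun k => e (p n k)) fun k hk => by
          have := (hW _ (mem_Icc_of_mem_cell ht.1 hk (left_mem_cell ht.1 n k))).const_smul_add (-1)
            (hW _ (mem_Icc_of_mem_cell ht.1 hk (right_mem_cell ht.1 n k)))
          rwa [neg_one_smul, neg_add_eq_sub] at this
    convert! h1 using 1
    ext1 x
    simp only [hS, Finset.sum_apply, Finset.sum_mul, Pi.smul_apply, Pi.add_apply, smul_eq_mul]
    refine Finset.sum_congr rfl fun k hk => ?_
    have hk := Finset.mem_range.1 hk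
    have h0 : (0 : ℝ) ≤ k * t / n := by have := ht.1; positivity
    have h2 : (k * t / n : ℝ) ≤ (k + 1) * t / n := (left_mem_cell ht.1 n k).2
    have h3 := (mem_Icc_of_mem_cell ht.1 hk (right_mem_cell ht.1 n k)).2
    by_cases hx1 : x ∈ Ioc (0 : ℝ) (k * t / n)
    · rw [indicator_of_mem hx1,
        indicator_of_mem (show x ∈ Ioc (0 : ℝ) ((k + 1) * t / n) from ⟨hx1.1, hx1.2.trans h2⟩),
        indicator_of_notMem fun h => (h.1.trans_le hx1.2).false]
      simp
    · rw [indicator_of_notMem hx1]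
      by_cases hx2 : x ∈ Ioc (k * t / n : ℝ) ((k + 1) * t / n)
      · rw [indicator_of_mem hx2,
          indicator_of_mem (show x ∈ Ioc (0 : ℝ) ((k + 1) * t / n) from ⟨h0.trans_lt hx2.1, hx2.2⟩),
          indicator_of_mem (show x ∈ Ioc 0 t from ⟨h0.trans_lt hx2.1, hx2.2.trans h3⟩)]
        simp
      · rw [indicator_of_notMem hx2, indicator_of_notMem (s := Ioc 0 ((k + 1) * t / n : ℝ))]
        · simp
        · intro h
          exact hx2 ⟨not_le.1 fun h3 => hx1 ⟨h.1, h3⟩, h.2⟩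
  have hζ : Measurable fun ω => (U ω, Z 0 ω) :=
    hZ.measurable_sample.prodMk (hZ.measurable 0 ⟨le_rfl, one_pos⟩)
  have hlaw := fun n => (hsum n).isIndepGaussian hZ.brownian hζ hZ.indep
  obtain ⟨Ke, hKe⟩ := isCompact_Icc.exists_bound_of_continuousOn hec
  obtain ⟨Kg, hKg⟩ := isCompact_Icc.exists_bound_of_continuousOn hg'
  have hKe0 : 0 ≤ Ke := (norm_nonneg _).trans (hKe 0 ⟨le_rfl, ht.1⟩)
  have hKg0 : 0 ≤ Kg := (norm_nonneg _).trans (hKg 0 ⟨le_rfl, ht.1⟩)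
  have hSm : ∀ n, Measurable (S n) := fun n =>
    Finset.measurable_fun_sum _ fun k _ => measurable_const.indicator measurableSet_Ioc
  have hgm : Measurable ((Ioc 0 t).indicator g) := by
    have h1 : Measurable ((Ioc 0 t).indicator (IccExtend ht.1 ((Icc 0 t).domRestrict g))) :=
      ((continuousOn_iff_continuous_domRestrict.1 hg').Icc_extend' (h := ht.1)).measurable.indicator
        measurableSet_Ioc
    convert! h1 using 1
    refine indicator_congr fun s hs => ?_
    rw [IccExtend_of_mem _ _ ⟨hs.1.le, hs.2⟩]
    rfl
  have hvar := tendsto_integral_sq (hn := fun n x => S n x * (Ioc 0 t).indicator g x)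
    (h := fun x => (Ioc 0 t).indicator e x * (Ioc 0 t).indicator g x) (K := Ke * Kg) (T := t)
    (fun n => (hSm n).mul hgm)
    (fun n x => by
      rw [abs_mul]
      refine mul_le_mul ?_ ?_ (abs_nonneg _) hKe0
      · exact abs_sum_indicator_Ioc_le ht.1 hKe0
          (fun k hk => hKe _ (mem_Icc_of_mem_cell ht.1 hk (right_mem_cell ht.1 n k))) x
      · by_cases hx : x ∈ Ioc 0 t
        · rw [indicator_of_mem hx]; exact hKg x ⟨hx.1.le, hx.2⟩
        · rw [indicator_of_notMem hx]; simpa using hKg0)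
    (fun n x hx => by rw [indicator_of_notMem hx, mul_zero])
    (fun x => (tendsto_sum_indicator_Ioc ht.1 hec (right_mem_cell ht.1) x).mul tendsto_const_nhds)
  have hvar' : ∫ x, ((Ioc 0 t).indicator e x * (Ioc 0 t).indicator g x) ^ 2 = scaledVar f g t := by
    rw [scaledVar, intervalIntegral.integral_of_le ht.1, ← integral_indicator measurableSet_Ioc]
    congr with x
    by_cases hx : x ∈ Ioc 0 t
    · simp only [indicator_of_mem hx, dampingFactor_eq_sq, mul_pow, he]
    · simp [indicator_of_notMem hx]
  rw [hvar'] at hvar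
  -- The sums converge almost surely to the rescaled displacement, while their variances converge to
  -- `∫ e² g² = scaledVar`.
  refine IsIndepGaussian.of_tendstoInMeasure hζ hlaw hvar ?_
  refine tendstoInMeasure_of_tendsto_ae (fun n => (hlaw n).aemeasurable.aestronglyMeasurable) ?_
  filter_upwards [hZ.continuous_paths] with ω hω
  have := tendsto_sum_integratingFactor_of_continuousOn ht.1 hf' (hω.mono (Icc_subset_Ico_one ht))
  refine this.congr fun n => ?_
  simp [hI, he, hp]

lemma noiseVar_pos (hv₀ : 0 < v₀) {t : ℝ} (ht : 0 ≤ t) : 0 < noiseVar f g v₀ t := by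
  rw [noiseVar_eq]
  have := scaledVar_nonneg (f := f) (g := g) ht
  have : 0 < meanCoeff f t := Real.exp_pos _
  positivity

/-- The transition kernel of the diffusion from the sample `U` to the value at time `t`. -/
theorem map_prod_eq_jointLaw [IsProbabilityMeasure P] [SFinite ν] (hZ : IsLinearDiffusion f g ν v₀ P w U Z)
    (hv₀ : 0 < v₀) (hf : ContinuousOn f (Ico 0 1)) (hg : ContinuousOn g (Ico 0 1)) {t : ℝ}
    (ht : t ∈ Ico (0 : ℝ) 1) :
    P.map (fun ω => (U ω, Z t ω)) = jointLaw ν (meanCoeff f t) (noiseVar f g v₀ t) := by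
  have hW := hZ.isIndepGaussian_sub hf hg ht
  set a := meanCoeff f t with ha
  have ha0 : 0 < a := Real.exp_pos _
  set W : Ω → 𝔼 := fun ω => Real.exp (-∫ s in (0 : ℝ)..t, f s) • Z t ω - Z 0 ω with hWdef
  set τ := scaledVar f g t with hτ
  have hτ0 : 0 ≤ τ := scaledVar_nonneg ht.1
  have hζ : Measurable fun ω => (U ω, Z 0 ω) :=
    hZ.measurable_sample.prodMk (hZ.measurable 0 ⟨le_rfl, one_pos⟩)
  -- Undo the integrating factor: `Z t = a (Z 0 + W)`.
  have hZt : (fun ω => (U ω, Z t ω)) =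
      (fun x : (𝔼 × 𝔼) × 𝔼 => (x.1.1, a • (x.1.2 + x.2))) ∘ fun ω => ((U ω, Z 0 ω), W ω) := by
    ext1 ω
    simp only [Function.comp_apply, hWdef, add_sub_cancel, smul_smul, ha, meanCoeff]
    rw [← Real.exp_add, add_neg_cancel, Real.exp_zero, one_smul]
  have hmap : P.map (fun ω => (U ω, Z t ω)) = ((jointLaw ν 1 v₀).prod ((γ).map fun ξ => √τ • ξ)).map
      (fun x : (𝔼 × 𝔼) × 𝔼 => (x.1.1, a • (x.1.2 + x.2))) := by
    rw [hZt, ← AEMeasurable.map_map_of_aemeasurable (by fun_prop)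
      (hζ.aemeasurable.prodMk hW.aemeasurable), hW.map_eq, hZ.initial_law]
  have hsf : SFinite (jointLaw ν 1 v₀) := by rw [jointLaw_eq_map ν 1 hv₀]; infer_instance
  rw [hmap]
  refine Measure.ext_of_lintegral _ fun h hh => ?_
  have hmeas : Measurable fun x : 𝔼 × 𝔼 =>
      ∫⁻ y, h (x.1, a • (x.2 + y)) ∂((γ).map fun ξ => √τ • ξ) :=
    (hh.comp (by fun_prop : Measurable fun x : (𝔼 × 𝔼) × 𝔼 =>
      (x.1.1, a • (x.1.2 + x.2)))).lintegral_prod_right'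
  rw [lintegral_map hh (by fun_prop), lintegral_prod _ (Measurable.aemeasurable (by fun_prop)),
    lintegral_jointLaw ν a (noiseVar_pos hv₀ ht.1) hh]
  refine (lintegral_jointLaw ν 1 hv₀ hmeas).trans ?_
  refine lintegral_congr fun z => ?_
  -- The initial noise of variance `v₀` and the accumulated noise of variance `τ` merge, and are
  -- then scaled by `a`.
  have hv : √(noiseVar f g v₀ t) = a * √(v₀ + τ) := by
    rw [noiseVar_eq, Real.sqrt_mul (sq_nonneg _), Real.sqrt_sq ha0.le, add_comm]
  have hsum := map_add_stdGaussian_prod (D := D) hv₀.le hτ0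
  have hmz : Measurable fun y : 𝔼 => h (z, a • z + a • y) := hh.comp (by fun_prop)
  calc _ = ∫⁻ ξ, ∫⁻ η, h (z, a • z + a • (√v₀ • ξ + √τ • η)) ∂γ ∂γ := by
        refine lintegral_congr fun ξ => ?_
        rw [lintegral_map (by fun_prop) (by fun_prop)]
        refine lintegral_congr fun η => ?_
        simp only [one_smul, smul_add, add_assoc]
    _ = ∫⁻ x, h (z, a • z + a • x) ∂((γ).map fun ξ => √(v₀ + τ) • ξ) := by
        rw [← hsum, lintegral_map hmz (by fun_prop),
          lintegral_prod _ (Measurable.aemeasurable (by fun_prop))]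
    _ = _ := by
        rw [lintegral_map hmz (by fun_prop), hv]
        simp only [smul_smul]

end IsLinearDiffusion

end LinearDiffusion

/-! ### Diffused density, its score, and the conditional cross entropy. -/

section MixtureDensity

variable {D : ℕ}

local notation "𝔼" => EuclideanSpace ℝ (Fin D)
local notation "γ" => stdGaussian (EuclideanSpace ℝ (Fin D))
local notation "⟪" x ", " y "⟫" => inner ℝ x y

/-- The law of `b - z` for `b ∼ p`. -/
noncomputable def recentered (p : Measure (EuclideanSpace ℝ (Fin D))) (z : EuclideanSpace ℝ (Fin D)) :
    Measure (EuclideanSpace ℝ (Fin D)) :=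
  p.map fun b => b - z

instance (p : Measure (EuclideanSpace ℝ (Fin D))) [IsProbabilityMeasure p] (z : EuclideanSpace ℝ (Fin D)) :
    IsProbabilityMeasure (recentered p z) :=
  Measure.isProbabilityMeasure_map (by fun_prop)

/-- The density of the second marginal of `jointLaw p a v`. -/
noncomputable def mixtureDensity (p : Measure (EuclideanSpace ℝ (Fin D))) (a v : ℝ)
    (x : EuclideanSpace ℝ (Fin D)) : ℝ :=
  ∫ z, normalDensity (a • z) v x ∂p

/-- The Gaussian average of the squared norm of the posterior mean. -/
noncomputable def posteriorMeanSq (β : Measure (EuclideanSpace ℝ (Fin D))) (r : ℝ) : ℝ :=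
  ∫ ξ, ‖tiltMean β r ξ‖ ^ 2 ∂(stdGaussian (EuclideanSpace ℝ (Fin D)))

lemma normalDensity_le (m : 𝔼) {v : ℝ} (hv : 0 < v) (x : 𝔼) :
    normalDensity m v x ≤ (2 * Real.pi * v) ^ (-(D : ℝ) / 2) := by
  unfold normalDensity
  refine mul_le_of_le_one_right (by positivity) (Real.exp_le_one_iff.2 ?_)
  rw [neg_div, neg_nonpos]
  positivity

lemma log_normalDensity (m : 𝔼) {v : ℝ} (hv : 0 < v) (x : 𝔼) :
    Real.log (normalDensity m v x) = -(D : ℝ) / 2 * Real.log (2 * Real.pi * v) - ‖x - m‖ ^ 2 / (2 * v) := by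
  unfold normalDensity
  rw [Real.log_mul (by positivity) (Real.exp_pos _).ne', Real.log_exp, Real.log_rpow (by positivity)]
  ring

lemma continuous_normalDensity_smul (a v : ℝ) :
    Continuous fun x : 𝔼 × 𝔼 => normalDensity (a • x.1) v x.2 := by
  unfold normalDensity; fun_prop

lemma continuous_normalDensity_smul_left (a v : ℝ) (x : 𝔼) :
    Continuous fun z : 𝔼 => normalDensity (a • z) v x := by
  unfold normalDensity; fun_prop

/-- With differentiability known, as it is for a smooth log density, line derivatives suffice to
compute the gradient. -/
lemma gradient_eq_of_hasLineDerivAt {F : 𝔼 → ℝ} {x G : 𝔼} (hF : DifferentiableAt ℝ F x)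
    (h : ∀ u, HasLineDerivAt ℝ F ⟪G, u⟫ x u) : gradient F x = G := by
  refine ext_inner_right ℝ fun u => ?_
  rw [inner_gradient_left]
  exact (hF.hasFDerivAt.hasLineDerivAt u).unique (h u)

lemma gradient_log_normalDensity (m : 𝔼) {v : ℝ} (hv : 0 < v) (x : 𝔼) :
    gradient (fun y => Real.log (normalDensity m v y)) x = -(1 / v) • (x - m) := by
  simp_rw [log_normalDensity m hv]
  refine gradient_eq_of_hasLineDerivAt ?_ fun u => ?_
  · have : DifferentiableAt ℝ (fun y : 𝔼 => ‖y - m‖ ^ 2) x :=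
      (differentiableAt_id.sub_const m).norm_sq ℝ
    simp_rw [div_eq_mul_inv _ (2 * v)]
    exact (this.mul_const _).const_sub _
  · have h1 := ((hasDerivAt_norm_sq_add_smul (x - m) u 0).div_const (2 * v)).const_sub
      (-(D : ℝ) / 2 * Real.log (2 * Real.pi * v))
    unfold HasLineDerivAt
    simp only [sub_add_eq_add_sub] at h1
    refine h1.congr_deriv ?_
    simp only [zero_smul, add_zero, real_inner_smul_left]
    field_simp

variable (p : Measure (EuclideanSpace ℝ (Fin D)))

lemma tiltMass_recentered (z : 𝔼) (r : ℝ) (ξ : 𝔼) :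
    tiltMass (recentered p z) r ξ = ∫ b, tiltWeight r ξ (b - z) ∂p :=
  integral_map (by fun_prop) (measurable_tiltWeight _ _).aestronglyMeasurable

/-- With `r = a / √v` one has `x - a b = √v (ξ - r (b - z))`; expanding the square separates the
noise density from the tilt weight at `b - z`. -/
lemma mixtureDensity_eq (a : ℝ) {v : ℝ} (hv : 0 < v) (z ξ : 𝔼) :
    mixtureDensity p a v (a • z + √v • ξ) =
      (2 * Real.pi * v) ^ (-(D : ℝ) / 2) * Real.exp (-‖ξ‖ ^ 2 / 2) *
        tiltMass (recentered p z) (a / √v) ξ := by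
  rw [tiltMass_recentered, mixtureDensity, ← integral_const_mul]
  refine integral_congr_ae (ae_of_all _ fun b => ?_)
  simp only [normalDensity, tiltWeight]
  rw [mul_assoc _ (Real.exp (-‖ξ‖ ^ 2 / 2)), ← Real.exp_add]
  congr 2
  have hs : √v ≠ 0 := (Real.sqrt_pos.2 hv).ne'
  have h1 : a • z + √v • ξ - a • b = √v • (ξ - (a / √v) • (b - z)) := by
    rw [smul_sub, smul_smul, mul_div_cancel₀ _ hs, smul_sub]
    abel
  rw [h1, norm_smul, Real.norm_of_nonneg (Real.sqrt_nonneg v), mul_pow, Real.sq_sqrt hv.le,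
    norm_sub_sq_real, real_inner_smul_right, norm_smul, mul_pow, Real.norm_eq_abs, sq_abs,
    real_inner_comm]
  field_simp
  ring

variable [IsProbabilityMeasure p]

lemma log_mixtureDensity (a : ℝ) {v : ℝ} (hv : 0 < v) (z ξ : 𝔼) :
    Real.log (mixtureDensity p a v (a • z + √v • ξ)) =
      -((D : ℝ) / 2 * Real.log (2 * Real.pi * v)) - ‖ξ‖ ^ 2 / 2 +
        Real.log (tiltMass (recentered p z) (a / √v) ξ) := by
  rw [mixtureDensity_eq p a hv, Real.log_mul (by positivity) (tiltMass_pos _ _ _).ne',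
    Real.log_mul (by positivity) (Real.exp_pos _).ne', Real.log_exp, Real.log_rpow (by positivity)]
  ring

lemma continuous_mixtureDensity (a : ℝ) {v : ℝ} (hv : 0 < v) : Continuous (mixtureDensity p a v) :=
  continuous_of_dominated
    (fun x => ((continuous_normalDensity_smul a v).comp
      (by fun_prop : Continuous fun z : 𝔼 => (z, x))).aestronglyMeasurable)
    (fun x => ae_of_all _ fun z => by
      rw [Real.norm_of_nonneg (normalDensity_nonneg _ hv x)]; exact normalDensity_le _ hv x)
    (integrable_const _) (ae_of_all _ fun z => continuous_normalDensity _ _)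

lemma integrable_normalDensity_smul (a : ℝ) {v : ℝ} (hv : 0 < v) (x : 𝔼) :
    Integrable (fun z => normalDensity (a • z) v x) p := by
  have hc := continuous_normalDensity_smul_left a v x
  refine (integrable_const ((2 * Real.pi * v) ^ (-(D : ℝ) / 2))).mono' hc.aestronglyMeasurable
    (ae_of_all _ fun z => ?_)
  rw [Real.norm_of_nonneg (normalDensity_nonneg _ hv x)]
  exact normalDensity_le _ hv x

lemma lintegral_ofReal_normalDensity_smul (a : ℝ) {v : ℝ} (hv : 0 < v) (x : 𝔼) :
    ∫⁻ z, ENNReal.ofReal (normalDensity (a • z) v x) ∂p = ENNReal.ofReal (mixtureDensity p a v x) :=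
  (ofReal_integral_eq_lintegral_ofReal (integrable_normalDensity_smul p a hv x)
    (ae_of_all _ fun _ => normalDensity_nonneg _ hv x)).symm

lemma map_snd_jointLaw (a : ℝ) {v : ℝ} (hv : 0 < v) :
    (jointLaw p a v).map Prod.snd =
      volume.withDensity fun x => ENNReal.ofReal (mixtureDensity p a v x) := by
  have hN := (continuous_normalDensity_smul (D := D) a v).measurable.ennreal_ofReal
  have hM := (continuous_mixtureDensity p a hv).measurable.ennreal_ofReal
  refine Measure.ext_of_lintegral _ fun h hh => ?_
  have hh2 : Measurable fun x : 𝔼 × 𝔼 => h x.2 := hh.comp measurable_snd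
  rw [lintegral_map hh measurable_snd, jointLaw, lintegral_withDensity_eq_lintegral_mul _ hN hh2,
    lintegral_prod_symm _ (hN.mul hh2).aemeasurable, lintegral_withDensity_eq_lintegral_mul _ hM hh]
  refine lintegral_congr fun x => ?_
  have hNx : Measurable fun z : 𝔼 => ENNReal.ofReal (normalDensity (a • z) v x) :=
    (continuous_normalDensity_smul_left a v x).measurable.ennreal_ofReal
  exact (lintegral_mul_const (h x) hNx).trans
    (congrArg (· * h x) (lintegral_ofReal_normalDensity_smul p a hv x))

/-- A positive density with continuous logarithm of the second marginal of `jointLaw p a v` is the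
mixture density everywhere. -/
lemma eq_mixtureDensity_of_map_snd (a : ℝ) {v : ℝ} (hv : 0 < v) {ρ : 𝔼 → ℝ} (hpos : ∀ x, 0 < ρ x)
    (hcont : Continuous fun x => Real.log (ρ x))
    (hρ : (jointLaw p a v).map Prod.snd = volume.withDensity fun x => ENNReal.ofReal (ρ x)) :
    ρ = mixtureDensity p a v := by
  have hρc : Continuous ρ := by
    have := hcont.rexp
    simpa only [Real.exp_log (hpos _)] using this
  have hmc := continuous_mixtureDensity p a hv
  rw [map_snd_jointLaw p a hv, withDensity_eq_iff_of_sigmaFinite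
    hmc.measurable.ennreal_ofReal.aemeasurable hρc.measurable.ennreal_ofReal.aemeasurable] at hρ
  -- Continuous functions equal almost everywhere for Lebesgue measure are equal, so the prescribed
  -- version is the mixture density pointwise and gradients can be compared.
  refine (hρc.ae_eq_iff_eq volume hmc).1 ?_
  filter_upwards [hρ] with x hx
  have h0 : 0 ≤ mixtureDensity p a v x :=
    integral_nonneg fun z => normalDensity_nonneg _ hv x
  exact ((ENNReal.ofReal_eq_ofReal_iff h0 (hpos x).le).1 hx).symm

/-- Tweedie's formula. -/
lemma gradient_log_mixtureDensity {a v : ℝ} (ha : 0 < a) (hv : 0 < v) (z ξ : 𝔼)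
    (hd : Differentiable ℝ fun x => Real.log (mixtureDensity p a v x)) :
    gradient (fun x => Real.log (mixtureDensity p a v x)) (a • z + √v • ξ) =
      (1 / √v) • ((a / √v) • tiltMean (recentered p z) (a / √v) ξ - ξ) := by
  have hs : 0 < √v := Real.sqrt_pos.2 hv
  refine gradient_eq_of_hasLineDerivAt (hd _) fun u => ?_
  have h1 : HasDerivAt _ _ _ :=
    hasLineDerivAt_log_tiltMass (recentered p z) (div_pos ha hs) ξ ((1 / √v) • u)
  have h2 := (((hasDerivAt_norm_sq_add_smul ξ ((1 / √v) • u) 0).div_const 2).const_sub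
    (-((D : ℝ) / 2 * Real.log (2 * Real.pi * v)))).add h1
  unfold HasLineDerivAt
  -- Moving `x` along `u` moves `ξ` along `u / √v`.
  have h3 : ∀ s : ℝ, a • z + √v • ξ + s • u = a • z + √v • (ξ + s • (1 / √v) • u) := by
    intro s
    rw [smul_add √v, smul_comm s, smul_smul (√v), mul_one_div_cancel hs.ne', one_smul, add_assoc]
  simp_rw [h3, log_mixtureDensity p a hv]
  refine h2.congr_deriv ?_
  simp only [zero_smul, add_zero, real_inner_smul_left, real_inner_smul_right, inner_sub_left]
  ring

lemma measurable_posteriorMeanSq :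
    Measurable fun x : ℝ × 𝔼 => posteriorMeanSq (recentered p x.2) x.1 := by
  unfold posteriorMeanSq
  refine (StronglyMeasurable.integral_prod_right' (ν := γ)
    (f := fun y : (ℝ × 𝔼) × 𝔼 => ‖tiltMean (recentered p y.1.2) y.1.1 y.2‖ ^ 2) ?_).measurable
  exact (((measurable_tiltMean_map p).comp (by fun_prop : Measurable fun y : (ℝ × 𝔼) × 𝔼 =>
    (y.1.1, y.1.2, y.2))).norm.pow_const 2).stronglyMeasurable

lemma posteriorMeanSq_nonneg (β : Measure 𝔼) (r : ℝ) : 0 ≤ posteriorMeanSq β r :=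
  integral_nonneg fun _ => sq_nonneg _

/-- The kernel score is `-ξ / √v`, which cancels the same term in Tweedie's formula and leaves `-(a
/ v)` times the posterior mean. -/
lemma denoisingError_mixtureDensity (q : Measure (EuclideanSpace ℝ (Fin D))) [IsProbabilityMeasure q]
    {a v : ℝ} (ha : 0 < a) (hv : 0 < v)
    (hd : ContDiff ℝ (⊤ : ℕ∞) fun x => Real.log (mixtureDensity p a v x)) :
    denoisingError q a v (mixtureDensity p a v) =
      ∫⁻ z, ENNReal.ofReal (a ^ 2 / v ^ 2 * posteriorMeanSq (recentered p z) (a / √v)) ∂q := by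
  have hs : 0 < √v := Real.sqrt_pos.2 hv
  have hgc : Continuous (gradient fun x => Real.log (mixtureDensity p a v x)) :=
    (InnerProductSpace.toDual ℝ 𝔼).symm.continuous.comp (hd.continuous_fderiv (by simp))
  unfold denoisingError
  simp_rw [gradient_log_normalDensity _ hv]
  rw [lintegral_jointLaw q a hv]
  · refine lintegral_congr fun z => ?_
    have hr : 0 < a / √v := div_pos ha hs
    have hpt : ∀ ξ : 𝔼, ‖-(1 / v) • (a • z + √v • ξ - a • z) -
        gradient (fun x => Real.log (mixtureDensity p a v x)) (a • z + √v • ξ)‖ ^ 2 =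
        a ^ 2 / v ^ 2 * ‖tiltMean (recentered p z) (a / √v) ξ‖ ^ 2 := by
      intro ξ
      rw [gradient_log_mixtureDensity p ha hv z ξ (hd.differentiable (by simp)), add_sub_cancel_left]
      have h1 : (1 / v) * √v = 1 / √v := by
        field_simp
        rw [Real.sq_sqrt hv.le]
      have h2 : -(1 / v) • √v • ξ - (1 / √v) • ((a / √v) • tiltMean (recentered p z) (a / √v) ξ - ξ) =
          -(a / v) • tiltMean (recentered p z) (a / √v) ξ := by
        have h3 : (1 / √v) * (a / √v) = a / v := by
          field_simp
          rw [Real.sq_sqrt hv.le]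
        rw [smul_smul, neg_mul, h1, smul_sub, smul_smul, h3, neg_smul, neg_smul]
        abel
      rw [h2, norm_smul, mul_pow, Real.norm_eq_abs, sq_abs]
      ring
    simp only [hpt]
    rw [posteriorMeanSq, ← integral_const_mul, ofReal_integral_eq_lintegral_ofReal]
    · exact (integrable_norm_tiltMean_sq _ hr).const_mul _
    · exact ae_of_all _ fun ξ => by positivity
  · have : Continuous fun x : 𝔼 × 𝔼 => ‖-(1 / v) • (x.2 - a • x.1) -
        gradient (fun x => Real.log (mixtureDensity p a v x)) x.2‖ ^ 2 := by fun_prop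
    exact this.measurable.ennreal_ofReal

/-- The cross entropy between a normal distribution and the mixture density, with the positive and
the negative part of the integrand separated. -/
lemma lintegral_neg_log_mixtureDensity {v : ℝ} (hv : 0 < v) (z : 𝔼) :
    ∫⁻ ξ, ENNReal.ofReal (-Real.log (mixtureDensity p 1 v (z + √v • ξ))) ∂γ +
        ENNReal.ofReal (-((D : ℝ) / 2 * Real.log (2 * Real.pi * Real.exp 1 * v))) =
      ∫⁻ ξ, ENNReal.ofReal (Real.log (mixtureDensity p 1 v (z + √v • ξ))) ∂γ +
        ENNReal.ofReal (-freeEnergy (recentered p z) (1 / √v)) +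
        ENNReal.ofReal ((D : ℝ) / 2 * Real.log (2 * Real.pi * Real.exp 1 * v)) := by
  have hs : 0 < √v := Real.sqrt_pos.2 hv
  have hr : 0 < 1 / √v := by positivity
  set L : 𝔼 → ℝ := fun ξ => -Real.log (mixtureDensity p 1 v (z + √v • ξ)) with hL
  have hLe : ∀ ξ, L ξ = (D : ℝ) / 2 * Real.log (2 * Real.pi * v) + ‖ξ‖ ^ 2 / 2 -
      Real.log (tiltMass (recentered p z) (1 / √v) ξ) := by
    intro ξ
    have := log_mixtureDensity p 1 hv z ξ
    rw [one_smul] at this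
    simp only [hL, this]
    ring
  have i1 : Integrable (fun ξ : 𝔼 => (D : ℝ) / 2 * Real.log (2 * Real.pi * v) + ‖ξ‖ ^ 2 / 2) γ :=
    (integrable_const _).add (integrable_norm_sq_stdGaussian.div_const 2)
  have i2 := integrable_log_tiltMass (recentered p z) hr.le
  have hLi : Integrable L γ := by
    simp_rw [funext hLe]
    exact i1.sub i2
  have hint : ∫ ξ, L ξ ∂γ = (D : ℝ) / 2 * Real.log (2 * Real.pi * Real.exp 1 * v) -
      freeEnergy (recentered p z) (1 / √v) := by
    simp_rw [hLe]
    rw [integral_sub i1 i2, integral_add (integrable_const _) (integrable_norm_sq_stdGaussian.div_const 2),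
      integral_div, integral_norm_sq_stdGaussian]
    -- The `D / 2` from `E‖ξ‖² / 2` supplies the factor `e` in the entropy of the noise.
    have : Real.log (2 * Real.pi * Real.exp 1 * v) = Real.log (2 * Real.pi * v) + 1 := by
      rw [mul_right_comm, Real.log_mul (by positivity) (Real.exp_pos 1).ne', Real.log_exp]
    rw [this, freeEnergy]
    simp
    ring
  rw [integral_eq_lintegral_pos_part_sub_lintegral_neg_part hLi] at hint
  have hA : ∫⁻ ξ, ENNReal.ofReal (L ξ) ∂γ ≠ ∞ := hLi.lintegral_lt_top.ne
  have hB : ∫⁻ ξ, ENNReal.ofReal (-L ξ) ∂γ ≠ ∞ := hLi.neg.lintegral_lt_top.ne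
  have hLB : ∀ ξ, Real.log (mixtureDensity p 1 v (z + √v • ξ)) = -L ξ := fun ξ => by simp [hL]
  change ∫⁻ ξ, ENNReal.ofReal (L ξ) ∂γ + _ = _
  have hR : ∫⁻ ξ, ENNReal.ofReal (Real.log (mixtureDensity p 1 v (z + √v • ξ))) ∂γ =
      ∫⁻ ξ, ENNReal.ofReal (-L ξ) ∂γ := lintegral_congr fun ξ => by rw [hLB]
  rw [hR]
  -- For fixed `z` all terms are finite, so the identity may be checked in the reals.
  rw [← ENNReal.toReal_eq_toReal_iff' (by simp [hA]) (by simp [hB]), ENNReal.toReal_add hA (by simp),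
    ENNReal.toReal_add (by simp [hB]) (by simp), ENNReal.toReal_add hB (by simp),
    ENNReal.toReal_ofReal', ENNReal.toReal_ofReal (neg_nonneg.2 (freeEnergy_nonpos _ hr.le)),
    ENNReal.toReal_ofReal']
  have hmax : ∀ c : ℝ, max c 0 - max (-c) 0 = c := fun c => by
    rcases le_total 0 c with h | h
    · rw [max_eq_left h, max_eq_right (by linarith)]; ring
    · rw [max_eq_right h, max_eq_left (by linarith)]; ring
  have := hmax ((D : ℝ) / 2 * Real.log (2 * Real.pi * Real.exp 1 * v))
  linarith

end MixtureDensity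

/-! ### Signal ratio along the noise schedule. -/

section NoiseSchedule

/-- The ratio of the coefficient of the sample and the standard deviation of the noise. -/
noncomputable def signalRatio (f g : ℝ → ℝ) (v₀ t : ℝ) : ℝ :=
  (√(scaledVar f g t + v₀))⁻¹

variable {f g : ℝ → ℝ} {v₀ : ℝ}

lemma scaledVar_add_pos (hv₀ : 0 < v₀) {t : ℝ} (ht : 0 ≤ t) : 0 < scaledVar f g t + v₀ :=
  add_pos_of_nonneg_of_pos (scaledVar_nonneg ht) hv₀

lemma signalRatio_pos (hv₀ : 0 < v₀) {t : ℝ} (ht : 0 ≤ t) : 0 < signalRatio f g v₀ t :=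
  inv_pos.2 (Real.sqrt_pos.2 (scaledVar_add_pos hv₀ ht))

lemma meanCoeff_pos (f : ℝ → ℝ) (t : ℝ) : 0 < meanCoeff f t := Real.exp_pos _

lemma meanCoeff_div_sqrt_noiseVar (f g : ℝ → ℝ) (v₀ t : ℝ) :
    meanCoeff f t / √(noiseVar f g v₀ t) = signalRatio f g v₀ t := by
  have ha := meanCoeff_pos f t
  rw [noiseVar_eq, Real.sqrt_mul (sq_nonneg _), Real.sqrt_sq ha.le, signalRatio, div_mul_eq_div_div,
    div_self ha.ne', one_div]

lemma sq_meanCoeff_div_sq_noiseVar (f g : ℝ → ℝ) (v₀ t : ℝ) :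
    meanCoeff f t ^ 2 / noiseVar f g v₀ t ^ 2 =
      dampingFactor f t / (scaledVar f g t + v₀) ^ 2 := by
  have ha := meanCoeff_pos f t
  have hF : dampingFactor f t = (meanCoeff f t ^ 2)⁻¹ := by
    rw [dampingFactor_eq_sq, Real.exp_neg, inv_pow, meanCoeff]
  rw [noiseVar_eq, hF, mul_pow, div_mul_eq_div_div, div_eq_mul_inv _ ((meanCoeff f t ^ 2) ^ 2)]
  congr 1
  field_simp

lemma continuousOn_primitive_Ico {h : ℝ → ℝ} (hh : ContinuousOn h (Ico 0 1)) :
    ContinuousOn (fun s => ∫ u in (0 : ℝ)..s, h u) (Ico 0 1) := by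
  intro s hs
  -- Work on `[0, t]` with `s < t < 1`, since `h` may fail to be integrable up to `1`.
  obtain ⟨t, hst, ht⟩ := exists_between hs.2
  have ht0 : t ∈ Ico (0 : ℝ) 1 := ⟨hs.1.trans hst.le, ht⟩
  refine ((continuousOn_primitive_Icc ht0.1 (hh.mono (Icc_subset_Ico_one ht0))) s
    ⟨hs.1, hst.le⟩).mono_of_mem_nhdsWithin ?_
  filter_upwards [self_mem_nhdsWithin, mem_nhdsWithin_of_mem_nhds (Iio_mem_nhds hst)] with u hu hu'
  exact ⟨hu.1, hu'.le⟩

lemma continuousOn_dampingFactor (hf : ContinuousOn f (Ico 0 1)) :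
    ContinuousOn (dampingFactor f) (Ico 0 1) :=
  ((continuousOn_primitive_Ico hf).const_mul (-2)).rexp

lemma continuousOn_dampingFactor_mul_sq (hf : ContinuousOn f (Ico 0 1)) (hg : ContinuousOn g (Ico 0 1)) :
    ContinuousOn (fun s => dampingFactor f s * g s ^ 2) (Ico 0 1) :=
  (continuousOn_dampingFactor hf).mul (hg.pow 2)

lemma continuousOn_scaledVar (hf : ContinuousOn f (Ico 0 1)) (hg : ContinuousOn g (Ico 0 1)) :
    ContinuousOn (scaledVar f g) (Ico 0 1) :=
  continuousOn_primitive_Ico (continuousOn_dampingFactor_mul_sq hf hg)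

lemma hasDerivAt_scaledVar (hf : ContinuousOn f (Ico 0 1)) (hg : ContinuousOn g (Ico 0 1)) {t : ℝ}
    (ht : t ∈ Ioo (0 : ℝ) 1) :
    HasDerivAt (scaledVar f g) (dampingFactor f t * g t ^ 2) t := by
  have hc := continuousOn_dampingFactor_mul_sq hf hg
  have hcO := hc.mono Ioo_subset_Ico_self
  refine intervalIntegral.integral_hasDerivAt_right ?_
    (hcO.stronglyMeasurableAtFilter isOpen_Ioo t ht) (hcO.continuousAt (isOpen_Ioo.mem_nhds ht))
  refine ContinuousOn.intervalIntegrable ?_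
  rw [uIcc_of_le ht.1.le]
  exact hc.mono (Icc_subset_Ico_one ⟨ht.1.le, ht.2⟩)

lemma continuousOn_signalRatio (hv₀ : 0 < v₀) (hf : ContinuousOn f (Ico 0 1))
    (hg : ContinuousOn g (Ico 0 1)) : ContinuousOn (signalRatio f g v₀) (Ico 0 1) :=
  ((continuousOn_scaledVar hf hg).add continuousOn_const).sqrt.inv₀ fun _ ht =>
    (Real.sqrt_pos.2 (scaledVar_add_pos hv₀ ht.1)).ne'

/-- With `S = scaledVar + v₀`, the ratio is `S^(-1/2)`. The derivative is arranged so that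
multiplying it by `-signalRatio` cancels `√S` and leaves the weight of the denoising error. -/
lemma hasDerivAt_signalRatio (hv₀ : 0 < v₀) (hf : ContinuousOn f (Ico 0 1))
    (hg : ContinuousOn g (Ico 0 1)) {t : ℝ} (ht : t ∈ Ioo (0 : ℝ) 1) :
    HasDerivAt (signalRatio f g v₀) (-(g t ^ 2 / 2 * (dampingFactor f t / (scaledVar f g t + v₀) ^ 2) *
      √(scaledVar f g t + v₀))) t := by
  have hS : 0 < scaledVar f g t + v₀ := scaledVar_add_pos hv₀ ht.1.le
  have hs := Real.sqrt_pos.2 hS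
  refine ((((hasDerivAt_scaledVar hf hg ht).add_const v₀).sqrt hS.ne').fun_inv hs.ne').congr_deriv ?_
  have hsq : scaledVar f g t + v₀ = √(scaledVar f g t + v₀) ^ 2 := (Real.sq_sqrt hS.le).symm
  generalize √(scaledVar f g t + v₀) = s at hs hsq ⊢
  rw [hsq]
  field_simp

lemma antitoneOn_signalRatio (hv₀ : 0 < v₀) (hf : ContinuousOn f (Ico 0 1))
    (hg : ContinuousOn g (Ico 0 1)) : AntitoneOn (signalRatio f g v₀) (Ico 0 1) := by
  refine antitoneOn_of_hasDerivWithinAt_nonpos (convex_Ico 0 1) (continuousOn_signalRatio hv₀ hf hg)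
    (fun t ht => (hasDerivAt_signalRatio hv₀ hf hg ?_).hasDerivWithinAt) fun t ht => ?_
  · rwa [interior_Ico] at ht
  · have : 0 ≤ dampingFactor f t := (Real.exp_pos _).le
    rw [neg_nonpos]
    positivity

/-- A decreasing positive function has a nonnegative limit, whatever the coefficients do near `1`.
-/
lemma exists_tendsto_signalRatio (hv₀ : 0 < v₀) (hf : ContinuousOn f (Ico 0 1))
    (hg : ContinuousOn g (Ico 0 1)) :
    ∃ r, 0 ≤ r ∧ Tendsto (signalRatio f g v₀) (𝓝[<] 1) (𝓝 r) := by
  have hm : MonotoneOn (fun t => -signalRatio f g v₀ t) (Ioo 0 1) :=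
    ((antitoneOn_signalRatio hv₀ hf hg).mono Ioo_subset_Ico_self).neg
  have := hm.tendsto_nhdsWithin_Ioo_left ⟨1 / 2, by norm_num⟩
    ⟨0, by rintro _ ⟨t, ht, rfl⟩; exact neg_nonpos.2 (signalRatio_pos hv₀ ht.1.le).le⟩
  refine ⟨_, ?_, by simpa using this.neg⟩
  refine ge_of_tendsto (by simpa using this.neg) ?_
  filter_upwards [Ioo_mem_nhdsLT (zero_lt_one' ℝ)] with t ht using (signalRatio_pos hv₀ ht.1.le).le

end NoiseSchedule

/-! ### Consequences of the common normal limit at time one. -/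

section Terminal

variable {D : ℕ}

local notation "𝔼" => EuclideanSpace ℝ (Fin D)
local notation "γ" => stdGaussian (EuclideanSpace ℝ (Fin D))

lemma charFun_map_snd_jointLaw (ν : Measure (EuclideanSpace ℝ (Fin D))) [IsProbabilityMeasure ν] (a : ℝ)
    {v : ℝ} (hv : 0 < v) (θ : 𝔼) :
    charFun ((jointLaw ν a v).map Prod.snd) θ =
      charFun ν (a • θ) * Complex.exp (-(v * ‖θ‖ ^ 2 / 2)) := by
  have hγ := charFun_map_affine_stdGaussian (D := D) 0 hv.le θ
  simp only [zero_add, inner_zero_left, Complex.ofReal_zero, zero_mul, zero_sub] at hγ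
  rw [← hγ, jointLaw_eq_map ν a hv, Measure.map_map measurable_snd (by fun_prop), charFun_apply,
    charFun_apply, charFun_apply, integral_map (by fun_prop) (by fun_prop),
    integral_map (by fun_prop) (by fun_prop), ← integral_prod_mul]
  refine integral_congr_ae (ae_of_all _ fun x => ?_)
  simp only [Function.comp_apply]
  rw [← Complex.exp_add, inner_add_left, real_inner_smul_left, real_inner_smul_right]
  push_cast
  ring_nf

lemma eq_dirac_zero_of_charFun_eq_one {ν : Measure (EuclideanSpace ℝ (Fin D))} [IsProbabilityMeasure ν]
    (h : ∀ θ, charFun ν θ = 1) : ν = Measure.dirac 0 := by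
  apply Measure.ext_of_charFun
  ext θ
  rw [h, charFun_dirac]
  simp

lemma tendsto_charFun_of_tendstoInDistribution {Ω Ω' : Type*} [MeasurableSpace Ω] [MeasurableSpace Ω']
    {P : Measure Ω} [IsProbabilityMeasure P] {P' : Measure Ω'} [IsProbabilityMeasure P']
    {ι : Type*} {l : Filter ι} {X : ι → Ω → EuclideanSpace ℝ (Fin D)} {X₁ : Ω' → EuclideanSpace ℝ (Fin D)}
    (h : TendstoInDistribution X l X₁ (fun _ => P) P') (θ : 𝔼) :
    Tendsto (fun i => charFun (P.map (X i)) θ) l (𝓝 (charFun (P'.map X₁) θ)) := by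
  simp_rw [charFun_eq_integral_innerProbChar]
  exact (ProbabilityMeasure.tendsto_iff_forall_integral_rclike_tendsto ℂ).1 h.tendsto
    (BoundedContinuousFunction.innerProbChar θ)

/-- If the law of the diffusion started from `ν` becomes normal at time `1`, with the noise alone
accounting for the variance, then either the sample is drowned by the noise or it is deterministic. -/
lemma IsLinearDiffusion.eq_zero_or_eq_dirac {f g : ℝ → ℝ} {Ω : Type*} [MeasurableSpace Ω]
    {ν : Measure (EuclideanSpace ℝ (Fin D))} [IsProbabilityMeasure ν] {v₀ : ℝ} {P : Measure Ω}
    [IsProbabilityMeasure P] {w : ℝ≥0 → Ω → EuclideanSpace ℝ (Fin D)} {U : Ω → EuclideanSpace ℝ (Fin D)}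
    {Z : ℝ → Ω → EuclideanSpace ℝ (Fin D)} (hZ : IsLinearDiffusion f g ν v₀ P w U Z) (hv₀ : 0 < v₀)
    (hf : ContinuousOn f (Ico 0 1)) (hg : ContinuousOn g (Ico 0 1)) {σ₁ : ℝ} (hσ₁ : 0 < σ₁)
    (hσ : Tendsto (fun t => noiseVar f g v₀ t) (𝓝[<] 1) (𝓝 (σ₁ ^ 2)))
    (hZ₁ : TendstoInDistribution Z (𝓝[<] 1) (fun x : EuclideanSpace ℝ (Fin D) => σ₁ • x)
      (fun _ => P) (stdGaussian (EuclideanSpace ℝ (Fin D)))) {r : ℝ}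
    (hr : Tendsto (signalRatio f g v₀) (𝓝[<] 1) (𝓝 r)) :
    r = 0 ∨ ν = Measure.dirac 0 := by
  refine or_iff_not_imp_left.2 fun hr0 => eq_dirac_zero_of_charFun_eq_one fun θ => ?_
  have hmem : ∀ᶠ t in 𝓝[<] (1 : ℝ), t ∈ Ico (0 : ℝ) 1 := by
    filter_upwards [Ioo_mem_nhdsLT (zero_lt_one' ℝ)] with t ht using Ioo_subset_Ico_self ht
  -- The mean coefficient is the signal ratio times the standard deviation of the noise.
  have ha : Tendsto (meanCoeff f) (𝓝[<] 1) (𝓝 (r * σ₁)) := by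
    have h1 := hr.mul hσ.sqrt
    rw [Real.sqrt_sq hσ₁.le] at h1
    refine h1.congr' ?_
    filter_upwards [hmem] with t ht
    rw [← meanCoeff_div_sqrt_noiseVar,
      div_mul_cancel₀ _ (Real.sqrt_pos.2 (IsLinearDiffusion.noiseVar_pos hv₀ ht.1)).ne']
  -- In the limit the noise alone gives the terminal characteristic function; cancelling this
  -- nonzero factor leaves the value `1` for the sample.
  have hlim : ∀ η : 𝔼, charFun ν ((r * σ₁) • η) = 1 := by
    intro η
    have h1 := tendsto_charFun_of_tendstoInDistribution hZ₁ η
    have h2 : Tendsto (fun t => charFun ν (meanCoeff f t • η) *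
        Complex.exp (-((noiseVar f g v₀ t : ℝ) * ‖η‖ ^ 2 / 2))) (𝓝[<] 1)
        (𝓝 (charFun ν ((r * σ₁) • η) * Complex.exp (-((σ₁ ^ 2 : ℝ) * ‖η‖ ^ 2 / 2)))) := by
      refine Tendsto.mul ?_ ?_
      · exact (continuous_charFun.tendsto _).comp (ha.smul_const η)
      · have : Continuous fun v : ℝ => Complex.exp (-((v : ℝ) * ‖η‖ ^ 2 / 2)) := by fun_prop
        exact (this.tendsto _).comp hσ
    have h3 := tendsto_nhds_unique (h1.congr' ?_) h2
    · have hγ := charFun_map_affine_stdGaussian (D := D) 0 (sq_nonneg σ₁) η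
      simp only [zero_add, inner_zero_left, Complex.ofReal_zero, zero_mul, zero_sub,
        Real.sqrt_sq hσ₁.le] at hγ
      rw [hγ] at h3
      exact (mul_eq_right₀ (Complex.exp_ne_zero _)).1 h3.symm
    · filter_upwards [hmem] with t ht
      rw [← charFun_map_snd_jointLaw ν _ (IsLinearDiffusion.noiseVar_pos hv₀ ht.1),
        ← hZ.map_prod_eq_jointLaw hv₀ hf hg ht, Measure.map_map measurable_snd
          (hZ.measurable_sample.prodMk (hZ.measurable t ht))]
      rfl
  have := hlim ((r * σ₁)⁻¹ • θ)
  rwa [smul_smul, mul_inv_cancel₀ (mul_ne_zero hr0 hσ₁.ne'), one_smul] at this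

end Terminal

/-! ### Tools for nonnegative derivatives and extended reals. -/

/-- A nonnegative derivative of a function with finite one-sided limits is automatically integrable,
so no integrability is assumed. -/
lemma lintegral_Ioo_deriv_of_nonneg {a b : ℝ} (hab : a < b) {φ φ' : ℝ → ℝ} {la lb : ℝ}
    (hderiv : ∀ x ∈ Ioo a b, HasDerivAt φ (φ' x) x) (hpos : ∀ x ∈ Ioo a b, 0 ≤ φ' x)
    (ha : Tendsto φ (𝓝[>] a) (𝓝 la)) (hb : Tendsto φ (𝓝[<] b) (𝓝 lb)) :
    ∫⁻ x in Ioo a b, ENNReal.ofReal (φ' x) = ENNReal.ofReal (lb - la) := by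
  have hcont : ContinuousOn φ (Ioo a b) := fun x hx => (hderiv x hx).continuousAt.continuousWithinAt
  have hint : IntegrableOn φ' (Ioc a b) := by
    refine intervalIntegral.integrableOn_deriv_of_nonneg (continuousOn_Icc_extendFrom_Ioo hcont ha hb)
      (fun x hx => (hderiv x hx).congr_of_eventuallyEq ?_) hpos
    filter_upwards [isOpen_Ioo.mem_nhds hx] with y hy
    exact extendFrom_eq (subset_closure hy) (hcont.continuousAt (isOpen_Ioo.mem_nhds hy)).continuousWithinAt
  have h := intervalIntegral.integral_eq_sub_of_hasDerivAt_of_tendsto hab hderiv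
    ((intervalIntegrable_iff_integrableOn_Ioc_of_le hab.le).2 hint) ha hb
  rw [← h, intervalIntegral.integral_of_le hab.le, integral_Ioc_eq_integral_Ioo,
    ofReal_integral_eq_lintegral_ofReal (hint.mono_set Ioo_subset_Ioc_self)]
  exact (ae_restrict_iff' measurableSet_Ioo).2 (ae_of_all _ hpos)

/-- Splitting the constant by sign allows the identity to be integrated in `ℝ≥0∞`; finiteness of `B`
excludes `∞ - ∞` when returning to `EReal`. -/
lemma EReal.coe_sub_coe_eq_of_add_ofReal_eq {A B Φ : ℝ≥0∞} {c : ℝ} (hB : B ≠ ∞)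
    (h : A + ENNReal.ofReal (-c) = B + Φ + ENNReal.ofReal c) :
    (A : EReal) - (B : EReal) = (Φ : EReal) + (c : EReal) := by
  lift B to ℝ≥0 using hB
  by_cases hΦ : Φ = ∞
  · have hA : A = ∞ := by
      by_contra hA
      have : A + ENNReal.ofReal (-c) ≠ ∞ := by simp [hA]
      exact this (by rw [h, hΦ]; simp)
    rw [hA, hΦ]
    rfl
  · have hA : A ≠ ∞ := by
      rintro rfl
      have : (B : ℝ≥0∞) + Φ + ENNReal.ofReal c ≠ ∞ := by simp [hΦ]
      exact this (by rw [← h]; simp)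
    lift A to ℝ≥0 using hA
    lift Φ to ℝ≥0 using hΦ
    have h2 := congrArg ENNReal.toReal h
    rw [ENNReal.toReal_add (by simp) (by simp), ENNReal.toReal_add (by simp) (by simp),
      ENNReal.toReal_add (by simp) (by simp), ENNReal.toReal_ofReal', ENNReal.toReal_ofReal'] at h2
    simp only [ENNReal.coe_toReal] at h2
    have h3 : (A : ℝ) - B = Φ + c := by
      rcases le_total 0 c with h | h
      · rw [max_eq_left h, max_eq_right (by linarith)] at h2; linarith
      · rw [max_eq_right h, max_eq_left (by linarith)] at h2; linarith
    change ((A : ℝ) : EReal) - ((B : ℝ) : EReal) = ((Φ : ℝ) : EReal) + (c : EReal)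
    exact_mod_cast congrArg ((↑) : ℝ → EReal) h3

/-! ### Integrated denoising error and cross entropy. -/

section CrossEntropy

variable {D : ℕ}

local notation "𝔼" => EuclideanSpace ℝ (Fin D)
local notation "γ" => stdGaussian (EuclideanSpace ℝ (Fin D))

variable {f g : ℝ → ℝ} {v₀ : ℝ}

/-- The factor in front of the posterior mean in the integrand of the denoising error. -/
noncomputable def errorWeight (f g : ℝ → ℝ) (v₀ t : ℝ) : ℝ :=
  g t ^ 2 / 2 * (dampingFactor f t / (scaledVar f g t + v₀) ^ 2)

lemma errorWeight_nonneg (f g : ℝ → ℝ) (v₀ t : ℝ) : 0 ≤ errorWeight f g v₀ t := by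
  have : 0 ≤ dampingFactor f t := (Real.exp_pos _).le
  unfold errorWeight
  positivity

lemma continuousOn_errorWeight (hv₀ : 0 < v₀) (hf : ContinuousOn f (Ico 0 1))
    (hg : ContinuousOn g (Ico 0 1)) : ContinuousOn (errorWeight f g v₀) (Ico 0 1) :=
  ((hg.pow 2).div_const 2).mul <| (continuousOn_dampingFactor hf).div
    (((continuousOn_scaledVar hf hg).add continuousOn_const).pow 2)
    fun _ ht => (pow_pos (scaledVar_add_pos hv₀ ht.1) 2).ne'

lemma signalRatio_at_zero (f g : ℝ → ℝ) (v₀ : ℝ) : signalRatio f g v₀ 0 = 1 / √v₀ := by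
  simp [signalRatio, scaledVar]

/-- By the chain rule, the integrand is the time derivative of the free energy along the signal
ratio. -/
lemma lintegral_errorWeight_mul_posteriorMeanSq (hv₀ : 0 < v₀) (hf : ContinuousOn f (Ico 0 1))
    (hg : ContinuousOn g (Ico 0 1)) (β : Measure (EuclideanSpace ℝ (Fin D))) [IsProbabilityMeasure β]
    {r : ℝ} (hr : 0 ≤ r) (hlim : Tendsto (signalRatio f g v₀) (𝓝[<] 1) (𝓝 r)) :
    ∫⁻ t in Ioo (0 : ℝ) 1, ENNReal.ofReal
        (errorWeight f g v₀ t * posteriorMeanSq β (signalRatio f g v₀ t)) =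
      ENNReal.ofReal (freeEnergy β r - freeEnergy β (1 / √v₀)) := by
  have hc := continuousOn_signalRatio hv₀ hf hg
  rw [← signalRatio_at_zero f g]
  refine lintegral_Ioo_deriv_of_nonneg one_pos (φ := fun t => freeEnergy β (signalRatio f g v₀ t))
    (fun t ht => ?_)
    (fun t _ => mul_nonneg (errorWeight_nonneg _ _ _ _) (posteriorMeanSq_nonneg _ _)) ?_ ?_
  · have hS := Real.sqrt_pos.2 (scaledVar_add_pos (f := f) (g := g) hv₀ ht.1.le)
    have h := (hasDerivAt_freeEnergy β (signalRatio_pos (f := f) (g := g) hv₀ ht.1.le)).comp t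
      (hasDerivAt_signalRatio hv₀ hf hg ht)
    refine h.congr_deriv ?_
    have h1 : signalRatio f g v₀ t * √(scaledVar f g t + v₀) = 1 := inv_mul_cancel₀ hS.ne'
    rw [posteriorMeanSq, errorWeight]
    linear_combination (g t ^ 2 / 2 * (dampingFactor f t / (scaledVar f g t + v₀) ^ 2) *
      ∫ ξ, ‖tiltMean β (signalRatio f g v₀ t) ξ‖ ^ 2 ∂γ) * h1
  · have h1 : ContinuousOn (fun t => freeEnergy β (signalRatio f g v₀ t)) (Ico 0 1) :=
      (continuousOn_freeEnergy β).comp hc fun t ht => (signalRatio_pos hv₀ ht.1).le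
    exact ((h1 0 ⟨le_rfl, one_pos⟩).mono_left (nhdsWithin_mono _ Ioo_subset_Ico_self)).mono_left
      (nhdsWithin_Ioo_eq_nhdsGT one_pos).ge
  · refine ((continuousOn_freeEnergy β) r hr).tendsto.comp (tendsto_nhdsWithin_iff.2 ⟨hlim, ?_⟩)
    filter_upwards [Ioo_mem_nhdsLT (zero_lt_one' ℝ)] with t ht using (signalRatio_pos hv₀ ht.1.le).le

variable (q p : Measure (EuclideanSpace ℝ (Fin D))) [IsProbabilityMeasure q] [IsProbabilityMeasure p]

/-- Tonelli exchanges time and sample; for almost every sample the terminal free energy vanishes, so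
only the initial one remains. -/
lemma lintegral_denoisingError (hv₀ : 0 < v₀) (hf : ContinuousOn f (Ico 0 1))
    (hg : ContinuousOn g (Ico 0 1)) {r : ℝ} (hr : 0 ≤ r)
    (hlim : Tendsto (signalRatio f g v₀) (𝓝[<] 1) (𝓝 r))
    (hq : ∀ᵐ z ∂q, freeEnergy (recentered p z) r = 0)
    {ρ : ℝ → EuclideanSpace ℝ (Fin D) → ℝ}
    (hρ : ∀ t ∈ Ico (0 : ℝ) 1, ρ t = mixtureDensity p (meanCoeff f t) (noiseVar f g v₀ t))
    (hρ_smooth : ∀ t ∈ Ico (0 : ℝ) 1, ContDiff ℝ (⊤ : ℕ∞) (fun z => Real.log (ρ t z))) :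
    ∫⁻ t in Icc (0 : ℝ) 1, ENNReal.ofReal (g t ^ 2 / 2) *
        denoisingError q (meanCoeff f t) (noiseVar f g v₀ t) (ρ t) =
      ∫⁻ z, ENNReal.ofReal (-freeEnergy (recentered p z) (1 / √v₀)) ∂q := by
  have h1 : ∀ t ∈ Ioo (0 : ℝ) 1, ENNReal.ofReal (g t ^ 2 / 2) *
      denoisingError q (meanCoeff f t) (noiseVar f g v₀ t) (ρ t) =
      ∫⁻ z, ENNReal.ofReal
        (errorWeight f g v₀ t * posteriorMeanSq (recentered p z) (signalRatio f g v₀ t)) ∂q := by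
    intro t ht
    have ht' := Ioo_subset_Ico_self ht
    have hs := hρ_smooth t ht'
    rw [hρ t ht'] at hs ⊢
    rw [denoisingError_mixtureDensity p q (meanCoeff_pos f t) (IsLinearDiffusion.noiseVar_pos hv₀ ht'.1)
      hs, ← lintegral_const_mul' _ _ ENNReal.ofReal_ne_top]
    refine lintegral_congr fun z => ?_
    rw [← ENNReal.ofReal_mul (by positivity), meanCoeff_div_sqrt_noiseVar, sq_meanCoeff_div_sq_noiseVar,
      ← mul_assoc, errorWeight]
  -- The endpoints are null, and nothing is known about `ρ 1`.
  rw [setLIntegral_congr Ioo_ae_eq_Icc.symm, setLIntegral_congr_fun measurableSet_Ioo h1,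
    lintegral_lintegral_swap]
  · refine lintegral_congr_ae ?_
    filter_upwards [hq] with z hz
    rw [lintegral_errorWeight_mul_posteriorMeanSq hv₀ hf hg _ hr hlim, hz, zero_sub]
  · have hk : AEMeasurable (errorWeight f g v₀) (volume.restrict (Ioo 0 1)) :=
      ((continuousOn_errorWeight hv₀ hf hg).mono Ioo_subset_Ico_self).aemeasurable measurableSet_Ioo
    have hs : AEMeasurable (signalRatio f g v₀) (volume.restrict (Ioo 0 1)) :=
      ((continuousOn_signalRatio hv₀ hf hg).mono Ioo_subset_Ico_self).aemeasurable measurableSet_Ioo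
    exact (hk.comp_fst.mul ((measurable_posteriorMeanSq p).comp_aemeasurable
      (hs.comp_fst.prodMk measurable_snd.aemeasurable))).ennreal_ofReal

/-- An upper bound on the density makes the positive part of its logarithm integrable, so the cross
entropy is never `-∞`. -/
lemma mixtureDensity_le (a : ℝ) {v : ℝ} (hv : 0 < v) (x : 𝔼) :
    mixtureDensity p a v x ≤ (2 * Real.pi * v) ^ (-(D : ℝ) / 2) := by
  have := integral_mono (integrable_normalDensity_smul p a hv x)
    (integrable_const ((2 * Real.pi * v) ^ (-(D : ℝ) / 2))) fun z => normalDensity_le (a • z) hv x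
  simpa [mixtureDensity] using this

lemma lintegral_map_snd_jointLaw_one {v : ℝ} (hv : 0 < v) {h : 𝔼 → ℝ≥0∞} (hh : Measurable h) :
    ∫⁻ x, h x ∂((jointLaw q 1 v).map Prod.snd) = ∫⁻ z, ∫⁻ ξ, h (z + √v • ξ) ∂γ ∂q := by
  have hh2 : Measurable fun x : 𝔼 × 𝔼 => h x.2 := hh.comp measurable_snd
  rw [lintegral_map hh measurable_snd, lintegral_jointLaw q 1 hv hh2]
  simp_rw [one_smul]

theorem crossEntropy_mixtureDensity {v : ℝ} (hv : 0 < v) (hpos : ∀ x, 0 < mixtureDensity p 1 v x) :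
    crossEntropy ((jointLaw q 1 v).map Prod.snd) (mixtureDensity p 1 v) =
      ((∫⁻ z, ENNReal.ofReal (-freeEnergy (recentered p z) (1 / √v)) ∂q : ℝ≥0∞) : EReal) +
        (((D : ℝ) / 2 * Real.log (2 * Real.pi * Real.exp 1 * v) : ℝ) : EReal) := by
  have hlog : Measurable fun x => Real.log (mixtureDensity p 1 v x) :=
    (continuous_mixtureDensity p 1 hv).measurable.log
  have hmeas : Measurable fun y : 𝔼 × 𝔼 =>
      ENNReal.ofReal (Real.log (mixtureDensity p 1 v (y.1 + √v • y.2))) :=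
    hlog.ennreal_ofReal.comp (by fun_prop : Measurable fun y : 𝔼 × 𝔼 => y.1 + √v • y.2)
  have : IsProbabilityMeasure ((jointLaw q 1 v).map Prod.snd) := by
    rw [jointLaw_eq_map q 1 hv, Measure.map_map (by fun_prop) (by fun_prop)]
    exact Measure.isProbabilityMeasure_map (by fun_prop)
  unfold crossEntropy
  refine EReal.coe_sub_coe_eq_of_add_ofReal_eq (ne_top_of_le_ne_top
    (ENNReal.ofReal_ne_top (r := Real.log ((2 * Real.pi * v) ^ (-(D : ℝ) / 2)))) ?_) ?_
  · refine (lintegral_mono fun x => ENNReal.ofReal_le_ofReal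
      (Real.log_le_log (hpos x) (mixtureDensity_le p 1 hv x))).trans ?_
    simp
  · have hneg : Measurable fun x => -Real.log (mixtureDensity p 1 v x) := hlog.neg
    rw [lintegral_map_snd_jointLaw_one q hv hneg.ennreal_ofReal,
      lintegral_map_snd_jointLaw_one q hv hlog.ennreal_ofReal]
    have h := lintegral_congr (μ := q) (lintegral_neg_log_mixtureDensity p hv)
    rw [lintegral_add_right _ measurable_const, lintegral_add_right _ measurable_const,
      lintegral_add_left hmeas.lintegral_prod_right'] at h
    simpa using h

end CrossEntropy

/-! ### The main theorem. -/

theorem theorem1 {D : ℕ} {Ω Ω' : Type*} [MeasurableSpace Ω] [MeasurableSpace Ω']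
    (P : Measure Ω) [IsProbabilityMeasure P] (P' : Measure Ω') [IsProbabilityMeasure P']
    (f g : ℝ → ℝ) (hf : ContinuousOn f (Ico 0 1)) (hg : ContinuousOn g (Ico 0 1))
    (σ₀ σ₁ : ℝ) (hσ₀ : 0 < σ₀) (hσ₁ : 0 < σ₁)
    -- the two initial distributions
    (q p : Measure (EuclideanSpace ℝ (Fin D))) [IsProbabilityMeasure q] [IsProbabilityMeasure p]
    -- the diffusion `Z` started from `q` and the diffusion `Y` started from `p`
    (w : ℝ≥0 → Ω → EuclideanSpace ℝ (Fin D)) (U : Ω → EuclideanSpace ℝ (Fin D))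
    (Z : ℝ → Ω → EuclideanSpace ℝ (Fin D))
    (hZ : IsLinearDiffusion f g q (σ₀ ^ 2) P w U Z)
    (w' : ℝ≥0 → Ω' → EuclideanSpace ℝ (Fin D)) (V : Ω' → EuclideanSpace ℝ (Fin D))
    (Y : ℝ → Ω' → EuclideanSpace ℝ (Fin D))
    (hY : IsLinearDiffusion f g p (σ₀ ^ 2) P' w' V Y)
    -- at `t = 1` both marginals are the normal law `N(0, σ₁² I)`
    (hσ : Tendsto (fun t => noiseVar f g (σ₀ ^ 2) t) (𝓝[<] 1) (𝓝 (σ₁ ^ 2)))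
    (hZ₁ : TendstoInDistribution Z (𝓝[<] 1) (fun x : EuclideanSpace ℝ (Fin D) => σ₁ • x)
      (fun _ => P) (stdGaussian (EuclideanSpace ℝ (Fin D))))
    (hY₁ : TendstoInDistribution Y (𝓝[<] 1) (fun x : EuclideanSpace ℝ (Fin D) => σ₁ • x)
      (fun _ => P') (stdGaussian (EuclideanSpace ℝ (Fin D))))
    -- `ρ t` is the density of `Y t`, positive and with smooth logarithm
    (ρ : ℝ → EuclideanSpace ℝ (Fin D) → ℝ)
    (hρ_pos : ∀ t ∈ Ico (0 : ℝ) 1, ∀ z, 0 < ρ t z)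
    (hρ_smooth : ∀ t ∈ Ico (0 : ℝ) 1, ContDiff ℝ (⊤ : ℕ∞) (fun z => Real.log (ρ t z)))
    (hρ_law : ∀ t ∈ Ico (0 : ℝ) 1,
      P'.map (Y t) = volume.withDensity (fun z => ENNReal.ofReal (ρ t z))) :
    -- the transition kernel from `U` to `Z t` is `N(μ_t(U), σ_t² I)`
    (∀ t ∈ Ico (0 : ℝ) 1, P.map (fun ω => (U ω, Z t ω)) =
      jointLaw q (meanCoeff f t) (noiseVar f g (σ₀ ^ 2) t)) ∧
    -- the cross entropy formula
    crossEntropy (P.map (Z 0)) (ρ 0) =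
      ((∫⁻ t in Icc (0 : ℝ) 1, ENNReal.ofReal (g t ^ 2 / 2) *
          denoisingError q (meanCoeff f t) (noiseVar f g (σ₀ ^ 2) t) (ρ t) : ℝ≥0∞) : EReal) +
        (((D : ℝ) / 2 * Real.log (2 * Real.pi * Real.exp 1 * σ₀ ^ 2) : ℝ) : EReal) := by
  have hv₀ : 0 < σ₀ ^ 2 := by positivity
  refine ⟨fun t ht => hZ.map_prod_eq_jointLaw hv₀ hf hg ht, ?_⟩
  obtain ⟨r, hr, hlim⟩ := exists_tendsto_signalRatio hv₀ hf hg
  -- If the limiting ratio is nonzero, both `q` and `p` are the point mass at `0`. Then `recentered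
  -- p z` is again that mass for `q`-almost every `z`, and its free energy is zero.
  have hq : ∀ᵐ z ∂q, freeEnergy (recentered p z) r = 0 := by
    rcases hZ.eq_zero_or_eq_dirac hv₀ hf hg hσ₁ hσ hZ₁ hlim with h | h
    · exact ae_of_all _ fun z => by rw [h, freeEnergy_zero]
    · rcases hY.eq_zero_or_eq_dirac hv₀ hf hg hσ₁ hσ hY₁ hlim with h' | h'
      · exact ae_of_all _ fun z => by rw [h', freeEnergy_zero]
      · rw [h, ae_dirac_eq, eventually_pure, h', recentered]
        simp_rw [sub_zero]
        rw [Measure.map_id', freeEnergy_dirac_zero]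
  have hρ : ∀ t ∈ Ico (0 : ℝ) 1, ρ t = mixtureDensity p (meanCoeff f t) (noiseVar f g (σ₀ ^ 2) t) := by
    intro t ht
    refine eq_mixtureDensity_of_map_snd p _ (IsLinearDiffusion.noiseVar_pos hv₀ ht.1) (hρ_pos t ht)
      (hρ_smooth t ht).continuous ?_
    rw [← hρ_law t ht, ← hY.map_prod_eq_jointLaw hv₀ hf hg ht,
      Measure.map_map measurable_snd (hY.measurable_sample.prodMk (hY.measurable t ht))]
    rfl
  have h0 : (0 : ℝ) ∈ Ico (0 : ℝ) 1 := ⟨le_rfl, one_pos⟩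
  have hρ0 : ρ 0 = mixtureDensity p 1 (σ₀ ^ 2) := by
    rw [hρ 0 h0]
    congr 1 <;> simp [meanCoeff, noiseVar, dampingFactor]
  have hZ0 : P.map (Z 0) = (jointLaw q 1 (σ₀ ^ 2)).map Prod.snd := by
    rw [← hZ.initial_law, Measure.map_map measurable_snd
      (hZ.measurable_sample.prodMk (hZ.measurable 0 h0))]
    rfl
  rw [lintegral_denoisingError q p hv₀ hf hg hr hlim hq hρ hρ_smooth, hZ0, hρ0,
    crossEntropy_mixtureDensity q p hv₀ fun x => hρ0 ▸ hρ_pos 0 h0 x]
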